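/- Let $H$ be a separable complex Hilbert space, let $M\ge 0$, and let $\mathsf m=(m_1\ge m_2\ge\dots\ge m_M\ge 0)$ be integers, $|\mathsf m|=\sum_i m_i$. Assume that $\dim H$ is at least the number of nonzero $m_i$ (no condition if $H$ is infinite-dimensional). Let $U_0(H)$ be the group of all unitary operators $U$ on $H$ for which $U-\mathbb I$ is compact, with the norm topology. For a Hilbert space $E$ let $E^{\mathsf m}\subset\bigotimes^{|\mathsf m|}E$ be the range of the Young symmetrizer (symmetrization along the rows followed by antisymmetrization along the columns) of the Young diagram whose $k$-th row has length $m_k$, the tensor factors being indexed by the boxes of the diagram; unitary operators $u$ on $E$ act on $E^{\mathsf m}$ by restriction of $u^{\otimes|\mathsf m|}$. Write $U^{\mathsf m}$ for the resulting representation of $U_0(H)$ on $\mathcal H^{\mathsf m}:=H^{\mathsf m}$ and $U_{\mathsf m}$ for that of $U(M)$ on $\mathcal H_{\mathsf m}:=(\mathbb C^M)^{\mathsf m}$. Let $\mathcal F=\exp(H\otimes\mathbb C^M)=\bigoplus_{n\ge 0}\bigotimes^n_s(H\otimes\mathbb C^M)$ be the symmetric Fock space. Let $U_0(H)$ act on $\mathcal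 F$ from the left by the second quantization $U_L(g)=\Gamma(g\otimes\mathbb I)$, and let $U(M)$ act from the right by $U_R(h)=\Gamma(\mathbb I\otimes h^T)$; these actions commute. Rieffel induction from a finite-dimensional unitary representation $\chi$ of $U(M)$ on $V$ yields the induced space $$\{\Phi\in\mathcal F\otimes V:\ (U_R(h^{-1})\otimes \chi(h))\Phi=\Phi\ \text{ for all } h\in U(M)\},$$ on which $U_0(H)$ acts by the restriction of $U_L\otimes\mathbb I$. Then: (1) $U_{\mathsf m}$ is an irreducible continuous unitary representation of $U(M)$, with highest weight $\mathsf m$; (2) $U^{\mathsf m}$ is an irreducible (strongly) continuous unitary representation of $U_0(H)$ on $\mathcal H^{\mathsf m}$; (3) the representation of $U_0(H)$ obtained by Rieffel induction from $U_{\mathsf m}$ is unitarily equivalent to $U^{\mathsf m}$; that is, there is a unitary map from the induced space onto $\mathcal H^{\mathsf m}$ that intertwines the two representations. -/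

import Mathlib

noncomputable section

set_option linter.unusedSectionVars false

namespace FockInduction

open scoped TensorProduct InnerProductSpace ENNReal

/-! ### Hilbert tensor powers -/

section TensorPower

variable (ι : Type) [Fintype ι] (E : Type*) [NormedAddCommGroup E] [InnerProductSpace ℂ E]

/-- The algebraic tensor power of `E` with factors indexed by `ι`, as a separate type that carries
the canonical inner product (and not one of the Banach tensor norms). -/
def AlgTensor : Type _ := ⨂[ℂ] _ : ι, E

instance : AddCommGroup (AlgTensor ι E) := inferInstanceAs (AddCommGroup (⨂[ℂ] _ : ι, E))

instance : Module ℂ (AlgTensor ι E) := inferInstanceAs (Module ℂ (⨂[ℂ] _ : ι, E))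

variable {ι E}

/-- The elementary tensor `⨂ i, f i`. -/
def AlgTensor.tprod : MultilinearMap ℂ (fun _ : ι => E) (AlgTensor ι E) :=
  PiTensorProduct.tprod ℂ

/-- The multilinear form `g ↦ ∏ i, ⟪f i, g i⟫`. -/
def innerForm (f : ι → E) : MultilinearMap ℂ (fun _ : ι => E) ℂ :=
  (MultilinearMap.mkPiAlgebra ℂ ι ℂ).compLinearMap fun i => (innerSL ℂ (f i)).toLinearMap

lemma innerForm_apply (f g : ι → E) : innerForm f g = ∏ i, ⟪f i, g i⟫_ℂ := by
  simp [innerForm]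

lemma innerForm_conj (f g : ι → E) : (starRingEnd ℂ) (innerForm f g) = innerForm g f := by
  simp [innerForm_apply, map_prod]

lemma AlgTensor.span_tprod :
    Submodule.span ℂ (Set.range (AlgTensor.tprod : (ι → E) → AlgTensor ι E)) = ⊤ :=
  PiTensorProduct.span_tprod_eq_top

lemma AlgTensor.induction {p : AlgTensor ι E → Prop} (x : AlgTensor ι E)
    (smul : ∀ (c : ℂ) (f : ι → E), p (c • AlgTensor.tprod f))
    (add : ∀ x y, p x → p y → p (x + y)) : p x :=
  PiTensorProduct.induction_on x (fun c f => smul c f) (fun a b ha hb => add a b ha hb)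

/-- `y ↦ ⟪⨂ i, f i, y⟫`, linear in `y`. -/
def innerLeft (f : ι → E) : AlgTensor ι E →ₗ[ℂ] ℂ := PiTensorProduct.lift (innerForm f)

lemma innerLeft_tprod (f g : ι → E) : innerLeft f (AlgTensor.tprod g) = innerForm f g :=
  PiTensorProduct.lift.tprod g

/-- `f ↦ ⟪y, ⨂ i, f i⟫`, multilinear in `f`. -/
def innerRight (y : AlgTensor ι E) : MultilinearMap ℂ (fun _ : ι => E) ℂ where
  toFun f := (starRingEnd ℂ) (innerLeft f y)
  map_update_add' f i a b := by
    induction y using AlgTensor.induction with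
    | smul c g => simp [innerLeft_tprod, innerForm_conj, mul_add]
    | add x y hx hy => simp only [map_add, hx, hy]; ring
  map_update_smul' f i a b := by
    induction y using AlgTensor.induction with
    | smul c g => simp [innerLeft_tprod, innerForm_conj]; ring
    | add x y hx hy => simp only [map_add, hx, hy, smul_add]

/-- The inner product of `AlgTensor ι E`, conjugate-linear in the first entry. -/
instance : Inner ℂ (AlgTensor ι E) where
  inner x y := PiTensorProduct.lift (innerRight x) y

lemma AlgTensor.inner_def (x y : AlgTensor ι E) :
    ⟪x, y⟫_ℂ = PiTensorProduct.lift (innerRight x) y := rfl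

lemma AlgTensor.inner_tprod_right (x : AlgTensor ι E) (g : ι → E) :
    ⟪x, AlgTensor.tprod g⟫_ℂ = (starRingEnd ℂ) (innerLeft g x) :=
  PiTensorProduct.lift.tprod g

lemma AlgTensor.inner_add_right' (x y z : AlgTensor ι E) :
    ⟪x, y + z⟫_ℂ = ⟪x, y⟫_ℂ + ⟪x, z⟫_ℂ := map_add (PiTensorProduct.lift (innerRight x)) y z

lemma AlgTensor.inner_smul_right' (x y : AlgTensor ι E) (c : ℂ) :
    ⟪x, c • y⟫_ℂ = c * ⟪x, y⟫_ℂ := map_smul (PiTensorProduct.lift (innerRight x)) c y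

/-- The inner product is characterized by
`⟪⨂ i, f i, ⨂ i, g i⟫ = ∏ i, ⟪f i, g i⟫`. -/
theorem AlgTensor.inner_tprod (f g : ι → E) :
    ⟪(AlgTensor.tprod f : AlgTensor ι E), AlgTensor.tprod g⟫_ℂ = ∏ i, ⟪f i, g i⟫_ℂ := by
  rw [AlgTensor.inner_tprod_right, innerLeft_tprod, innerForm_conj, innerForm_apply]

lemma AlgTensor.inner_add_left' (x y z : AlgTensor ι E) :
    ⟪x + y, z⟫_ℂ = ⟪x, z⟫_ℂ + ⟪y, z⟫_ℂ := by
  induction z using AlgTensor.induction with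
  | smul c g => simp only [AlgTensor.inner_smul_right', AlgTensor.inner_tprod_right, map_add, mul_add]
  | add u v hu hv => simp only [AlgTensor.inner_add_right', hu, hv]; ring

lemma AlgTensor.inner_smul_left' (x z : AlgTensor ι E) (c : ℂ) :
    ⟪c • x, z⟫_ℂ = (starRingEnd ℂ) c * ⟪x, z⟫_ℂ := by
  induction z using AlgTensor.induction with
  | smul d g =>
    simp only [AlgTensor.inner_smul_right', AlgTensor.inner_tprod_right, map_smul, smul_eq_mul,
      map_mul]
    ring
  | add u v hu hv => simp only [AlgTensor.inner_add_right', hu, hv]; ring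

lemma AlgTensor.inner_conj (x y : AlgTensor ι E) : (starRingEnd ℂ) ⟪y, x⟫_ℂ = ⟪x, y⟫_ℂ := by
  induction x using AlgTensor.induction with
  | add u v hu hv => simp only [AlgTensor.inner_add_right', AlgTensor.inner_add_left', map_add, hu, hv]
  | smul c f =>
    induction y using AlgTensor.induction with
    | add u v hu hv =>
      simp only [AlgTensor.inner_add_right', AlgTensor.inner_add_left', map_add, hu, hv]
    | smul d g =>
      simp only [AlgTensor.inner_smul_right', AlgTensor.inner_smul_left', map_mul,
        AlgTensor.inner_tprod, map_prod, inner_conj_symm, RingHomCompTriple.comp_apply, RingHom.id_apply]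
      ring

open scoped ComplexOrder in
/-- Products of Gram matrices are positive semidefinite. -/
lemma posSemidef_prod_inner {κ : Type*} [Finite κ] (v : κ → ι → E) :
    (Matrix.of fun k l : κ => ∏ i, ⟪v k i, v l i⟫_ℂ).PosSemidef := by
  classical
  suffices h : ∀ s : Finset ι,
      (Matrix.of fun k l : κ => ∏ i ∈ s, ⟪v k i, v l i⟫_ℂ).PosSemidef from h Finset.univ
  intro s
  induction s using Finset.induction_on with
  | empty =>
    have h := Matrix.posSemidef_gram ℂ (fun _ : κ => (1 : ℂ))
    have e : (Matrix.of fun k l : κ => ∏ i ∈ (∅ : Finset ι), ⟪v k i, v l i⟫_ℂ) =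
        Matrix.gram ℂ (fun _ : κ => (1 : ℂ)) := by
      ext f g
      simp
    rw [e]
    exact h
  | insert a s ha ih =>
    have h := (Matrix.posSemidef_gram ℂ (fun k : κ => v k a)).hadamard ih
    have e : (Matrix.of fun k l : κ => ∏ i ∈ insert a s, ⟪v k i, v l i⟫_ℂ) =
        (Matrix.gram ℂ (fun k : κ => v k a)).hadamard
          (Matrix.of fun k l : κ => ∏ i ∈ s, ⟪v k i, v l i⟫_ℂ) := by
      ext f g
      simp [Finset.prod_insert ha, Matrix.hadamard]
    rw [e]
    exact h

open scoped ComplexOrder in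
lemma AlgTensor.inner_nonneg (x : AlgTensor ι E) : 0 ≤ RCLike.re ⟪x, x⟫_ℂ := by
  have hx : x ∈ Submodule.span ℂ (Set.range (AlgTensor.tprod : (ι → E) → AlgTensor ι E)) := by
    rw [AlgTensor.span_tprod]; trivial
  obtain ⟨n, c, u, rfl⟩ := Submodule.mem_span_set'.1 hx
  choose v hv using fun k => (u k).2
  simp only [← hv]
  have key : ∀ (x : AlgTensor ι E) (u : Fin n → AlgTensor ι E),
      ⟪x, ∑ i, u i⟫_ℂ = ∑ i, ⟪x, u i⟫_ℂ := fun x u =>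
    map_sum (PiTensorProduct.lift (innerRight x)) u _
  have key' : ∀ (x : AlgTensor ι E) (u : Fin n → AlgTensor ι E),
      ⟪∑ i, u i, x⟫_ℂ = ∑ i, ⟪u i, x⟫_ℂ := fun x u => by
    rw [← AlgTensor.inner_conj, key, map_sum]
    simp only [AlgTensor.inner_conj]
  have h := (posSemidef_prod_inner v).dotProduct_mulVec_nonneg c
  have e : ⟪∑ k, c k • (AlgTensor.tprod (v k) : AlgTensor ι E),
      ∑ k, c k • (AlgTensor.tprod (v k) : AlgTensor ι E)⟫_ℂ =
      star c ⬝ᵥ (Matrix.of fun k l => ∏ i, ⟪v k i, v l i⟫_ℂ).mulVec c := by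
    simp only [key', AlgTensor.inner_smul_left', dotProduct, Matrix.mulVec]
    refine Finset.sum_congr rfl fun k _ => ?_
    simp only [key, AlgTensor.inner_smul_right', AlgTensor.inner_tprod, Matrix.of_apply,
      Pi.star_apply, RCLike.star_def]
    congr 1
    exact Finset.sum_congr rfl fun l _ => mul_comm _ _
  rw [e]
  exact (RCLike.le_iff_re_im.1 h).1.trans' (by simp)

instance AlgTensor.core : PreInnerProductSpace.Core ℂ (AlgTensor ι E) where
  conj_inner_symm := AlgTensor.inner_conj
  re_inner_nonneg := AlgTensor.inner_nonneg
  add_left := AlgTensor.inner_add_left'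
  smul_left x y c := AlgTensor.inner_smul_left' x y c

instance : SeminormedAddCommGroup (AlgTensor ι E) :=
  InnerProductSpace.Core.toSeminormedAddCommGroup (𝕜 := ℂ)

instance : InnerProductSpace ℂ (AlgTensor ι E) := InnerProductSpace.ofCore AlgTensor.core

end TensorPower

/-! ### Unitary representations

A unitary representation of a group `G` on `K` is a homomorphism `G →* (K ≃ₗᵢ[ℂ] K)`. -/

section Unitary

variable {A : Type*} [SeminormedAddCommGroup A] [InnerProductSpace ℂ A]

/-- The extension of a unitary operator to the Hilbert space completion. -/
def extendUnitary (A : Type*) [SeminormedAddCommGroup A] [InnerProductSpace ℂ A] :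
    (A ≃ₗᵢ[ℂ] A) →* (UniformSpace.Completion A ≃ₗᵢ[ℂ] UniformSpace.Completion A) :=
  have key : ∀ (u v : A ≃ₗᵢ[ℂ] A) (x : UniformSpace.Completion A),
      (u : A →L[ℂ] A).completion ((v : A →L[ℂ] A).completion x) =
        ((u * v : A ≃ₗᵢ[ℂ] A) : A →L[ℂ] A).completion x := fun u v x => by
    induction x using UniformSpace.Completion.induction_on with
    | hp => exact isClosed_eq (by fun_prop) (by fun_prop)
    | ih a => simp
  have key1 : ∀ x : UniformSpace.Completion A,
      ((1 : A ≃ₗᵢ[ℂ] A) : A →L[ℂ] A).completion x = x := fun x => by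
    induction x using UniformSpace.Completion.induction_on with
    | hp => exact isClosed_eq (by fun_prop) (by fun_prop)
    | ih a => simp
  { toFun u :=
      { toLinearMap := ((u : A →L[ℂ] A).completion).toLinearMap
        invFun := (u⁻¹ : A ≃ₗᵢ[ℂ] A).toContinuousLinearEquiv.toContinuousLinearMap.completion
        left_inv x := (key u⁻¹ u x).trans (by rw [inv_mul_cancel]; exact key1 x)
        right_inv x := (key u u⁻¹ x).trans (by rw [mul_inv_cancel]; exact key1 x)
        norm_map' x := by
          change ‖(u : A →L[ℂ] A).completion x‖ = ‖x‖
          induction x using UniformSpace.Completion.induction_on with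
          | hp => exact isClosed_eq (by fun_prop) (by fun_prop)
          | ih a => simp }
    map_one' := LinearIsometryEquiv.ext key1
    map_mul' u v := LinearIsometryEquiv.ext fun x => (key u v x).symm }

theorem extendUnitary_coe (u : A ≃ₗᵢ[ℂ] A) (a : A) :
    extendUnitary A u (a : UniformSpace.Completion A) = (u a : A) :=
  ContinuousLinearMap.completion_apply_coe (u : A →L[ℂ] A) a

variable {G K : Type*} [Group G] [NormedAddCommGroup K] [InnerProductSpace ℂ K]

/-- The restriction of a unitary representation to an invariant subspace. -/
def restrictRep (ρ : G →* (K ≃ₗᵢ[ℂ] K)) (W : Submodule ℂ K)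
    (hW : ∀ g, ∀ v ∈ W, ρ g v ∈ W) : G →* (W ≃ₗᵢ[ℂ] W) where
  toFun g :=
    { toLinearMap := (ρ g).toLinearEquiv.toLinearMap.restrict (hW g)
      invFun := (ρ g⁻¹).toLinearEquiv.toLinearMap.restrict (hW g⁻¹)
      left_inv x := Subtype.ext (by simp)
      right_inv x := Subtype.ext (by simp)
      norm_map' x := (ρ g).norm_map x }
  map_one' := LinearIsometryEquiv.ext fun x => Subtype.ext (by simp)
  map_mul' g h := LinearIsometryEquiv.ext fun x => Subtype.ext (by simp)

@[simp]
theorem restrictRep_coe (ρ : G →* (K ≃ₗᵢ[ℂ] K)) (W : Submodule ℂ K)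
    (hW : ∀ g, ∀ v ∈ W, ρ g v ∈ W) (g : G) (x : W) :
    ((restrictRep ρ W hW g x : W) : K) = ρ g x := rfl

/-- `ρ` is a (strongly) continuous irreducible unitary representation of the topological group `G`
on the Hilbert space `K`: the space is nonzero and the only closed invariant subspaces are the
trivial ones. -/
def IsIrreducibleUnitaryRep [TopologicalSpace G] (ρ : G →* (K ≃ₗᵢ[ℂ] K)) : Prop :=
  CompleteSpace K ∧ Nontrivial K ∧ (∀ v, Continuous fun g => ρ g v) ∧
    ∀ W : Submodule ℂ K, IsClosed (W : Set K) → (∀ g, ∀ v ∈ W, ρ g v ∈ W) → W = ⊥ ∨ W = ⊤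

/-- Two unitary representations of `G` are unitarily equivalent. -/
def UnitarilyEquivalent {K' : Type*} [NormedAddCommGroup K'] [InnerProductSpace ℂ K']
    (ρ : G →* (K ≃ₗᵢ[ℂ] K)) (ρ' : G →* (K' ≃ₗᵢ[ℂ] K')) : Prop :=
  ∃ T : K ≃ₗᵢ[ℂ] K', ∀ g v, T (ρ g v) = ρ' g (T v)

end Unitary

/-! ### Unitary operators and permutations on Hilbert tensor powers -/

section TensorOperators

variable (ι : Type) [Fintype ι] (E : Type*) [NormedAddCommGroup E] [InnerProductSpace ℂ E]

/-- The Hilbert space tensor power `⨂ i : ι, E`: the separated completion of the algebraic tensor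
power for the inner product `⟪⨂ i, f i, ⨂ i, g i⟫ = ∏ i, ⟪f i, g i⟫`. -/
def HilbertTensor : Type _ := UniformSpace.Completion (AlgTensor ι E)

instance : NormedAddCommGroup (HilbertTensor ι E) :=
  inferInstanceAs (NormedAddCommGroup (UniformSpace.Completion (AlgTensor ι E)))

instance : InnerProductSpace ℂ (HilbertTensor ι E) :=
  inferInstanceAs (InnerProductSpace ℂ (UniformSpace.Completion (AlgTensor ι E)))

instance : CompleteSpace (HilbertTensor ι E) :=
  inferInstanceAs (CompleteSpace (UniformSpace.Completion (AlgTensor ι E)))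

/-- The canonical (isometric, dense) map of the algebraic tensor power into its completion. -/
def toHilbertTensor : AlgTensor ι E →ₗᵢ[ℂ] HilbertTensor ι E :=
  (UniformSpace.Completion.toComplₗᵢ :
    AlgTensor ι E →ₗᵢ[ℂ] UniformSpace.Completion (AlgTensor ι E))

lemma AlgTensor.inner_map_map {T : AlgTensor ι E →ₗ[ℂ] AlgTensor ι E}
    (h : ∀ f g : ι → E, ⟪T (AlgTensor.tprod f), T (AlgTensor.tprod g)⟫_ℂ =
      ⟪(AlgTensor.tprod f : AlgTensor ι E), AlgTensor.tprod g⟫_ℂ) (x y : AlgTensor ι E) :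
    ⟪T x, T y⟫_ℂ = ⟪x, y⟫_ℂ := by
  induction x using AlgTensor.induction with
  | add u v hu hv => simp only [map_add, inner_add_left, hu, hv]
  | smul c f =>
    induction y using AlgTensor.induction with
    | add u v hu hv => simp only [map_add, inner_add_right, hu, hv]
    | smul d g => simp only [map_smul, inner_smul_left, inner_smul_right, h]

variable {ι E} in
lemma AlgTensor.ext_tprod {B : Type*} [AddCommGroup B] [Module ℂ B] {S T : AlgTensor ι E →ₗ[ℂ] B}
    (h : ∀ f : ι → E, S (AlgTensor.tprod f) = T (AlgTensor.tprod f)) (x : AlgTensor ι E) :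
    S x = T x := by
  induction x using AlgTensor.induction with
  | add u v hu hv => simp only [map_add, hu, hv]
  | smul c f => simp only [map_smul, h]

/-- The operator `⨂ i, u` on the algebraic tensor power. -/
def algPower (u : E ≃ₗᵢ[ℂ] E) : AlgTensor ι E →ₗ[ℂ] AlgTensor ι E :=
  PiTensorProduct.map fun _ => u.toLinearEquiv.toLinearMap

lemma algPower_tprod (u : E ≃ₗᵢ[ℂ] E) (f : ι → E) :
    algPower ι E u (AlgTensor.tprod f) = AlgTensor.tprod fun i => u (f i) :=
  PiTensorProduct.map_tprod _ f

/-- The permutation `σ` of the tensor factors, which moves the `i`-th factor to place `σ i`. -/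
def algPerm (σ : Equiv.Perm ι) : AlgTensor ι E →ₗ[ℂ] AlgTensor ι E :=
  (PiTensorProduct.reindex ℂ (fun _ : ι => E) σ).toLinearMap

lemma algPerm_tprod (σ : Equiv.Perm ι) (f : ι → E) :
    algPerm ι E σ (AlgTensor.tprod f) = AlgTensor.tprod fun i => f (σ.symm i) :=
  PiTensorProduct.reindex_tprod σ f

/-- The tensor power representation `u ↦ ⨂ i, u` of the unitary group of `E`. -/
def tensorPower : (E ≃ₗᵢ[ℂ] E) →* (HilbertTensor ι E ≃ₗᵢ[ℂ] HilbertTensor ι E) :=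
  (extendUnitary (AlgTensor ι E)).comp
    { toFun u := LinearEquiv.isometryOfInner
        (LinearEquiv.ofLinearMap (algPower ι E u) (algPower ι E u⁻¹)
          (LinearMap.ext <| AlgTensor.ext_tprod fun f => by simp [algPower_tprod])
          (LinearMap.ext <| AlgTensor.ext_tprod fun f => by simp [algPower_tprod]))
        (AlgTensor.inner_map_map ι E fun f g => by
          simp [algPower_tprod, AlgTensor.inner_tprod])
      map_one' := LinearIsometryEquiv.ext <|
        AlgTensor.ext_tprod (S := algPower ι E 1) (T := LinearMap.id)
          fun f => by simp [algPower_tprod]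
      map_mul' u v := LinearIsometryEquiv.ext <|
        AlgTensor.ext_tprod (S := algPower ι E (u * v)) (T := algPower ι E u ∘ₗ algPower ι E v)
          fun f => by simp [algPower_tprod] }

/-- The representation of the symmetric group by permutations of the tensor factors. -/
def permuteFactors [DecidableEq ι] :
    Equiv.Perm ι →* (HilbertTensor ι E ≃ₗᵢ[ℂ] HilbertTensor ι E) :=
  (extendUnitary (AlgTensor ι E)).comp
    { toFun σ := LinearEquiv.isometryOfInner
        (LinearEquiv.ofLinearMap (algPerm ι E σ) (algPerm ι E σ⁻¹)
          (LinearMap.ext <| AlgTensor.ext_tprod fun f => by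
            simp [algPerm_tprod, ← Equiv.Perm.inv_def])
          (LinearMap.ext <| AlgTensor.ext_tprod fun f => by
            simp [algPerm_tprod, Equiv.Perm.inv_def]))
        (AlgTensor.inner_map_map ι E fun f g => by
          simp only [LinearEquiv.toLinearMap_ofLinearMap, algPerm_tprod, AlgTensor.inner_tprod]
          exact Equiv.prod_comp σ.symm fun i => ⟪f i, g i⟫_ℂ)
      map_one' := LinearIsometryEquiv.ext <|
        AlgTensor.ext_tprod (S := algPerm ι E 1) (T := LinearMap.id)
          fun f => by simp [algPerm_tprod, ← Equiv.Perm.inv_def]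
      map_mul' u v := LinearIsometryEquiv.ext <|
        AlgTensor.ext_tprod (S := algPerm ι E (u * v)) (T := algPerm ι E u ∘ₗ algPerm ι E v)
          fun f => by simp [algPerm_tprod, ← Equiv.Perm.inv_def] }

variable {ι E}

/-- The elementary tensor `⨂ i, f i` in the Hilbert space tensor power. -/
def elementary (f : ι → E) : HilbertTensor ι E := toHilbertTensor ι E (AlgTensor.tprod f)

theorem inner_elementary (f g : ι → E) :
    ⟪elementary f, elementary g⟫_ℂ = ∏ i, ⟪f i, g i⟫_ℂ := by
  rw [elementary, elementary, LinearIsometry.inner_map_map, AlgTensor.inner_tprod]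

theorem denseRange_toHilbertTensor : DenseRange (toHilbertTensor ι E) :=
  UniformSpace.Completion.denseRange_coe (α := AlgTensor ι E)

theorem tensorPower_elementary (u : E ≃ₗᵢ[ℂ] E) (f : ι → E) :
    tensorPower ι E u (elementary f) = elementary fun i => u (f i) := by
  rw [elementary, elementary, ← algPower_tprod]
  exact extendUnitary_coe _ _

theorem permuteFactors_elementary [DecidableEq ι] (σ : Equiv.Perm ι) (f : ι → E) :
    permuteFactors ι E σ (elementary f) = elementary fun i => f (σ.symm i) := by
  rw [elementary, elementary, ← algPerm_tprod]
  exact extendUnitary_coe _ _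

/-- Continuous linear maps on the Hilbert tensor power that agree on elementary tensors agree. -/
theorem ext_elementary {B : Type*} [NormedAddCommGroup B] [NormedSpace ℂ B]
    {S T : HilbertTensor ι E →L[ℂ] B} (h : ∀ f : ι → E, S (elementary f) = T (elementary f))
    (x : HilbertTensor ι E) : S x = T x := by
  refine denseRange_toHilbertTensor.induction_on (p := fun x => S x = T x) x
    (isClosed_eq S.continuous T.continuous) fun a => ?_
  exact AlgTensor.ext_tprod (S := S.toLinearMap ∘ₗ (toHilbertTensor ι E).toLinearMap)
    (T := T.toLinearMap ∘ₗ (toHilbertTensor ι E).toLinearMap) h a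

theorem tensorPower_permuteFactors [DecidableEq ι] (u : E ≃ₗᵢ[ℂ] E) (σ : Equiv.Perm ι)
    (x : HilbertTensor ι E) :
    tensorPower ι E u (permuteFactors ι E σ x) = permuteFactors ι E σ (tensorPower ι E u x) :=
  ext_elementary
    (S := (tensorPower ι E u : HilbertTensor ι E →L[ℂ] HilbertTensor ι E).comp
      (permuteFactors ι E σ : HilbertTensor ι E →L[ℂ] HilbertTensor ι E))
    (T := (permuteFactors ι E σ : HilbertTensor ι E →L[ℂ] HilbertTensor ι E).comp
      (tensorPower ι E u : HilbertTensor ι E →L[ℂ] HilbertTensor ι E))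
    (fun f => by simp [tensorPower_elementary, permuteFactors_elementary]) x

end TensorOperators

/-! ### Young-symmetrized tensors -/

section Young

variable {M : ℕ} (m : Fin M → ℕ) (E : Type*) [NormedAddCommGroup E] [InnerProductSpace ℂ E]

/-- The boxes `(k, j)` of the Young diagram whose `k`-th row has length `m k`;
there are `|m| = ∑ k, m k` of them. -/
abbrev Boxes : Type := Σ k : Fin M, Fin (m k)

/-- The symmetrization over the permutations of the boxes that preserve each row. -/
def rowSymmetrizer : HilbertTensor (Boxes m) E →L[ℂ] HilbertTensor (Boxes m) E :=
  ∑ σ : Equiv.Perm (Boxes m) with ∀ b, (σ b).1 = b.1,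
    (permuteFactors (Boxes m) E σ : HilbertTensor (Boxes m) E →L[ℂ] HilbertTensor (Boxes m) E)

/-- The antisymmetrization over the permutations of the boxes that preserve each column. -/
def columnAntisymmetrizer : HilbertTensor (Boxes m) E →L[ℂ] HilbertTensor (Boxes m) E :=
  ∑ σ : Equiv.Perm (Boxes m) with ∀ b, ((σ b).2 : ℕ) = (b.2 : ℕ),
    ((Equiv.Perm.sign σ : ℤ) : ℂ) •
      (permuteFactors (Boxes m) E σ : HilbertTensor (Boxes m) E →L[ℂ] HilbertTensor (Boxes m) E)

/-- The Young symmetrizer: symmetrize along the rows, then antisymmetrize along the columns. -/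
def youngSymmetrizer : HilbertTensor (Boxes m) E →L[ℂ] HilbertTensor (Boxes m) E :=
  (columnAntisymmetrizer m E).comp (rowSymmetrizer m E)

/-- The subspace of the `|m|`-fold Hilbert tensor power of `E` obtained by symmetrization according
to the Young diagram with rows `m`. -/
def youngSpace : Submodule ℂ (HilbertTensor (Boxes m) E) :=
  LinearMap.range (youngSymmetrizer m E).toLinearMap

/-- The space `youngSpace m E`, as a type with the inner product of the tensor power. -/
def YoungTensors : Type _ := youngSpace m E

instance : NormedAddCommGroup (YoungTensors m E) :=
  inferInstanceAs (NormedAddCommGroup (youngSpace m E))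

instance : InnerProductSpace ℂ (YoungTensors m E) :=
  inferInstanceAs (InnerProductSpace ℂ (youngSpace m E))

lemma tensorPower_youngSymmetrizer (u : E ≃ₗᵢ[ℂ] E) (x : HilbertTensor (Boxes m) E) :
    tensorPower (Boxes m) E u (youngSymmetrizer m E x) =
      youngSymmetrizer m E (tensorPower (Boxes m) E u x) := by
  simp [youngSymmetrizer, rowSymmetrizer, columnAntisymmetrizer, map_sum, tensorPower_permuteFactors]

/-- The restriction of the tensor power representation of the unitary group of `E` to the
Young-symmetrized tensors. -/
def youngRep : (E ≃ₗᵢ[ℂ] E) →* (YoungTensors m E ≃ₗᵢ[ℂ] YoungTensors m E) :=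
  restrictRep (tensorPower (Boxes m) E) (youngSpace m E) (by
    rintro u _ ⟨x, rfl⟩
    exact ⟨tensorPower (Boxes m) E u x, (tensorPower_youngSymmetrizer m E u x).symm⟩)

end Young

/-! ### Symmetric Fock space and second quantization -/

section Fock

/-- The Hilbert direct sum of a sequence of unitary operators. -/
def directSumUnitary (E : ℕ → Type*) [∀ n, NormedAddCommGroup (E n)]
    [∀ n, InnerProductSpace ℂ (E n)] :
    (∀ n, E n ≃ₗᵢ[ℂ] E n) →* (lp E 2 ≃ₗᵢ[ℂ] lp E 2) :=
  have mem : ∀ (u : ∀ n, E n ≃ₗᵢ[ℂ] E n) (x : lp E 2), Memℓp (fun n => u n (x n)) 2 :=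
    fun u x => by
      have h := lp.memℓp x
      rw [memℓp_gen_iff (by norm_num)] at h ⊢
      simpa using h
  { toFun u :=
      { toFun x := ⟨fun n => u n (x n), mem u x⟩
        map_add' x y := lp.ext (funext fun n => map_add (u n) (x n) (y n))
        map_smul' c x := lp.ext (funext fun n => map_smul (u n) c (x n))
        invFun x := ⟨fun n => (u n).symm (x n), mem (fun n => (u n).symm) x⟩
        left_inv x := lp.ext (funext fun n => (u n).symm_apply_apply (x n))
        right_inv x := lp.ext (funext fun n => (u n).apply_symm_apply (x n))
        norm_map' x := by
          rw [lp.norm_eq_tsum_rpow (by norm_num), lp.norm_eq_tsum_rpow (by norm_num)]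
          exact congrArg (· ^ (1 / (2 : ℝ≥0∞).toReal))
            (tsum_congr fun n => congrArg (· ^ (2 : ℝ≥0∞).toReal) ((u n).norm_map (x n))) }
    map_one' := rfl
    map_mul' u v := rfl }

variable (E : Type*) [NormedAddCommGroup E] [InnerProductSpace ℂ E]

/-- The symmetric tensors in the `n`-fold Hilbert tensor power of `E`. -/
def symPower (n : ℕ) : Submodule ℂ (HilbertTensor (Fin n) E) where
  carrier := {x | ∀ σ, permuteFactors (Fin n) E σ x = x}
  zero_mem' σ := map_zero _
  add_mem' hx hy σ := by rw [map_add, hx σ, hy σ]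
  smul_mem' c x hx σ := by rw [map_smul, hx σ]

instance (n : ℕ) : CompleteSpace (symPower E n) := by
  have e : (symPower E n : Set (HilbertTensor (Fin n) E)) =
      ⋂ σ, {x | permuteFactors (Fin n) E σ x = x} := by
    ext x
    simp [symPower]
  have h : IsClosed (symPower E n : Set (HilbertTensor (Fin n) E)) := by
    rw [e]
    exact isClosed_iInter fun σ =>
      isClosed_eq (permuteFactors (Fin n) E σ).continuous continuous_id
  exact h.completeSpace_coe

/-- The symmetric Fock space `exp(E)`: the Hilbert direct sum over `n = 0, 1, 2, …` of the spaces
of symmetric tensors of degree `n`. -/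
def Fock : Type _ := lp (fun n : ℕ => symPower E n) 2

instance : NormedAddCommGroup (Fock E) :=
  inferInstanceAs (NormedAddCommGroup (lp (fun n : ℕ => symPower E n) 2))

instance : InnerProductSpace ℂ (Fock E) :=
  inferInstanceAs (InnerProductSpace ℂ (lp (fun n : ℕ => symPower E n) 2))

instance : CompleteSpace (Fock E) :=
  inferInstanceAs (CompleteSpace (lp (fun n : ℕ => symPower E n) 2))

/-- The restriction of `u ⊗ ⋯ ⊗ u` to the symmetric tensors of degree `n`. -/
def symRep (n : ℕ) : (E ≃ₗᵢ[ℂ] E) →* (symPower E n ≃ₗᵢ[ℂ] symPower E n) :=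
  restrictRep (tensorPower (Fin n) E) (symPower E n) fun u x hx σ => by
    rw [← tensorPower_permuteFactors, hx σ]

/-- Second quantization: the unitary operator `u` on `E` acts on `exp(E)` in degree `n` as the
`n`-fold tensor power of `u`. -/
def secondQuantization : (E ≃ₗᵢ[ℂ] E) →* (Fock E ≃ₗᵢ[ℂ] Fock E) :=
  (directSumUnitary fun n : ℕ => symPower E n).comp (MonoidHom.pi fun n => symRep E n)

end Fock

/-! ### Rieffel induction for a compact group -/

section Rieffel

variable {G K F V : Type*} [Group G] [Group K] [NormedAddCommGroup F] [InnerProductSpace ℂ F]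
  [NormedAddCommGroup V] [InnerProductSpace ℂ V]

/-- The space obtained by Rieffel induction from a representation `χ` of a compact group `K` on a
finite-dimensional Hilbert space `V`, where `UR` is the right action (anti-representation) of `K`
on the Hilbert space `F`: the subspace of `F ⊗ V` on which `UR(h⁻¹) ⊗ χ(h)` is trivial for all
`h ∈ K`. (As `V` is finite-dimensional, the algebraic tensor product `F ⊗ V` with its inner product
is already complete.) -/
def inducedSpace (UR : Kᵐᵒᵖ →* (F ≃ₗᵢ[ℂ] F)) (χ : K →* (V ≃ₗᵢ[ℂ] V)) :
    Submodule ℂ (F ⊗[ℂ] V) where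
  carrier := {Φ | ∀ h : K, TensorProduct.congrIsometry (UR (MulOpposite.op h⁻¹)) (χ h) Φ = Φ}
  zero_mem' h := map_zero _
  add_mem' hx hy h := by rw [map_add, hx h, hy h]
  smul_mem' c x hx h := by rw [map_smul, hx h]

/-- The induced space, as a type with the inner product of `F ⊗ V`. -/
def Induced (UR : Kᵐᵒᵖ →* (F ≃ₗᵢ[ℂ] F)) (χ : K →* (V ≃ₗᵢ[ℂ] V)) : Type _ := inducedSpace UR χ

instance (UR : Kᵐᵒᵖ →* (F ≃ₗᵢ[ℂ] F)) (χ : K →* (V ≃ₗᵢ[ℂ] V)) :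
    NormedAddCommGroup (Induced UR χ) :=
  inferInstanceAs (NormedAddCommGroup (inducedSpace UR χ))

instance (UR : Kᵐᵒᵖ →* (F ≃ₗᵢ[ℂ] F)) (χ : K →* (V ≃ₗᵢ[ℂ] V)) :
    InnerProductSpace ℂ (Induced UR χ) :=
  inferInstanceAs (InnerProductSpace ℂ (inducedSpace UR χ))

/-- The representation `g ↦ UL(g) ⊗ 1` on `F ⊗ V`. -/
def ampliation (UL : G →* (F ≃ₗᵢ[ℂ] F)) (V : Type*) [NormedAddCommGroup V]
    [InnerProductSpace ℂ V] : G →* ((F ⊗[ℂ] V) ≃ₗᵢ[ℂ] (F ⊗[ℂ] V)) where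
  toFun g := TensorProduct.congrIsometry (UL g) 1
  map_one' := LinearIsometryEquiv.ext fun x => by
    induction x using TensorProduct.induction_on with
    | zero => simp
    | add x y hx hy => simp only [map_add, hx, hy]
    | tmul a b => simp; rfl
  map_mul' g h := LinearIsometryEquiv.ext fun x => by
    induction x using TensorProduct.induction_on with
    | zero => simp
    | add x y hx hy => simp only [map_add, hx, hy]
    | tmul a b => simp; rfl

/-- The induced representation of `G`: the restriction of `UL ⊗ 1` to the induced space, where `UL`
is a representation of `G` on `F` that commutes with the right action of `K`. -/
def inducedRep (UL : G →* (F ≃ₗᵢ[ℂ] F)) (UR : Kᵐᵒᵖ →* (F ≃ₗᵢ[ℂ] F)) (χ : K →* (V ≃ₗᵢ[ℂ] V))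
    (hcomm : ∀ g h, Commute (UL g) (UR h)) :
    G →* (Induced UR χ ≃ₗᵢ[ℂ] Induced UR χ) :=
  restrictRep (ampliation UL V) (inducedSpace UR χ) fun g Φ hΦ h => by
    have key : ∀ Ψ : F ⊗[ℂ] V,
        TensorProduct.congrIsometry (UR (MulOpposite.op h⁻¹)) (χ h) (ampliation UL V g Ψ) =
        ampliation UL V g (TensorProduct.congrIsometry (UR (MulOpposite.op h⁻¹)) (χ h) Ψ) :=
      fun Ψ => by
        induction Ψ using TensorProduct.induction_on with
        | zero => simp
        | add x y hx hy => simp only [map_add, hx, hy]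
        | tmul a b =>
          have e := congrArg (fun T : F ≃ₗᵢ[ℂ] F => T a) (hcomm g (MulOpposite.op h⁻¹)).eq
          have e' : UL g (UR (MulOpposite.op h⁻¹) a) = UR (MulOpposite.op h⁻¹) (UL g a) := e
          simp only [ampliation, MonoidHom.coe_mk, OneHom.coe_mk,
            TensorProduct.congrIsometry_apply, TensorProduct.congr_tmul] at *
          change UR _ (UL g a) ⊗ₜ[ℂ] _ = UL g (UR _ a) ⊗ₜ[ℂ] _
          rw [e']
          rfl
    rw [key, hΦ h]

end Rieffel

/-! ### The groups and the bimodule -/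

section Bimodule

/-- The group `U(M)` of unitary `M × M` matrices. -/
abbrev UM (M : ℕ) : Type := Matrix.unitaryGroup (Fin M) ℂ

/-- The defining representation of `U(M)` on `ℂ^M`. -/
def definingUM (M : ℕ) :
    UM M →* (EuclideanSpace ℂ (Fin M) ≃ₗᵢ[ℂ] EuclideanSpace ℂ (Fin M)) :=
  Unitary.linearIsometryEquiv.toMonoidHom.comp
    (Unitary.map
      { toFun := Matrix.toEuclideanCLM (n := Fin M) (𝕜 := ℂ)
        map_one' := map_one _
        map_mul' := map_mul _
        map_star' := map_star _ }).toMonoidHom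

/-- Transposition `h ↦ hᵀ` as an anti-homomorphism of `U(M)`. -/
def transposeUM (M : ℕ) : (UM M)ᵐᵒᵖ →* UM M where
  toFun h := Matrix.UnitaryGroup.transpose h.unop
  map_one' := Subtype.ext (by simp)
  map_mul' g h := Subtype.ext (by simp [Matrix.transpose_mul])

variable (H : Type*) [NormedAddCommGroup H] [InnerProductSpace ℂ H] [CompleteSpace H]

/-- The group `U₀(H)` of all unitary operators `U` on `H` for which `U - 1` is compact, equipped
with the norm topology (the subspace topology from the bounded operators). -/
def U0 : Subgroup (unitary (H →L[ℂ] H)) where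
  carrier := {U | IsCompactOperator ((U : H →L[ℂ] H) - (1 : H →L[ℂ] H))}
  one_mem' := by
    change IsCompactOperator ((1 : H →L[ℂ] H) - 1 : H →L[ℂ] H)
    rw [sub_self]
    exact isCompactOperator_zero
  mul_mem' {U V} hU hV := by
    have e : ((U * V : unitary (H →L[ℂ] H)) : H →L[ℂ] H) - 1 =
        ((U : H →L[ℂ] H) - 1).comp (V : H →L[ℂ] H) + ((V : H →L[ℂ] H) - 1) := by
      ext x; simp
    have h := (IsCompactOperator.comp_clm hU (V : H →L[ℂ] H)).add hV
    change IsCompactOperator _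
    rw [e]
    exact h
  inv_mem' {U} hU := by
    have e : ((U⁻¹ : unitary (H →L[ℂ] H)) : H →L[ℂ] H) - 1 =
        -(((U : H →L[ℂ] H) - 1).comp ((U⁻¹ : unitary (H →L[ℂ] H)) : H →L[ℂ] H)) := by
      have h1 : (U : H →L[ℂ] H) * ((U⁻¹ : unitary (H →L[ℂ] H)) : H →L[ℂ] H) = 1 :=
        congrArg Subtype.val (mul_inv_cancel U)
      change _ = -(((U : H →L[ℂ] H) - 1) * ((U⁻¹ : unitary (H →L[ℂ] H)) : H →L[ℂ] H))
      rw [sub_mul, h1, one_mul, neg_sub]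
    have h := (IsCompactOperator.comp_clm hU ((U⁻¹ : unitary (H →L[ℂ] H)) : H →L[ℂ] H)).neg
    change IsCompactOperator _
    rw [e]
    exact h

/-- The defining representation of `U₀(H)` on `H`. -/
def definingU0 : U0 H →* (H ≃ₗᵢ[ℂ] H) :=
  Unitary.linearIsometryEquiv.toMonoidHom.comp (U0 H).subtype

/-- The one-particle space `S = H ⊗ ℂ^M` with its tensor product inner product (complete, as `ℂ^M`
is finite-dimensional). -/
abbrev OneParticle (M : ℕ) : Type _ := H ⊗[ℂ] EuclideanSpace ℂ (Fin M)

/-- The natural left action `g ↦ g ⊗ 1` of `U₀(H)` on `H ⊗ ℂ^M`. -/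
def leftAction (M : ℕ) : U0 H →* (OneParticle H M ≃ₗᵢ[ℂ] OneParticle H M) :=
  ampliation (definingU0 H) (EuclideanSpace ℂ (Fin M))

/-- The natural right action `h ↦ 1 ⊗ hᵀ` of `U(M)` on `H ⊗ ℂ^M`. -/
def rightAction (M : ℕ) : (UM M)ᵐᵒᵖ →* (OneParticle H M ≃ₗᵢ[ℂ] OneParticle H M) where
  toFun h := TensorProduct.congrIsometry 1 (definingUM M (transposeUM M h))
  map_one' := LinearIsometryEquiv.ext fun x => by
    induction x using TensorProduct.induction_on with
    | zero => simp
    | add x y hx hy => simp only [map_add, hx, hy]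
    | tmul a b => simp; rfl
  map_mul' g h := LinearIsometryEquiv.ext fun x => by
    induction x using TensorProduct.induction_on with
    | zero => simp
    | add x y hx hy => simp only [map_add, hx, hy]
    | tmul a b => simp; rfl

lemma commute_leftAction_rightAction (M : ℕ) (g : U0 H) (h : (UM M)ᵐᵒᵖ) :
    Commute (leftAction H M g) (rightAction H M h) :=
  LinearIsometryEquiv.ext fun x => by
    induction x using TensorProduct.induction_on with
    | zero => simp
    | add x y hx hy => simp only [map_add, hx, hy]
    | tmul a b => simp [leftAction, rightAction, ampliation]; rfl

/-- The left action of `U₀(H)` on the Fock space `exp(H ⊗ ℂ^M)` by second quantization. -/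
def fockLeft (M : ℕ) : U0 H →* (Fock (OneParticle H M) ≃ₗᵢ[ℂ] Fock (OneParticle H M)) :=
  (secondQuantization (OneParticle H M)).comp (leftAction H M)

/-- The right action of `U(M)` on the Fock space `exp(H ⊗ ℂ^M)` by second quantization. -/
def fockRight (M : ℕ) :
    (UM M)ᵐᵒᵖ →* (Fock (OneParticle H M) ≃ₗᵢ[ℂ] Fock (OneParticle H M)) :=
  (secondQuantization (OneParticle H M)).comp (rightAction H M)

lemma commute_fockLeft_fockRight (M : ℕ) (g : U0 H) (h : (UM M)ᵐᵒᵖ) :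
    Commute (fockLeft H M g) (fockRight H M h) :=
  (commute_leftAction_rightAction H M g h).map (secondQuantization (OneParticle H M))

variable {M : ℕ} (m : Fin M → ℕ)

/-- The representation `U_m` of `U(M)`, realized on the Young-symmetrized tensors over `ℂ^M`. -/
def repUM : UM M →*
    (YoungTensors m (EuclideanSpace ℂ (Fin M)) ≃ₗᵢ[ℂ] YoungTensors m (EuclideanSpace ℂ (Fin M))) :=
  (youngRep m (EuclideanSpace ℂ (Fin M))).comp (definingUM M)

/-- The representation `U^m` of `U₀(H)`, realized on the Young-symmetrized tensors over `H`. -/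
def repU0 : U0 H →* (YoungTensors m H ≃ₗᵢ[ℂ] YoungTensors m H) :=
  (youngRep m H).comp (definingU0 H)

/-- The representation of `U₀(H)` obtained from the bimodule `exp(H ⊗ ℂ^M)` by Rieffel induction
from the representation `U_m` of `U(M)`. -/
def rieffelRep : U0 H →*
    (Induced (fockRight H M) (repUM m) ≃ₗᵢ[ℂ] Induced (fockRight H M) (repUM m)) :=
  inducedRep (fockLeft H M) (fockRight H M) (repUM m) (commute_fockLeft_fockRight H M)

end Bimodule

/-! ### Highest weights of representations of `U(M)` -/

section Weights

variable {M : ℕ} {V : Type*} [NormedAddCommGroup V] [InnerProductSpace ℂ V]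

/-- The diagonal matrix with entries `z i` of modulus one, as an element of `U(M)`. -/
def torusUM (z : Fin M → Circle) : UM M :=
  ⟨Matrix.diagonal fun i => (z i : ℂ), by
    rw [Matrix.mem_unitaryGroup_iff, Matrix.star_eq_conjTranspose, Matrix.diagonal_conjTranspose,
      Matrix.diagonal_mul_diagonal, ← Matrix.diagonal_one]
    congr 1
    ext i
    simp [Complex.mul_conj]⟩

/-- The integral weight `l` occurs in the representation `χ` of `U(M)`: there is a nonzero vector
on which each diagonal matrix `diag(z)` acts by the scalar `∏ i, (z i) ^ (l i)`. -/
def HasWeight (χ : UM M →* (V ≃ₗᵢ[ℂ] V)) (l : Fin M → ℤ) : Prop :=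
  ∃ v : V, v ≠ 0 ∧ ∀ z : Fin M → Circle, χ (torusUM z) v = (∏ i, (z i : ℂ) ^ l i) • v

/-- The integral weight `l` is the highest weight of `χ`: it occurs in `χ`, and every weight `l'`
of `χ` satisfies `l' ≤ l`, i.e. `l - l'` is a sum of positive roots `e_i - e_j` (`i < j`); in terms
of partial sums: `l'_1 + ⋯ + l'_k ≤ l_1 + ⋯ + l_k` for all `k`, with equality for `k = M`. -/
def HasHighestWeight (χ : UM M →* (V ≃ₗᵢ[ℂ] V)) (l : Fin M → ℤ) : Prop :=
  HasWeight χ l ∧ ∀ l' : Fin M → ℤ, HasWeight χ l' →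
    (∀ k : Fin M, ∑ i ∈ Finset.Iic k, l' i ≤ ∑ i ∈ Finset.Iic k, l i) ∧ ∑ i, l' i = ∑ i, l i

end Weights

end FockInduction

end

open FockInduction

/-! The proof is a highest weight theory in which complex reflections (a phase on one unit vector,
the identity on its orthogonal complement) play the role of the Lie algebra. They belong to U(M) and
to U₀(H), so both irreducibility statements follow from one theorem about a space E with a frame h,
a family that is orthonormal over the nonempty rows.

Cyclicity: modulo a subspace W, an elementary tensor depends polynomially on a parameter that moves
its entries along a line. If W is invariant under reflections, the phases may therefore be replaced
by arbitrary complex numbers, and row tensors (one vector per row) may be moved by every operator 1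
+ K on a finite-dimensional subspace. This is the unitarian trick. Polarization then yields all
row-symmetrized tensors (`ReflectionInvariant.range_rowSymmetrizer_le`), and column
antisymmetrization makes the highest vector cyclic (`ReflectionInvariant.youngSpace_le`).

Multiplicity one: a column antisymmetric tensor of weight m pairs only with fillings of content m
that have no repetition in a column. For a partition these are the column permutations of the
filling by row numbers, so such a tensor is a multiple of the highest vector
(`eq_smul_highestVector`). The same count with inequalities gives the dominance of weights.

The two facts together give Schur's lemma (`ReflectionEquivariant.exists_smul`). It shows that the
Young symmetrizer is a nonzero multiple of an idempotent, hence that the Young space is closed, and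
that orthogonal projections onto invariant subspaces are trivial.

Induction: the map D x = ∑ I, (x ⊗ e_I) ⊗ Y e_I, which is `coupling (toYoung m)`, inserts the
invariant tensor ∑ I, e_I ⊗ e_I. It therefore takes values in the induced space and intertwines the
actions of U₀(H). By Schur's lemma D†D, compressed to the Young space, is a scalar, so D is a
multiple of an isometry there (`exists_inner_coupling_eq`). Its range is everything
(`eq_zero_of_inner_coupling`): contracting an induced vector Φ with a tensor x over H gives a
U(M)-equivariant operator into the Young space. If Φ is orthogonal to the range of D, multiplicity
one and cyclicity force this operator to vanish, while the scalar matrices in U(M) exclude all Fock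
degrees other than |m|. -/

noncomputable section

set_option linter.unusedSectionVars false

namespace FockInduction

open scoped TensorProduct InnerProductSpace ENNReal

/-! ### Multilinear maps over `ℂ` -/

section Multilinear

variable {ι : Type*} [Fintype ι] {E Q : Type*} [AddCommGroup E] [Module ℂ E]
  [AddCommGroup Q] [Module ℂ Q]

/-- A multilinear map that vanishes on families from a spanning set vanishes. -/
lemma multilinear_eq_zero_of_span (φ : MultilinearMap ℂ (fun _ : ι => E) Q) {S : Set E}
    (hS : Submodule.span ℂ S = ⊤) (h : ∀ f : ι → E, (∀ i, f i ∈ S) → φ f = 0) (f : ι → E) :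
    φ f = 0 := by
  classical
  -- Induction on the set `s` of slots whose entries are arbitrary; each step frees one slot by
  -- linearity in it.
  suffices H : ∀ s : Finset ι, ∀ f : ι → E, (∀ i, i ∉ s → f i ∈ S) → φ f = 0 from
    H Finset.univ f (by simp)
  intro s
  induction s using Finset.induction_on with
  | empty => exact fun f hf => h f fun i => hf i (by simp)
  | insert a s ha ih =>
    intro f hf
    have key : ∀ v ∈ Submodule.span ℂ S, φ (Function.update f a v) = 0 := by
      intro v hv
      induction hv using Submodule.span_induction with
      | mem v hv =>
        refine ih _ fun i hi => ?_
        by_cases hia : i = a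
        · subst hia; simpa using hv
        · rw [Function.update_of_ne hia]
          exact hf i (by simp [hia, hi])
      | zero => simp
      | add x y _ _ hx hy => rw [φ.map_update_add, hx, hy, add_zero]
      | smul c x _ hx => rw [φ.map_update_smul, hx, smul_zero]
    have := key (f a) (by rw [hS]; trivial)
    rwa [Function.update_eq_self] at this

/-- A multilinear map is polynomial along complex lines. -/
lemma multilinear_line_eq_zero (φ : MultilinearMap ℂ (fun _ : ι => E) Q) (x y : ι → E)
    (h : {z : ℂ | φ (x + z • y) = 0}.Infinite) (z : ℂ) : φ (x + z • y) = 0 := by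
  classical
  -- Linear functionals reduce the claim to scalar polynomials and separate the points of any
  -- complex vector space, so `Q` may be a quotient without topology. In the expansion, `s` is the
  -- set of slots that take `x`; the others contribute a factor `z`.
  have key : ∀ l : Module.Dual ℂ Q, ∃ P : Polynomial ℂ, ∀ z, P.eval z = l (φ (x + z • y)) := by
    intro l
    refine ⟨∑ s : Finset ι, Polynomial.C (l (φ (s.piecewise x y))) *
      Polynomial.X ^ (sᶜ).card, fun z => ?_⟩
    rw [φ.map_add_univ, map_sum, Polynomial.eval_finsetSum]
    refine Finset.sum_congr rfl fun s _ => ?_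
    have e : s.piecewise x (z • y) = fun i => (if i ∈ s then (1 : ℂ) else z) • s.piecewise x y i := by
      ext i
      by_cases hi : i ∈ s <;> simp [hi]
    rw [e, φ.map_smul_univ, map_smul, Finset.prod_ite, Finset.prod_const_one, one_mul,
      Finset.prod_const]
    simp only [Polynomial.eval_mul, Polynomial.eval_C, Polynomial.eval_pow, Polynomial.eval_X,
      smul_eq_mul, Finset.filter_notMem_eq_sdiff, Finset.compl_eq_univ_sdiff]
    ring
  refine (Module.forall_dual_apply_eq_zero_iff ℂ _).1 fun l => ?_
  obtain ⟨P, hP⟩ := key l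
  have h0 : P = 0 := P.eq_zero_of_infinite_isRoot (h.mono fun z hz => by
    rw [Set.mem_ofPred_eq] at hz
    simp [Polynomial.IsRoot, hP, hz])
  rw [← hP, h0, Polynomial.eval_zero]

/-- Polarization: if `φ` vanishes on all families that are constant on the fibres of `p`, then its
symmetrization along the fibres of `p` vanishes. -/
lemma multilinear_polarization {κ : Type*} [DecidableEq ι] [DecidableEq κ]
    (φ : MultilinearMap ℂ (fun _ : ι => E) Q) (p : ι → κ)
    (h : ∀ x : κ → E, φ (fun i => x (p i)) = 0) (f : ι → E) :
    ∑ σ : Equiv.Perm ι with ∀ i, p (σ i) = p i, φ (fun i => f (σ i)) = 0 := by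
  -- Insert in each fibre of `p` the sum of those `f i` with `i ∈ S` in that fibre. The expansion
  -- runs over the fibre-preserving maps `J` with values in `S`.
  have h1 : ∀ S : Finset ι, ∑ J : ι → ι with (∀ i, p (J i) = p i) ∧ ∀ i, J i ∈ S,
      φ (fun i => f (J i)) = 0 := by
    intro S
    have := h fun k => ∑ i ∈ S with p i = k, f i
    rw [φ.map_sum_finset] at this
    rw [← this]
    refine Finset.sum_congr ?_ fun _ _ => rfl
    ext J
    simp only [Finset.mem_filter, Finset.mem_univ, true_and, Fintype.mem_piFinset]
    exact ⟨fun h i => ⟨h.2 i, h.1 i⟩, fun h => ⟨fun i => (h i).2, fun i => (h i).1⟩⟩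
  have h2 : ∑ S : Finset ι, ((-1 : ℂ) ^ (Sᶜ).card) •
      ∑ J : ι → ι with (∀ i, p (J i) = p i) ∧ ∀ i, J i ∈ S, φ (fun i => f (J i)) = 0 :=
    Finset.sum_eq_zero fun S _ => by rw [h1, smul_zero]
  -- Inclusion–exclusion over `S`: only surjective `J` survive the alternating sum, and on a finite
  -- set these are the permutations.
  have h3 : ∀ J : ι → ι, (∑ S : Finset ι with ∀ i, J i ∈ S, ((-1 : ℂ) ^ (Sᶜ).card)) =
      if Function.Surjective J then 1 else 0 := by
    intro J
    have e : (∑ S : Finset ι with ∀ i, J i ∈ S, ((-1 : ℂ) ^ (Sᶜ).card)) =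
        ∑ S ∈ (Finset.univ.image J)ᶜ.powerset, ((-1 : ℂ) ^ S.card) := by
      refine Finset.sum_bij' (fun S _ => Sᶜ) (fun S _ => Sᶜ) ?_ ?_ (by simp) (by simp) (by simp)
      · intro S hS
        simp only [Finset.mem_filter, Finset.mem_univ, true_and] at hS
        simp only [Finset.mem_powerset, Finset.compl_subset_compl]
        intro j hj
        obtain ⟨i, -, rfl⟩ := Finset.mem_image.1 hj
        exact hS i
      · intro S hS
        simp only [Finset.mem_powerset] at hS
        simp only [Finset.mem_filter, Finset.mem_univ, true_and, Finset.mem_compl]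
        intro i hi
        simpa using hS hi
    have e2 := congrArg (Int.cast : ℤ → ℂ)
      (Finset.sum_powerset_neg_one_pow_card (x := (Finset.univ.image J)ᶜ))
    push_cast at e2
    rw [e, e2]
    refine if_congr ?_ rfl rfl
    simp [Finset.eq_univ_iff_forall, Function.Surjective]
  have h4 : ∑ J : ι → ι with ∀ i, p (J i) = p i,
      (if Function.Surjective J then (1 : ℂ) else 0) • φ (fun i => f (J i)) = 0 := by
    rw [← h2]
    simp only [Finset.smul_sum, Finset.sum_filter]
    rw [Finset.sum_comm]
    refine Finset.sum_congr rfl fun J _ => ?_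
    by_cases hJ : ∀ i, p (J i) = p i
    · rw [if_pos hJ, ← h3, Finset.sum_smul, Finset.sum_filter]
      exact Finset.sum_congr rfl fun S _ => by by_cases hS : ∀ i, J i ∈ S <;> simp [hJ, hS]
    · simp [hJ]
  rw [← h4]
  simp only [ite_smul, one_smul, zero_smul]
  rw [← Finset.sum_filter, Finset.filter_filter]
  refine Finset.sum_bij (fun σ _ => (σ : ι → ι)) ?_ ?_ ?_ ?_
  · intro σ hσ
    simp only [Finset.mem_filter, Finset.mem_univ, true_and] at hσ ⊢
    exact ⟨hσ, σ.surjective⟩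
  · intro σ _ τ _ e
    exact DFunLike.coe_injective e
  · intro J hJ
    simp only [Finset.mem_filter, Finset.mem_univ, true_and] at hJ
    exact ⟨Equiv.ofBijective J (Finite.surjective_iff_bijective.1 hJ.2), by simpa using hJ.1, rfl⟩
  · intro σ _; rfl

end Multilinear

/-! ### Elementary tensors -/

section Elementary

variable {ι : Type} [Fintype ι] {E : Type*} [NormedAddCommGroup E] [InnerProductSpace ℂ E]

/-- The elementary tensor as a multilinear map. -/
def elementaryMul : MultilinearMap ℂ (fun _ : ι => E) (HilbertTensor ι E) :=
  (toHilbertTensor ι E).toLinearMap.compMultilinearMap AlgTensor.tprod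

lemma elementaryMul_apply (f : ι → E) : elementaryMul f = elementary f := rfl

lemma norm_elementary (f : ι → E) : ‖elementary f‖ = ∏ i, ‖f i‖ := by
  have h : ((‖elementary f‖ : ℂ)) ^ 2 = ((∏ i, ‖f i‖ : ℝ) : ℂ) ^ 2 := by
    have := inner_elementary f f
    simp only [inner_self_eq_norm_sq_to_K] at this
    rw [Finset.prod_pow] at this
    simpa using this
  have h' : ‖elementary f‖ ^ 2 = (∏ i, ‖f i‖) ^ 2 := by exact_mod_cast h
  exact (pow_left_inj₀ (norm_nonneg _) (Finset.prod_nonneg fun i _ => norm_nonneg _) two_ne_zero).1 h'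

lemma continuous_elementary : Continuous (elementary : (ι → E) → HilbertTensor ι E) :=
  MultilinearMap.continuous_of_bound (elementaryMul (ι := ι) (E := E)) 1 fun f => by
    rw [elementaryMul_apply, norm_elementary, one_mul]

lemma mem_of_elementary_mem {W : Submodule ℂ (HilbertTensor ι E)}
    (hW : IsClosed (W : Set (HilbertTensor ι E))) (h : ∀ f : ι → E, elementary f ∈ W)
    (x : HilbertTensor ι E) : x ∈ W := by
  refine denseRange_toHilbertTensor.induction_on (p := fun x => x ∈ W) x hW fun a => ?_
  induction a using AlgTensor.induction with
  | add u v hu hv => rw [map_add]; exact W.add_mem hu hv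
  | smul c f => rw [map_smul]; exact W.smul_mem _ (h f)

/-- A closed subspace that contains the elementary tensors of families from a spanning set is
everything. -/
lemma mem_of_elementary_mem_of_span {W : Submodule ℂ (HilbertTensor ι E)}
    (hW : IsClosed (W : Set (HilbertTensor ι E))) {S : Set E} (hS : Submodule.span ℂ S = ⊤)
    (h : ∀ f : ι → E, (∀ i, f i ∈ S) → elementary f ∈ W) (x : HilbertTensor ι E) : x ∈ W := by
  refine mem_of_elementary_mem hW (fun f => ?_) x
  have := multilinear_eq_zero_of_span (W.mkQ.compMultilinearMap elementaryMul) hS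
    (fun f hf => by simpa [elementaryMul_apply] using h f hf) f
  simpa [elementaryMul_apply] using this

/-- Membership is vanishing modulo `W`, and the class of an elementary tensor modulo `W` is
polynomial along the line. No closedness of `W` is needed. -/
lemma elementary_line_mem (W : Submodule ℂ (HilbertTensor ι E)) (x y : ι → E)
    (h : {z : ℂ | elementary (x + z • y) ∈ W}.Infinite) (z : ℂ) : elementary (x + z • y) ∈ W := by
  have := multilinear_line_eq_zero (W.mkQ.compMultilinearMap elementaryMul) x y
    (by simpa [elementaryMul_apply] using h) z
  simpa [elementaryMul_apply] using this

end Elementary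

/-! ### Complex reflections -/

section Reflection

variable {E : Type*} [NormedAddCommGroup E] [InnerProductSpace ℂ E]

/-- The operator `1 + (z - 1) |e⟩⟨e|`. -/
def scaleAlong (e : E) (z : ℂ) : E →L[ℂ] E :=
  ContinuousLinearMap.id ℂ E + (z - 1) • (innerSL ℂ e).smulRight e

lemma scaleAlong_apply (e : E) (z : ℂ) (v : E) :
    scaleAlong e z v = v + ((z - 1) * ⟪e, v⟫_ℂ) • e := by
  simp [scaleAlong, mul_smul]

lemma scaleAlong_mul {e : E} (he : ‖e‖ = 1) (z w : ℂ) (v : E) :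
    scaleAlong e z (scaleAlong e w v) = scaleAlong e (z * w) v := by
  simp only [scaleAlong_apply, inner_add_right, inner_smul_right, inner_self_eq_norm_sq_to_K, he]
  rw [add_assoc, ← add_smul]
  congr 2
  simp only [RCLike.ofReal_one, one_pow]
  ring

lemma scaleAlong_one (e : E) (v : E) : scaleAlong e 1 v = v := by simp [scaleAlong_apply]

/-- The complex reflection that multiplies the unit vector `e` by the phase `z` and fixes its
orthogonal complement. -/
def complexReflection (e : E) (he : ‖e‖ = 1) (z : Circle) : E ≃ₗᵢ[ℂ] E :=
  LinearEquiv.isometryOfInner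
    (LinearEquiv.ofLinearMap (scaleAlong e z).toLinearMap (scaleAlong e (z⁻¹ : Circle)).toLinearMap
      (LinearMap.ext fun v => by
        change scaleAlong e z (scaleAlong e (z⁻¹ : Circle) v) = v
        rw [scaleAlong_mul he, ← Circle.coe_mul, mul_inv_cancel, Circle.coe_one, scaleAlong_one])
      (LinearMap.ext fun v => by
        change scaleAlong e (z⁻¹ : Circle) (scaleAlong e z v) = v
        rw [scaleAlong_mul he, ← Circle.coe_mul, inv_mul_cancel, Circle.coe_one, scaleAlong_one]))
    (fun x y => by
      change ⟪scaleAlong e z x, scaleAlong e z y⟫_ℂ = _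
      have hz : (starRingEnd ℂ) (z : ℂ) * (z : ℂ) = 1 := by
        rw [mul_comm, Complex.mul_conj, Circle.normSq_coe, Complex.ofReal_one]
      simp only [scaleAlong_apply, inner_add_right, inner_add_left, inner_smul_right,
        inner_smul_left, inner_self_eq_norm_sq_to_K, he, map_mul, map_sub, map_one,
        inner_conj_symm]
      linear_combination (⟪x, e⟫_ℂ * ⟪e, y⟫_ℂ) * hz)

lemma complexReflection_apply (e : E) (he : ‖e‖ = 1) (z : Circle) (v : E) :
    complexReflection e he z v = scaleAlong e z v := rfl

lemma complexReflection_inv (e : E) (he : ‖e‖ = 1) (z : Circle) :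
    (complexReflection e he z)⁻¹ = complexReflection e he z⁻¹ := by
  rw [inv_eq_iff_mul_eq_one]
  refine LinearIsometryEquiv.ext fun v => ?_
  change scaleAlong e z (scaleAlong e (z⁻¹ : Circle) v) = v
  rw [scaleAlong_mul he, ← Circle.coe_mul, mul_inv_cancel, Circle.coe_one, scaleAlong_one]

end Reflection

lemma isClosed_comap_clm {X Y : Type*} [NormedAddCommGroup X] [NormedSpace ℂ X]
    [NormedAddCommGroup Y] [NormedSpace ℂ Y] (T : X →L[ℂ] Y) {W : Submodule ℂ Y}
    (hW : IsClosed (W : Set Y)) : IsClosed (W.comap T.toLinearMap : Set X) :=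
  hW.preimage T.continuous

lemma mem_comap_clm {X Y : Type*} [NormedAddCommGroup X] [NormedSpace ℂ X]
    [NormedAddCommGroup Y] [NormedSpace ℂ Y] (T : X →L[ℂ] Y) {W : Submodule ℂ Y} {x : X} :
    x ∈ W.comap T.toLinearMap ↔ T x ∈ W := Iff.rfl

/-! ### Row and column operations on the boxes -/

section RowColumn

variable {M : ℕ} (m : Fin M → ℕ) {E : Type*} [NormedAddCommGroup E] [InnerProductSpace ℂ E]

lemma rowSymmetrizer_elementary (f : Boxes m → E) :
    rowSymmetrizer m E (elementary f) =
      ∑ σ : Equiv.Perm (Boxes m) with ∀ b, (σ b).1 = b.1, elementary fun b => f (σ b) := by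
  simp only [rowSymmetrizer, sum_apply]
  refine Finset.sum_bij' (fun σ _ => σ⁻¹) (fun σ _ => σ⁻¹) ?_ ?_ (by simp) (by simp) ?_
  · intro σ hσ
    simp only [Finset.mem_filter, Finset.mem_univ, true_and] at hσ ⊢
    intro b
    have := hσ (σ⁻¹ b)
    rw [show σ (σ⁻¹ b) = b from σ.apply_symm_apply b] at this
    exact this.symm
  · intro σ hσ
    simp only [Finset.mem_filter, Finset.mem_univ, true_and] at hσ ⊢
    intro b
    have := hσ (σ⁻¹ b)
    rw [show σ (σ⁻¹ b) = b from σ.apply_symm_apply b] at this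
    exact this.symm
  · intro σ _
    exact permuteFactors_elementary σ f

lemma columnAntisymmetrizer_elementary (f : Boxes m → E) :
    columnAntisymmetrizer m E (elementary f) =
      ∑ σ : Equiv.Perm (Boxes m) with ∀ b, ((σ b).2 : ℕ) = (b.2 : ℕ),
        ((Equiv.Perm.sign σ : ℤ) : ℂ) • elementary fun b => f (σ b) := by
  simp only [columnAntisymmetrizer, sum_apply]
  refine Finset.sum_bij' (fun σ _ => σ⁻¹) (fun σ _ => σ⁻¹) ?_ ?_ (by simp) (by simp) ?_
  · intro σ hσ
    simp only [Finset.mem_filter, Finset.mem_univ, true_and] at hσ ⊢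
    intro b
    have := hσ (σ⁻¹ b)
    rw [show σ (σ⁻¹ b) = b from σ.apply_symm_apply b] at this
    exact this.symm
  · intro σ hσ
    simp only [Finset.mem_filter, Finset.mem_univ, true_and] at hσ ⊢
    intro b
    have := hσ (σ⁻¹ b)
    rw [show σ (σ⁻¹ b) = b from σ.apply_symm_apply b] at this
    exact this.symm
  · intro σ _
    rw [Equiv.Perm.sign_inv]
    exact congrArg _ (permuteFactors_elementary σ f)

lemma tensorPower_columnAntisymmetrizer (u : E ≃ₗᵢ[ℂ] E) (x : HilbertTensor (Boxes m) E) :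
    tensorPower (Boxes m) E u (columnAntisymmetrizer m E x) =
      columnAntisymmetrizer m E (tensorPower (Boxes m) E u x) := by
  simp [columnAntisymmetrizer, map_sum, tensorPower_permuteFactors]

variable {m}

/-- The elementary tensor with the vector `x k` in all boxes of the `k`-th row. -/
def rowTensor (m : Fin M → ℕ) (x : Fin M → E) : HilbertTensor (Boxes m) E :=
  elementary fun b => x b.1

/-- Polarization along the fibres of `b ↦ b.1`, applied modulo `W`, handles elementary tensors;
closedness of `W` gives the rest. -/
lemma rowSymmetrizer_mem {W : Submodule ℂ (HilbertTensor (Boxes m) E)}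
    (hW : IsClosed (W : Set (HilbertTensor (Boxes m) E))) (h : ∀ x : Fin M → E, rowTensor m x ∈ W)
    (t : HilbertTensor (Boxes m) E) : rowSymmetrizer m E t ∈ W := by
  refine mem_of_elementary_mem (W := W.comap (rowSymmetrizer m E).toLinearMap)
    (isClosed_comap_clm _ hW) (fun f => ?_) t
  rw [mem_comap_clm]
  have := multilinear_polarization (W.mkQ.compMultilinearMap elementaryMul)
    (fun b : Boxes m => b.1)
    (fun x => by simpa [elementaryMul_apply, rowTensor] using h x) f
  rw [rowSymmetrizer_elementary, ← Submodule.Quotient.mk_eq_zero, ← Submodule.mkQ_apply, map_sum]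
  exact this

/-- A subspace of the tensor power that is invariant under all complex reflections. -/
def ReflectionInvariant {ι : Type} [Fintype ι] (W : Submodule ℂ (HilbertTensor ι E)) : Prop :=
  ∀ (e : E) (he : ‖e‖ = 1) (z : Circle), ∀ w ∈ W,
    tensorPower ι E (complexReflection e he z) w ∈ W

/-- The vectors `h k` that belong to nonempty rows are orthonormal. -/
def IsRowFrame (m : Fin M → ℕ) (h : Fin M → E) : Prop :=
  ∀ i j, 0 < m i → 0 < m j → ⟪h i, h j⟫_ℂ = if i = j then 1 else 0

lemma boxes_pos (b : Boxes m) : 0 < m b.1 := b.2.pos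

variable {W : Submodule ℂ (HilbertTensor (Boxes m) E)}

lemma rowTensor_line_mem (x y : Fin M → E)
    (h : {z : ℂ | rowTensor m (x + z • y) ∈ W}.Infinite) (z : ℂ) : rowTensor m (x + z • y) ∈ W :=
  elementary_line_mem W (fun b : Boxes m => x b.1) (fun b => y b.1) h z

/-- Invariance gives the claim for `z` on the unit circle. The circle is infinite and the dependence
on `z` is polynomial, so every complex `z` is allowed, even `z = 0`. -/
lemma ReflectionInvariant.scaleAlong_mem (hW : ReflectionInvariant W) {e : E} (he : ‖e‖ = 1)
    {x : Fin M → E} (hx : rowTensor m x ∈ W) (z : ℂ) :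
    rowTensor m (fun k => scaleAlong e z (x k)) ∈ W := by
  have e1 : ∀ z : ℂ, (fun k => scaleAlong e z (x k)) =
      (fun k => x k - ⟪e, x k⟫_ℂ • e) + z • (fun k => ⟪e, x k⟫_ℂ • e) := by
    intro z
    ext k
    simp only [scaleAlong_apply, Pi.add_apply, Pi.smul_apply, smul_smul, sub_mul, sub_smul, one_mul]
    abel
  rw [e1]
  refine rowTensor_line_mem _ _ ?_ z
  have hinf : Infinite Circle := by
    have := (Set.Ioc_infinite (a := -Real.pi) (b := Real.pi) (by linarith [Real.pi_pos])).to_subtype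
    exact Infinite.of_injective _ Circle.argEquiv.symm.injective
  refine (Set.infinite_range_of_injective (f := fun z : Circle => (z : ℂ))
    Circle.coe_injective).mono ?_
  rintro _ ⟨w, rfl⟩
  rw [Set.mem_ofPred_eq, ← e1]
  have := hW e he w _ hx
  rwa [rowTensor, tensorPower_elementary] at this

/-- Compose the scalings by `1 + l i` along the `f i`. By orthogonality each one leaves the
coefficients along the other directions unchanged. -/
lemma ReflectionInvariant.diagonal_mem (hW : ReflectionInvariant W) {κ : Type*} {f : κ → E}
    (hf : Orthonormal ℂ f) {x : Fin M → E} (hx : rowTensor m x ∈ W) (l : κ → ℂ) (s : Finset κ) :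
    rowTensor m (fun k => x k + ∑ i ∈ s, (l i * ⟪f i, x k⟫_ℂ) • f i) ∈ W := by
  classical
  induction s using Finset.induction_on with
  | empty => simpa using hx
  | insert a s ha ih =>
    have := hW.scaleAlong_mem (hf.1 a) ih (1 + l a)
    convert this using 2
    ext k
    have h0 : ∑ i ∈ s, ⟪f a, (l i * ⟪f i, x k⟫_ℂ) • f i⟫_ℂ = 0 := Finset.sum_eq_zero fun i hi => by
      rw [inner_smul_right, hf.2 (ne_of_mem_of_not_mem hi ha).symm, mul_zero]
    rw [scaleAlong_apply, Finset.sum_insert ha, inner_add_right, inner_sum, h0, add_zero,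
      add_sub_cancel_left]
    abel

/-- In an orthonormal eigenbasis of `K` the operator `1 + K` on `F` is of the diagonal form already
treated. -/
lemma ReflectionInvariant.symmetric_mem (hW : ReflectionInvariant W) {F : Submodule ℂ E}
    [FiniteDimensional ℂ F] {K : F →ₗ[ℂ] F} (hK : K.IsSymmetric) {x : Fin M → F}
    (hx : rowTensor m (fun k => (x k : E)) ∈ W) :
    rowTensor m (fun k => (x k : E) + K (x k)) ∈ W := by
  have hf : Orthonormal ℂ fun i => (hK.eigenvectorBasis rfl i : E) :=
    (hK.eigenvectorBasis rfl).orthonormal.comp_linearIsometry F.subtypeₗᵢ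
  have := hW.diagonal_mem hf hx (fun i => (hK.eigenvalues rfl i : ℂ)) Finset.univ
  convert this using 2
  ext k
  congr 1
  conv_lhs => rw [← (hK.eigenvectorBasis rfl).sum_repr' (x k), map_sum]
  simp only [map_smul, hK.apply_eigenvectorBasis, smul_smul, Submodule.coe_sum, Submodule.coe_smul,
    Submodule.coe_inner]
  exact Finset.sum_congr rfl fun i _ => by rw [mul_comm]; rfl

/-- Write `K = K1 + i K2` with symmetric `K1`, `K2`. For real `s` the operator `K1 + s K2` is
symmetric, and polynomial dependence on `s` permits the value `s = i`. -/
lemma ReflectionInvariant.linearMap_mem (hW : ReflectionInvariant W) {F : Submodule ℂ E}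
    [FiniteDimensional ℂ F] (K : F →ₗ[ℂ] F) {x : Fin M → F}
    (hx : rowTensor m (fun k => (x k : E)) ∈ W) :
    rowTensor m (fun k => (x k : E) + K (x k)) ∈ W := by
  set K1 : F →ₗ[ℂ] F := (2⁻¹ : ℂ) • (K + LinearMap.adjoint K) with hK1
  set K2 : F →ₗ[ℂ] F := (2⁻¹ * -Complex.I) • (K - LinearMap.adjoint K) with hK2
  have h1 : K1.IsSymmetric := fun v w => by
    simp only [hK1, LinearMap.smul_apply, LinearMap.add_apply, inner_smul_left, inner_smul_right,
      inner_add_left, inner_add_right, LinearMap.adjoint_inner_left, LinearMap.adjoint_inner_right]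
    simp only [map_inv₀, map_ofNat]
    ring
  have h2 : K2.IsSymmetric := fun v w => by
    simp only [hK2, LinearMap.smul_apply, LinearMap.sub_apply, inner_smul_left, inner_smul_right,
      inner_sub_left, inner_sub_right, LinearMap.adjoint_inner_left, LinearMap.adjoint_inner_right]
    simp only [map_mul, map_neg, Complex.conj_I, map_inv₀, map_ofNat]
    ring
  have hK : ∀ v, K v = K1 v + Complex.I • K2 v := fun v => by
    simp only [hK1, hK2, LinearMap.smul_apply, LinearMap.add_apply, LinearMap.sub_apply, smul_smul]
    have : Complex.I * (2⁻¹ * -Complex.I) = 2⁻¹ := by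
      linear_combination (-2⁻¹ : ℂ) * Complex.I_mul_I
    rw [this, ← smul_add, add_add_sub_cancel, ← two_smul ℂ, smul_smul]
    norm_num
  have key := rowTensor_line_mem (W := W) (m := m) (fun k => (x k : E) + K1 (x k))
    (fun k => (K2 (x k) : E)) ((Set.infinite_range_of_injective Complex.ofReal_injective).mono ?_)
    Complex.I
  · convert key using 2
    ext k
    simp only [hK, Pi.add_apply, Pi.smul_apply, Submodule.coe_add, Submodule.coe_smul]
    abel
  · rintro _ ⟨s, rfl⟩
    have hs : (K1 + (s : ℂ) • K2).IsSymmetric := h1.add (h2.smul (by simp))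
    have := hW.symmetric_mem hs hx
    rw [Set.mem_ofPred_eq]
    convert this using 2
    ext k
    simp only [Pi.add_apply, Pi.smul_apply, LinearMap.add_apply, LinearMap.smul_apply,
      Submodule.coe_add, Submodule.coe_smul]
    abel

/-- The unitarian trick: a reflection invariant subspace that contains the row tensor of a frame
contains all row tensors. -/
lemma ReflectionInvariant.rowTensor_mem (hW : ReflectionInvariant W) {h : Fin M → E}
    (hh : IsRowFrame m h) (hhW : rowTensor m h ∈ W) (x : Fin M → E) : rowTensor m x ∈ W := by
  let F : Submodule ℂ E := Submodule.span ℂ (Set.range h ∪ Set.range x)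
  have : FiniteDimensional ℂ F :=
    FiniteDimensional.span_of_finite ℂ ((Set.finite_range h).union (Set.finite_range x))
  let h' : Fin M → F := fun k => ⟨h k, Submodule.subset_span (Or.inl ⟨k, rfl⟩)⟩
  let x' : Fin M → F := fun k => ⟨x k, Submodule.subset_span (Or.inr ⟨k, rfl⟩)⟩
  -- Chosen so that `1 + K` sends `h k` to `x k` on every nonempty row. The operator `1 + K` need
  -- not be invertible.
  let K : F →ₗ[ℂ] F := ∑ k with 0 < m k,
    ((innerSL ℂ (h' k)).toLinearMap).smulRight (x' k - h' k)
  have key := hW.linearMap_mem K (x := h') hhW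
  convert key using 1
  refine congrArg elementary (funext fun b => ?_)
  have hK : K (h' b.1) = x' b.1 - h' b.1 := by
    simp only [K, LinearMap.sum_apply, LinearMap.smulRight_apply]
    rw [Finset.sum_eq_single b.1]
    · change ⟪h b.1, h b.1⟫_ℂ • _ = _
      rw [hh _ _ (boxes_pos b) (boxes_pos b), if_pos rfl, one_smul]
    · intro k hk hkb
      change ⟪h k, h b.1⟫_ℂ • _ = _
      rw [hh _ _ (by simpa using hk) (boxes_pos b), if_neg hkb, zero_smul]
    · intro hb
      exact absurd (boxes_pos b) (by simpa using hb)
  change x b.1 = h b.1 + (K (h' b.1) : E)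
  rw [hK]
  simp [h', x']

lemma ReflectionInvariant.range_rowSymmetrizer_le (hW : ReflectionInvariant W)
    (hWc : IsClosed (W : Set (HilbertTensor (Boxes m) E))) {h : Fin M → E}
    (hh : IsRowFrame m h) (hhW : rowTensor m h ∈ W) (t : HilbertTensor (Boxes m) E) :
    rowSymmetrizer m E t ∈ W :=
  rowSymmetrizer_mem hWc (hW.rowTensor_mem hh hhW) t

/-- The highest weight vector of the frame `h`. -/
def highestVector (m : Fin M → ℕ) (h : Fin M → E) : HilbertTensor (Boxes m) E :=
  columnAntisymmetrizer m E (rowTensor m h)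

/-- The highest weight vector is cyclic in the space of Young-symmetrized tensors. -/
lemma ReflectionInvariant.youngSpace_le (hW : ReflectionInvariant W)
    (hWc : IsClosed (W : Set (HilbertTensor (Boxes m) E))) {h : Fin M → E}
    (hh : IsRowFrame m h) (hhW : highestVector m h ∈ W) : youngSpace m E ≤ W := by
  -- The column antisymmetrizer commutes with the reflections, so the cyclicity of the row tensor
  -- among row-symmetrized tensors can be applied to the preimage of `W`.
  have h1 : ReflectionInvariant (W.comap (columnAntisymmetrizer m E).toLinearMap) := by
    intro e he z w hw
    rw [mem_comap_clm] at hw ⊢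
    rw [← tensorPower_columnAntisymmetrizer]
    exact hW e he z _ hw
  have h2 := h1.range_rowSymmetrizer_le (isClosed_comap_clm _ hWc) hh
    ((mem_comap_clm _).2 hhW)
  rintro _ ⟨t, rfl⟩
  exact (mem_comap_clm _).1 (h2 t)

end RowColumn

/-! ### Fillings of the boxes -/

section Fillings

variable {M : ℕ} {m : Fin M → ℕ}

lemma box_ext {b b' : Boxes m} (h1 : b.1 = b'.1) (h2 : (b.2 : ℕ) = b'.2) : b = b' := by
  obtain ⟨k, i⟩ := b
  obtain ⟨k', i'⟩ := b'
  dsimp only at h1 h2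
  subst h1
  rw [Fin.ext h2]

/-- The filling `J` has distinct entries in each column. -/
def ColumnInjective (J : Boxes m → Fin M) : Prop :=
  ∀ b b' : Boxes m, (b.2 : ℕ) = b'.2 → J b = J b' → b = b'

/-- The entry `i` occurs `m i` times in the filling `J`. -/
def HasShapeContent (J : Boxes m → Fin M) : Prop :=
  ∀ k, (Finset.univ.filter fun b => J b = k).card = m k

lemma card_row (k : Fin M) : (Finset.univ.filter fun b : Boxes m => b.1 = k).card = m k := by
  have : (Finset.univ.filter fun b : Boxes m => b.1 = k) =
      Finset.univ.map (Function.Embedding.sigmaMk k) := by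
    ext b
    simp only [Finset.mem_filter, Finset.mem_univ, true_and, Finset.mem_map,
      Function.Embedding.sigmaMk_apply]
    constructor
    · rintro rfl; exact ⟨b.2, rfl⟩
    · rintro ⟨i, rfl⟩; rfl
  rw [this]
  simp

lemma card_filter_Iic (J : Boxes m → Fin M) (k : Fin M) :
    (Finset.univ.filter fun b => J b ≤ k).card =
      ∑ i ∈ Finset.Iic k, (Finset.univ.filter fun b => J b = i).card := by
  rw [Finset.card_eq_sum_card_fiberwise (f := J) (t := Finset.Iic k)]
  · refine Finset.sum_congr rfl fun i hi => congrArg _ ?_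
    ext b
    simp only [Finset.mem_filter, Finset.mem_univ, true_and, and_iff_right_iff_imp]
    rintro rfl
    exact Finset.mem_Iic.1 hi
  · intro b hb
    simpa using hb

/-- If column `j` reaches below row `k`, antitonicity of `m` puts a box of it in every row up to
`k`, and injectivity of `J` on the column allows at most that many entries `≤ k`. Otherwise the
whole column lies in rows `≤ k` and the bound is trivial. -/
lemma card_column_le (hm : Antitone m) {J : Boxes m → Fin M} (hJ : ColumnInjective J) (j : ℕ)
    (k : Fin M) :
    (Finset.univ.filter fun b : Boxes m => J b ≤ k ∧ (b.2 : ℕ) = j).card ≤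
      (Finset.univ.filter fun b : Boxes m => b.1 ≤ k ∧ (b.2 : ℕ) = j).card := by
  by_cases h : ∃ b : Boxes m, (b.2 : ℕ) = j ∧ k < b.1
  · obtain ⟨b0, hb0, hk⟩ := h
    have h1 : (Finset.univ.filter fun b : Boxes m => J b ≤ k ∧ (b.2 : ℕ) = j).card ≤
        (Finset.Iic k).card := by
      refine Finset.card_le_card_of_injOn J (fun b hb => ?_) fun b hb b' hb' e => ?_
      · simp only [Finset.coe_filter, Finset.mem_univ, true_and, Set.mem_ofPred_eq] at hb
        simpa using hb.1
      · simp only [Finset.coe_filter, Finset.mem_univ, true_and, Set.mem_ofPred_eq] at hb hb'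
        exact hJ b b' (hb.2.trans hb'.2.symm) e
    refine h1.trans (Finset.card_le_card_of_injOn
      -- The value `b0` is a dummy: `j < m i` holds for every `i ≤ k`.
      (fun i => if hi : j < m i then ⟨i, ⟨j, hi⟩⟩ else b0) (fun i hi => ?_) fun i hi i' hi' e => ?_)
    · have hi' : i ≤ k := by simpa using hi
      have : j < m i := (hb0 ▸ b0.2.2).trans_le (hm (hi'.trans hk.le))
      simp [this, hi']
    · have hi1 : i ≤ k := by simpa using hi
      have hi2 : i' ≤ k := by simpa using hi'
      have h1 : j < m i := (hb0 ▸ b0.2.2).trans_le (hm (hi1.trans hk.le))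
      have h2 : j < m i' := (hb0 ▸ b0.2.2).trans_le (hm (hi2.trans hk.le))
      simp only [h1, h2, dif_pos] at e
      exact congrArg Sigma.fst e
  · push Not at h
    refine Finset.card_le_card fun b hb => ?_
    simp only [Finset.mem_filter, Finset.mem_univ, true_and] at hb ⊢
    exact ⟨h b hb.2, hb.2⟩

lemma card_eq_sum_columns (P : Boxes m → Prop) [DecidablePred P] :
    (Finset.univ.filter P).card = ∑ j ∈ Finset.univ.image (fun b : Boxes m => (b.2 : ℕ)),
      (Finset.univ.filter fun b : Boxes m => P b ∧ (b.2 : ℕ) = j).card := by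
  rw [Finset.card_eq_sum_card_fiberwise (f := fun b : Boxes m => (b.2 : ℕ))
    (t := Finset.univ.image (fun b : Boxes m => (b.2 : ℕ)))]
  · exact Finset.sum_congr rfl fun j _ => by rw [Finset.filter_filter]
  · intro b _
    simp

/-- The content of a column injective filling is dominated by the shape. -/
lemma ColumnInjective.card_le (hm : Antitone m) {J : Boxes m → Fin M} (hJ : ColumnInjective J)
    (k : Fin M) :
    (Finset.univ.filter fun b => J b ≤ k).card ≤
      (Finset.univ.filter fun b : Boxes m => b.1 ≤ k).card := by
  rw [card_eq_sum_columns, card_eq_sum_columns (fun b : Boxes m => b.1 ≤ k)]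
  exact Finset.sum_le_sum fun j _ => card_column_le hm hJ j k

/-- A column injective filling of content `m` arises from the filling by row numbers by a
permutation within the columns. -/
lemma ColumnInjective.exists_perm (hm : Antitone m) {J : Boxes m → Fin M} (hJ : ColumnInjective J)
    (hc : HasShapeContent J) :
    ∃ τ : Equiv.Perm (Boxes m), (∀ b, ((τ b).2 : ℕ) = (b.2 : ℕ)) ∧ ∀ b, (τ b).1 = J b := by
  have hcard : ∀ k, (Finset.univ.filter fun b => J b ≤ k).card =
      (Finset.univ.filter fun b : Boxes m => b.1 ≤ k).card := fun k => by
    rw [card_filter_Iic, card_filter_Iic (fun b : Boxes m => b.1)]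
    exact Finset.sum_congr rfl fun i _ => by rw [hc i, card_row]
  -- The inequality holds in each column and the totals agree, so equality holds in each column.
  have hcol : ∀ (k : Fin M) (b : Boxes m),
      (Finset.univ.filter fun b' : Boxes m => J b' ≤ k ∧ (b'.2 : ℕ) = b.2).card =
        (Finset.univ.filter fun b' : Boxes m => b'.1 ≤ k ∧ (b'.2 : ℕ) = b.2).card := fun k b => by
    have h := hcard k
    rw [card_eq_sum_columns, card_eq_sum_columns (fun b : Boxes m => b.1 ≤ k)] at h
    exact (Finset.sum_eq_sum_iff_of_le fun j _ => card_column_le hm hJ j k).1 h _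
      (Finset.mem_image_of_mem _ (Finset.mem_univ b))
  -- Row `J b` does reach the column of `b`: if `b1` is the lowest box of this column, equality of
  -- the counts at level `b1.1` makes all entries of the column `≤ b1.1`. Hence `b ↦ (J b, column of
  -- b)` is a well-defined map of the boxes.
  have hlt : ∀ b : Boxes m, (b.2 : ℕ) < m (J b) := fun b => by
    obtain ⟨b1, hb1, hmax⟩ := Finset.exists_max_image
      (Finset.univ.filter fun b' : Boxes m => (b'.2 : ℕ) = b.2) (fun b' => b'.1) ⟨b, by simp⟩
    simp only [Finset.mem_filter, Finset.mem_univ, true_and] at hb1 hmax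
    have h1 := hcol b1.1 b
    have h2 : (Finset.univ.filter fun b' : Boxes m => b'.1 ≤ b1.1 ∧ (b'.2 : ℕ) = b.2) =
        Finset.univ.filter fun b' : Boxes m => (b'.2 : ℕ) = b.2 :=
      Finset.filter_congr fun b' _ => ⟨fun h => h.2, fun h => ⟨hmax b' h, h⟩⟩
    rw [h2] at h1
    have h3 : (Finset.univ.filter fun b' : Boxes m => J b' ≤ b1.1 ∧ (b'.2 : ℕ) = b.2) =
        Finset.univ.filter fun b' : Boxes m => (b'.2 : ℕ) = b.2 :=
      Finset.eq_of_subset_of_card_le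
        (fun b' hb' => by
          simp only [Finset.mem_filter, Finset.mem_univ, true_and] at hb' ⊢
          exact hb'.2) h1.ge
    have h4 : b ∈ Finset.univ.filter fun b' : Boxes m => (b'.2 : ℕ) = b.2 := by simp
    rw [← h3] at h4
    simp only [Finset.mem_filter, Finset.mem_univ, true_and, and_true] at h4
    exact (hb1 ▸ b1.2.2 : (b.2 : ℕ) < m b1.1).trans_le (hm h4)
  refine ⟨Equiv.ofBijective (fun b => ⟨J b, ⟨b.2, hlt b⟩⟩)
    (Finite.injective_iff_bijective.1 fun b b' e => ?_), fun b => rfl, fun b => rfl⟩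
  have e1 : J b = J b' := congrArg Sigma.fst e
  have e2 := congrArg (fun x : Boxes m => (x.2 : ℕ)) e
  exact hJ b b' e2 e1

/-- The fibres of `J` and of the row number have equal cardinalities, and bijections between them
glue. It serves to write a basis tensor of content `m` as a permuted row tensor. -/
lemma HasShapeContent.exists_perm {J : Boxes m → Fin M} (hc : HasShapeContent J) :
    ∃ σ : Equiv.Perm (Boxes m), ∀ b, (σ b).1 = J b := by
  have e : ∀ k, Nonempty ({b // J b = k} ≃ {b : Boxes m // b.1 = k}) := fun k => by
    refine ⟨Fintype.equivOfCardEq ?_⟩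
    rw [Fintype.card_subtype, Fintype.card_subtype, hc k, card_row]
  exact ⟨Equiv.ofFiberEquiv fun k => (e k).some,
    fun b => Equiv.ofFiberEquiv_map (fun k => (e k).some) b⟩

lemma eq_one_of_row_column {σ : Equiv.Perm (Boxes m)} (h1 : ∀ b, (σ b).1 = b.1)
    (h2 : ∀ b, ((σ b).2 : ℕ) = (b.2 : ℕ)) : σ = 1 :=
  Equiv.ext fun b => box_ext (h1 b) (h2 b)

end Fillings

/-! ### Symmetrizers and inner products -/

section Symmetrizers

variable {ι : Type} [Fintype ι] {E : Type*} [NormedAddCommGroup E] [InnerProductSpace ℂ E]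

lemma inner_permuteFactors_left [DecidableEq ι] (σ : Equiv.Perm ι) (x y : HilbertTensor ι E) :
    ⟪permuteFactors ι E σ x, y⟫_ℂ = ⟪x, permuteFactors ι E σ⁻¹ y⟫_ℂ := by
  have : permuteFactors ι E σ (permuteFactors ι E σ⁻¹ y) = y := by
    rw [map_inv]; exact (permuteFactors ι E σ).apply_symm_apply y
  conv_lhs => rw [← this]
  exact (permuteFactors ι E σ).inner_map_map _ _

lemma permuteFactors_mul_apply [DecidableEq ι] (σ τ : Equiv.Perm ι) (x : HilbertTensor ι E) :
    permuteFactors ι E (σ * τ) x = permuteFactors ι E σ (permuteFactors ι E τ x) := by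
  rw [map_mul]; rfl

lemma elementary_smul_ite (p : ι → Prop) [DecidablePred p] (z : ℂ) (f : ι → E) :
    elementary (fun i => if p i then z • f i else f i) =
      z ^ (Finset.univ.filter p).card • elementary f := by
  have e : (fun i => if p i then z • f i else f i) =
      fun i => (if p i then z else 1) • f i := by
    ext i; split_ifs <;> simp
  rw [e, ← elementaryMul_apply, MultilinearMap.map_smul_univ, Finset.prod_ite,
    Finset.prod_const_one, mul_one, Finset.prod_const]
  rfl

variable {M : ℕ} {m : Fin M → ℕ}

lemma rowSymmetrizer_apply (x : HilbertTensor (Boxes m) E) :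
    rowSymmetrizer m E x = ∑ σ : Equiv.Perm (Boxes m) with ∀ b, (σ b).1 = b.1,
      permuteFactors (Boxes m) E σ x := by
  simp only [rowSymmetrizer, sum_apply]
  rfl

lemma columnAntisymmetrizer_apply (x : HilbertTensor (Boxes m) E) :
    columnAntisymmetrizer m E x =
      ∑ σ : Equiv.Perm (Boxes m) with ∀ b, ((σ b).2 : ℕ) = (b.2 : ℕ),
        ((Equiv.Perm.sign σ : ℤ) : ℂ) • permuteFactors (Boxes m) E σ x := by
  simp only [columnAntisymmetrizer, sum_apply]
  rfl

lemma row_perm_inv {σ : Equiv.Perm (Boxes m)} (h : ∀ b, (σ b).1 = b.1) (b : Boxes m) :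
    (σ⁻¹ b).1 = b.1 := by
  have := h (σ⁻¹ b)
  rw [show σ (σ⁻¹ b) = b from σ.apply_symm_apply b] at this
  exact this.symm

lemma column_perm_inv {σ : Equiv.Perm (Boxes m)} (h : ∀ b, ((σ b).2 : ℕ) = (b.2 : ℕ))
    (b : Boxes m) : ((σ⁻¹ b).2 : ℕ) = (b.2 : ℕ) := by
  have := h (σ⁻¹ b)
  rw [show σ (σ⁻¹ b) = b from σ.apply_symm_apply b] at this
  exact this.symm

lemma inner_rowSymmetrizer_left (x y : HilbertTensor (Boxes m) E) :
    ⟪rowSymmetrizer m E x, y⟫_ℂ = ⟪x, rowSymmetrizer m E y⟫_ℂ := by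
  rw [rowSymmetrizer_apply, rowSymmetrizer_apply, sum_inner, inner_sum]
  refine Finset.sum_bij' (fun σ _ => σ⁻¹) (fun σ _ => σ⁻¹) ?_ ?_ (by simp) (by simp) ?_
  · intro σ hσ
    simp only [Finset.mem_filter, Finset.mem_univ, true_and] at hσ ⊢
    exact row_perm_inv hσ
  · intro σ hσ
    simp only [Finset.mem_filter, Finset.mem_univ, true_and] at hσ ⊢
    exact row_perm_inv hσ
  · intro σ _
    exact inner_permuteFactors_left σ x y

lemma inner_columnAntisymmetrizer_left (x y : HilbertTensor (Boxes m) E) :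
    ⟪columnAntisymmetrizer m E x, y⟫_ℂ = ⟪x, columnAntisymmetrizer m E y⟫_ℂ := by
  rw [columnAntisymmetrizer_apply, columnAntisymmetrizer_apply, sum_inner, inner_sum]
  refine Finset.sum_bij' (fun σ _ => σ⁻¹) (fun σ _ => σ⁻¹) ?_ ?_ (by simp) (by simp) ?_
  · intro σ hσ
    simp only [Finset.mem_filter, Finset.mem_univ, true_and] at hσ ⊢
    exact column_perm_inv hσ
  · intro σ hσ
    simp only [Finset.mem_filter, Finset.mem_univ, true_and] at hσ ⊢
    exact column_perm_inv hσ
  · intro σ _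
    rw [inner_smul_left, inner_smul_right, inner_permuteFactors_left, Equiv.Perm.sign_inv]
    simp

lemma permuteFactors_rowSymmetrizer {τ : Equiv.Perm (Boxes m)} (hτ : ∀ b, (τ b).1 = b.1)
    (x : HilbertTensor (Boxes m) E) :
    permuteFactors (Boxes m) E τ (rowSymmetrizer m E x) = rowSymmetrizer m E x := by
  rw [rowSymmetrizer_apply, map_sum]
  refine Finset.sum_bij' (fun σ _ => τ * σ) (fun σ _ => τ⁻¹ * σ) ?_ ?_ (by simp) (by simp) ?_
  · intro σ hσ
    simp only [Finset.mem_filter, Finset.mem_univ, true_and] at hσ ⊢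
    exact fun b => (hτ _).trans (hσ b)
  · intro σ hσ
    simp only [Finset.mem_filter, Finset.mem_univ, true_and] at hσ ⊢
    exact fun b => (row_perm_inv hτ _).trans (hσ b)
  · intro σ _
    exact (permuteFactors_mul_apply τ σ x).symm

/-- Antisymmetry under the permutations within the columns. -/
def ColumnAntisymmetric (t : HilbertTensor (Boxes m) E) : Prop :=
  ∀ τ : Equiv.Perm (Boxes m), (∀ b, ((τ b).2 : ℕ) = (b.2 : ℕ)) →
    permuteFactors (Boxes m) E τ t = ((Equiv.Perm.sign τ : ℤ) : ℂ) • t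

lemma columnAntisymmetric_columnAntisymmetrizer (x : HilbertTensor (Boxes m) E) :
    ColumnAntisymmetric (columnAntisymmetrizer m E x) := by
  intro τ hτ
  rw [columnAntisymmetrizer_apply, map_sum, Finset.smul_sum]
  refine Finset.sum_bij' (fun σ _ => τ * σ) (fun σ _ => τ⁻¹ * σ) ?_ ?_ (by simp) (by simp) ?_
  · intro σ hσ
    simp only [Finset.mem_filter, Finset.mem_univ, true_and] at hσ ⊢
    exact fun b => (hτ _).trans (hσ b)
  · intro σ hσ
    simp only [Finset.mem_filter, Finset.mem_univ, true_and] at hσ ⊢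
    exact fun b => (column_perm_inv hτ _).trans (hσ b)
  · intro σ _
    rw [permuteFactors_mul_apply, map_smul, smul_smul, Equiv.Perm.sign_mul]
    congr 1
    have h : ((Equiv.Perm.sign τ : ℤ) : ℂ) * ((Equiv.Perm.sign τ : ℤ) : ℂ) = 1 := by
      rcases Int.units_eq_one_or (Equiv.Perm.sign τ) with h | h <;> simp [h]
    push_cast
    rw [← mul_assoc, h, one_mul]

lemma columnAntisymmetric_of_mem_youngSpace {t : HilbertTensor (Boxes m) E}
    (ht : t ∈ youngSpace m E) : ColumnAntisymmetric t := by
  obtain ⟨x, rfl⟩ := ht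
  exact columnAntisymmetric_columnAntisymmetrizer (rowSymmetrizer m E x)

/-- Swapping the boxes `b` and `b'` fixes `elementary f` and changes the sign of `t`, so the inner
product equals its negative. -/
lemma ColumnAntisymmetric.inner_eq_zero {t : HilbertTensor (Boxes m) E}
    (ht : ColumnAntisymmetric t) {f : Boxes m → E} {b b' : Boxes m} (hbb : b ≠ b')
    (h2 : (b.2 : ℕ) = b'.2) (hf : f b = f b') : ⟪t, elementary f⟫_ℂ = 0 := by
  have e1 : permuteFactors (Boxes m) E (Equiv.swap b b') (elementary f) = elementary f := by
    rw [permuteFactors_elementary]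
    refine congrArg elementary (funext fun b1 => ?_)
    rw [Equiv.symm_swap, Equiv.swap_apply_def]
    split_ifs with hb1 hb2
    · rw [hb1, hf]
    · rw [hb2, hf]
    · rfl
  have e2 := (permuteFactors (Boxes m) E (Equiv.swap b b')).inner_map_map t (elementary f)
  rw [e1, ht _ (fun b1 => by
    rcases eq_or_ne b1 b with rfl | hb1
    · rw [Equiv.swap_apply_left, h2]
    rcases eq_or_ne b1 b' with rfl | hb2
    · rw [Equiv.swap_apply_right, h2]
    · rw [Equiv.swap_apply_of_ne_of_ne hb1 hb2]), Equiv.Perm.sign_swap hbb, inner_smul_left] at e2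
  simp only [Units.val_neg, Units.val_one, Int.cast_neg, Int.cast_one, map_neg, map_one,
    neg_mul, one_mul] at e2
  exact self_eq_neg.1 e2.symm

variable (m) in
/-- The order of the group of row permutations. -/
def rowOrder : ℕ :=
  (Finset.univ.filter fun σ : Equiv.Perm (Boxes m) => ∀ b, (σ b).1 = b.1).card

lemma rowOrder_ne_zero : (rowOrder m : ℂ) ≠ 0 := by
  rw [Nat.cast_ne_zero]
  exact Finset.card_ne_zero.2 ⟨1, by simp⟩

lemma rowSymmetrizer_eq_smul {x : HilbertTensor (Boxes m) E}
    (hx : ∀ τ : Equiv.Perm (Boxes m), (∀ b, (τ b).1 = b.1) → permuteFactors (Boxes m) E τ x = x) :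
    rowSymmetrizer m E x = (rowOrder m : ℂ) • x := by
  rw [rowSymmetrizer_apply, Finset.sum_congr rfl (g := fun _ => x)
    (fun σ hσ => hx σ (by simpa using hσ)), Finset.sum_const, rowOrder, Nat.cast_smul_eq_nsmul]

lemma rowSymmetrizer_rowSymmetrizer (x : HilbertTensor (Boxes m) E) :
    rowSymmetrizer m E (rowSymmetrizer m E x) = (rowOrder m : ℂ) • rowSymmetrizer m E x :=
  rowSymmetrizer_eq_smul fun _ hτ => permuteFactors_rowSymmetrizer hτ x

lemma permuteFactors_rowTensor {τ : Equiv.Perm (Boxes m)} (hτ : ∀ b, (τ b).1 = b.1)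
    (h : Fin M → E) : permuteFactors (Boxes m) E τ (rowTensor m h) = rowTensor m h := by
  rw [rowTensor, permuteFactors_elementary]
  exact congrArg elementary (funext fun b => congrArg h (row_perm_inv hτ b))

lemma rowSymmetrizer_rowTensor (h : Fin M → E) :
    rowSymmetrizer m E (rowTensor m h) = (rowOrder m : ℂ) • rowTensor m h :=
  rowSymmetrizer_eq_smul fun _ hτ => permuteFactors_rowTensor hτ h

lemma youngSymmetrizer_apply (x : HilbertTensor (Boxes m) E) :
    youngSymmetrizer m E x = columnAntisymmetrizer m E (rowSymmetrizer m E x) := rfl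

lemma youngSymmetrizer_mem (x : HilbertTensor (Boxes m) E) :
    youngSymmetrizer m E x ∈ youngSpace m E := ⟨x, rfl⟩

lemma youngSymmetrizer_rowTensor (h : Fin M → E) :
    youngSymmetrizer m E (rowTensor m h) = (rowOrder m : ℂ) • highestVector m h := by
  rw [youngSymmetrizer_apply, rowSymmetrizer_rowTensor, map_smul]
  rfl

lemma highestVector_mem (h : Fin M → E) : highestVector m h ∈ youngSpace m E := by
  have := (youngSpace m E).smul_mem (rowOrder m : ℂ)⁻¹ (youngSymmetrizer_mem (rowTensor m h))
  rwa [youngSymmetrizer_rowTensor, smul_smul, inv_mul_cancel₀ rowOrder_ne_zero, one_smul] at this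

/-- A column permutation contributes only if orthonormality lets it preserve all rows, and a
permutation that preserves rows and columns is the identity. -/
lemma inner_rowTensor_highestVector {h : Fin M → E} (hh : IsRowFrame m h) :
    ⟪rowTensor m h, highestVector m h⟫_ℂ = 1 := by
  rw [highestVector, rowTensor, columnAntisymmetrizer_elementary, inner_sum,
    Finset.sum_eq_single 1]
  · rw [inner_smul_right, inner_elementary, Finset.prod_eq_one]
    · simp
    · intro b _
      exact (hh _ _ (boxes_pos b) (boxes_pos b)).trans (if_pos rfl)
  · intro σ hσ h1
    simp only [Finset.mem_filter, Finset.mem_univ, true_and] at hσ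
    have : ∃ b, (σ b).1 ≠ b.1 := by
      by_contra! h2
      exact h1 (eq_one_of_row_column h2 hσ)
    obtain ⟨b, hb⟩ := this
    rw [inner_smul_right, inner_elementary, Finset.prod_eq_zero (Finset.mem_univ b), mul_zero]
    rw [hh _ _ (boxes_pos b) (boxes_pos _), if_neg hb.symm]
  · simp

end Symmetrizers

/-! ### Weights -/

section Weight

variable {E : Type*} [NormedAddCommGroup E] [InnerProductSpace ℂ E] {M : ℕ} {m : Fin M → ℕ}
  {h : Fin M → E}

lemma circle_zpow_injective {a b : ℤ} (hab : ∀ z : Circle, (z : ℂ) ^ a = (z : ℂ) ^ b) : a = b := by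
  by_contra hne
  have h0 : ((a - b : ℤ) : ℝ) ≠ 0 := by exact_mod_cast sub_ne_zero.2 hne
  -- This phase satisfies `z ^ (a - b) = -1`, against `z ^ (a - b) = 1` from the hypothesis.
  set z : Circle := Circle.exp (Real.pi / ((a - b : ℤ) : ℝ)) with hz
  have h1 : (z : ℂ) ^ (a - b) = 1 := by
    rw [zpow_sub₀ (Circle.coe_ne_zero z), hab, div_self (zpow_ne_zero _ (Circle.coe_ne_zero z))]
  have h2 : (z : ℂ) ^ (a - b) = -1 := by
    rw [hz, Circle.coe_exp, ← Complex.exp_int_mul, ← Complex.exp_pi_mul_I]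
    congr 1
    have h0' : ((a - b : ℤ) : ℂ) ≠ 0 := by exact_mod_cast h0
    push_cast at h0' ⊢
    field_simp
  rw [h1] at h2
  norm_num at h2

/-- `t` is a vector of weight `m` for the torus of the frame `h`. -/
def HasShapeWeight (m : Fin M → ℕ) (h : Fin M → E) (t : HilbertTensor (Boxes m) E) : Prop :=
  ∀ (k : Fin M) (hk : ‖h k‖ = 1), 0 < m k → ∀ z : Circle,
    tensorPower (Boxes m) E (complexReflection (h k) hk z) t = (z : ℂ) ^ m k • t

lemma IsRowFrame.norm_eq_one (hh : IsRowFrame m h) {k : Fin M} (hk : 0 < m k) : ‖h k‖ = 1 := by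
  have h2 : ‖h k‖ ^ 2 = 1 := by
    rw [← inner_self_eq_norm_sq (𝕜 := ℂ), hh k k hk hk, if_pos rfl, RCLike.one_re]
  exact (pow_eq_one_iff_of_nonneg (norm_nonneg _) two_ne_zero).1 h2

lemma IsRowFrame.complexReflection_apply (hh : IsRowFrame m h) {k i : Fin M} (hk : 0 < m k)
    (hi : 0 < m i) (hk1 : ‖h k‖ = 1) (z : Circle) :
    complexReflection (h k) hk1 z (h i) = if i = k then (z : ℂ) • h i else h i := by
  rw [FockInduction.complexReflection_apply, scaleAlong_apply, hh k i hk hi]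
  by_cases hik : i = k
  · subst hik
    rw [if_pos rfl, if_pos rfl, mul_one, sub_smul, one_smul, add_sub_cancel]
  · rw [if_neg hik, if_neg (Ne.symm hik), mul_zero, zero_smul, add_zero]

lemma hasShapeWeight_rowTensor (hh : IsRowFrame m h) : HasShapeWeight m h (rowTensor m h) := by
  intro k hk hmk z
  rw [rowTensor, tensorPower_elementary]
  have : (fun b : Boxes m => complexReflection (h k) hk z (h b.1)) =
      fun b => if b.1 = k then (z : ℂ) • h b.1 else h b.1 :=
    funext fun b => hh.complexReflection_apply hmk (boxes_pos b) hk z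
  rw [this, elementary_smul_ite, card_row]

lemma HasShapeWeight.map {t : HilbertTensor (Boxes m) E} (ht : HasShapeWeight m h t)
    {A : HilbertTensor (Boxes m) E →L[ℂ] HilbertTensor (Boxes m) E}
    (hA : ∀ (e : E) (he : ‖e‖ = 1) (z : Circle) (x : HilbertTensor (Boxes m) E),
      A (tensorPower (Boxes m) E (complexReflection e he z) x) =
        tensorPower (Boxes m) E (complexReflection e he z) (A x)) :
    HasShapeWeight m h (A t) := by
  intro k hk hmk z
  rw [← hA, ht k hk hmk z, map_smul]

lemma hasShapeWeight_highestVector (hh : IsRowFrame m h) :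
    HasShapeWeight m h (highestVector m h) :=
  (hasShapeWeight_rowTensor hh).map fun _ _ _ _ => (tensorPower_columnAntisymmetrizer m _ _).symm

/-- These vectors are eigenvectors of the reflections along the frame, with eigenvalue `z` or `1`,
so their elementary tensors are weight vectors that suffice for testing. -/
lemma span_frame_union_orthogonal (m : Fin M → ℕ) (h : Fin M → E) :
    Submodule.span ℂ ({v | ∃ k, 0 < m k ∧ v = h k} ∪ {v | ∀ k, 0 < m k → ⟪h k, v⟫_ℂ = 0}) = ⊤ := by
  have hfin : ({v | ∃ k, 0 < m k ∧ v = h k} : Set E).Finite :=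
    (Set.finite_range h).subset (by rintro _ ⟨k, -, rfl⟩; exact ⟨k, rfl⟩)
  have := FiniteDimensional.span_of_finite ℂ hfin
  rw [Submodule.span_union, eq_top_iff,
    ← Submodule.sup_orthogonal_of_hasOrthogonalProjection
      (K := Submodule.span ℂ {v | ∃ k, 0 < m k ∧ v = h k})]
  refine sup_le_sup le_rfl fun v hv => Submodule.subset_span fun k hk => ?_
  exact (Submodule.mem_orthogonal _ _).1 hv _ (Submodule.subset_span ⟨k, hk, rfl⟩)

/-- The weight `m` occurs with multiplicity one in the column antisymmetric tensors. -/
lemma eq_zero_of_hasShapeWeight (hm : Antitone m) (hh : IsRowFrame m h)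
    {t : HilbertTensor (Boxes m) E} (ht : ColumnAntisymmetric t) (hw : HasShapeWeight m h t)
    (h0 : ⟪t, rowTensor m h⟫_ℂ = 0) : t = 0 := by
  suffices H : ∀ x, x ∈ (ℂ ∙ t)ᗮ from
    inner_self_eq_zero.1 (Submodule.mem_orthogonal_singleton_iff_inner_right.1 (H t))
  refine mem_of_elementary_mem_of_span (Submodule.isClosed_orthogonal _)
    (span_frame_union_orthogonal m h) fun f hf => ?_
  rw [Submodule.mem_orthogonal_singleton_iff_inner_right]
  by_contra hne
  classical
  -- The reflection along `h k` multiplies `t` by `z ^ m k` and `elementary f` by `z` to the number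
  -- of occurrences of `h k`. A nonzero inner product forces the two powers to agree for all phases.
  have hcard : ∀ k, 0 < m k → (Finset.univ.filter fun b => f b = h k).card = m k := by
    intro k hk
    have hk1 := hh.norm_eq_one hk
    have : ∀ z : Circle, (z : ℂ) ^ (((Finset.univ.filter fun b => f b = h k).card : ℕ) : ℤ) =
        (z : ℂ) ^ ((m k : ℕ) : ℤ) := by
      intro z
      have e1 : tensorPower (Boxes m) E (complexReflection (h k) hk1 z) (elementary f) =
          (z : ℂ) ^ (Finset.univ.filter fun b => f b = h k).card • elementary f := by
        rw [tensorPower_elementary, ← elementary_smul_ite]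
        refine congrArg elementary (funext fun b => ?_)
        rcases hf b with ⟨i, hi, hfi⟩ | hb
        · rw [hfi, hh.complexReflection_apply hk hi hk1]
          refine if_congr ⟨fun e => by rw [e], fun e => ?_⟩ rfl rfl
          by_contra hik
          have := hh i k hi hk
          rw [e, if_neg hik] at this
          rw [inner_self_eq_zero.1 this] at hk1
          simp at hk1
        · rw [complexReflection_apply, scaleAlong_apply, hb k hk, mul_zero, zero_smul, add_zero,
            if_neg]
          intro e
          have := hb k hk
          rw [e] at this
          rw [inner_self_eq_zero.1 this] at hk1
          simp at hk1
      have e2 := (tensorPower (Boxes m) E (complexReflection (h k) hk1 z)).inner_map_map t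
        (elementary f)
      rw [e1, hw k hk1 hk z, inner_smul_left, inner_smul_right, ← mul_assoc] at e2
      have e3 := mul_right_cancel₀ hne (e2.trans (one_mul _).symm)
      have e4 : (starRingEnd ℂ) ((z : ℂ) ^ m k) * (z : ℂ) ^ m k = 1 := by
        rw [map_pow, ← mul_pow, mul_comm, Complex.mul_conj, Circle.normSq_coe,
          Complex.ofReal_one, one_pow]
      have e5 : (starRingEnd ℂ) ((z : ℂ) ^ m k) ≠ 0 := left_ne_zero_of_mul_eq_one e4
      rw [zpow_natCast, zpow_natCast]
      exact mul_left_cancel₀ e5 (e3.trans e4.symm)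
    exact_mod_cast circle_zpow_injective this
  -- The occurrences of the frame vectors already add up to the number of boxes, so no entry of `f`
  -- is left for the orthogonal complement.
  have hall : ∀ b, ∃ k, 0 < m k ∧ f b = h k := by
    have hU : ((Finset.univ.filter fun k => 0 < m k).biUnion
        fun k => Finset.univ.filter fun b => f b = h k) = (Finset.univ : Finset (Boxes m)) := by
      refine Finset.eq_univ_of_card _ ?_
      rw [Finset.card_biUnion]
      · rw [Finset.sum_congr rfl fun k hk => hcard k (by simpa using hk), Fintype.card_sigma]
        simp only [Fintype.card_fin]
        refine Finset.sum_subset (Finset.subset_univ _) fun k _ hk => ?_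
        simpa using hk
      · intro i hi k hk hik
        refine Finset.disjoint_left.2 fun b hb1 hb2 => ?_
        simp only [Finset.mem_filter, Finset.mem_univ, true_and] at hb1 hb2
        simp only [Finset.coe_filter, Finset.mem_univ, true_and, Set.mem_ofPred_eq] at hi hk
        have := hh i k hi hk
        have hk1 := hh.norm_eq_one hk
        rw [← hb1, hb2, if_neg hik] at this
        rw [inner_self_eq_zero.1 this] at hk1
        simp at hk1
    intro b
    have hb := Finset.mem_univ b
    rw [← hU] at hb
    simpa using hb
  choose J hJ0 hJ using hall
  have hc : HasShapeContent J := by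
    intro k
    by_cases hk : 0 < m k
    · rw [← hcard k hk]
      refine congrArg _ (Finset.filter_congr fun b _ => ⟨fun e => by rw [hJ, e], fun e => ?_⟩)
      by_contra hne'
      have := hh _ _ (hJ0 b) hk
      have hk1 := hh.norm_eq_one hk
      rw [← hJ, e, if_neg hne'] at this
      rw [inner_self_eq_zero.1 this] at hk1
      simp at hk1
    · rw [Nat.eq_zero_of_not_pos hk, Finset.card_eq_zero, Finset.filter_eq_empty_iff]
      rintro b - rfl
      exact hk (hJ0 b)
  have hinj : ColumnInjective J := by
    intro b b' h2 e
    by_contra hbb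
    exact hne (ht.inner_eq_zero hbb h2 (by rw [hJ, hJ, e]))
  -- Thus `elementary f` is a column permutation of the row tensor. Such a permutation changes `t`
  -- only by a sign, and `t` is orthogonal to the row tensor.
  obtain ⟨τ, hτ, hτJ⟩ := hinj.exists_perm hm hc
  have e1 : elementary f = permuteFactors (Boxes m) E τ⁻¹ (rowTensor m h) := by
    rw [rowTensor, permuteFactors_elementary]
    refine congrArg elementary (funext fun b => ?_)
    rw [hJ, ← hτJ]
    rfl
  rw [e1, ← inner_permuteFactors_left, ht τ hτ, inner_smul_left, h0, mul_zero] at hne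
  exact hne rfl

/-- The difference of the two sides keeps the weight and the antisymmetry, and it is orthogonal to
the row tensor because the highest vector has inner product 1 with it. -/
lemma eq_smul_highestVector (hm : Antitone m) (hh : IsRowFrame m h)
    {t : HilbertTensor (Boxes m) E} (ht : ColumnAntisymmetric t) (hw : HasShapeWeight m h t) :
    t = ⟪rowTensor m h, t⟫_ℂ • highestVector m h := by
  have hv : ColumnAntisymmetric (highestVector m h) :=
    columnAntisymmetric_columnAntisymmetrizer (rowTensor m h)
  rw [← sub_eq_zero]
  refine eq_zero_of_hasShapeWeight hm hh (fun τ hτ => ?_) (fun k hk hmk z => ?_) ?_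
  · rw [map_sub, map_smul, ht τ hτ, hv τ hτ, smul_sub, smul_comm]
  · rw [map_sub, map_smul, hw k hk hmk z, hasShapeWeight_highestVector hh k hk hmk z, smul_sub,
      smul_comm]
  · rw [← inner_conj_symm, inner_sub_right, inner_smul_right, inner_rowTensor_highestVector hh,
      mul_one, sub_self, map_zero]

end Weight

/-! ### Schur's lemma and irreducibility -/

section Schur

variable {E : Type*} [NormedAddCommGroup E] [InnerProductSpace ℂ E] {M : ℕ} {m : Fin M → ℕ}
  {h : Fin M → E}

/-- The operator `A` commutes with the tensor powers of all complex reflections. -/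
def ReflectionEquivariant {ι : Type} [Fintype ι] (A : HilbertTensor ι E →L[ℂ] HilbertTensor ι E) :
    Prop :=
  ∀ (e : E) (he : ‖e‖ = 1) (z : Circle) (x : HilbertTensor ι E),
    A (tensorPower ι E (complexReflection e he z) x) =
      tensorPower ι E (complexReflection e he z) (A x)

lemma reflectionInvariant_ker {A B : HilbertTensor (Boxes m) E →L[ℂ] HilbertTensor (Boxes m) E}
    (hA : ReflectionEquivariant A) (hB : ReflectionEquivariant B) :
    ReflectionInvariant (LinearMap.ker (A - B).toLinearMap) := by
  intro e he z w hw
  have hw' : A w - B w = 0 := hw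
  change A _ - B _ = 0
  rw [hA, hB, ← map_sub, hw', map_zero]

lemma reflectionEquivariant_smul (c : ℂ) {A : HilbertTensor (Boxes m) E →L[ℂ] HilbertTensor (Boxes m) E}
    (hA : ReflectionEquivariant A) : ReflectionEquivariant (c • A) := by
  intro e he z x
  change c • A _ = _
  rw [hA, ← map_smul]
  rfl

lemma reflectionEquivariant_id :
    ReflectionEquivariant (ContinuousLinearMap.id ℂ (HilbertTensor (Boxes m) E)) :=
  fun _ _ _ _ => rfl

lemma reflectionEquivariant_youngSymmetrizer : ReflectionEquivariant (youngSymmetrizer m E) :=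
  fun _ _ _ _ => (tensorPower_youngSymmetrizer m E _ _).symm

lemma isClosed_ker_clm {X Y : Type*} [NormedAddCommGroup X] [NormedSpace ℂ X]
    [NormedAddCommGroup Y] [NormedSpace ℂ Y] (T : X →L[ℂ] Y) :
    IsClosed (LinearMap.ker T.toLinearMap : Set X) :=
  T.isClosed_ker

lemma mem_ker_clm_sub {X Y : Type*} [NormedAddCommGroup X] [NormedSpace ℂ X]
    [NormedAddCommGroup Y] [NormedSpace ℂ Y] (S T : X →L[ℂ] Y) {x : X} :
    x ∈ LinearMap.ker (S - T).toLinearMap ↔ S x = T x := sub_eq_zero (a := S x)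

/-- Two equivariant operators that agree on the highest weight vector agree on the space of
Young-symmetrized tensors. -/
lemma ReflectionEquivariant.eqOn_youngSpace
    {A B : HilbertTensor (Boxes m) E →L[ℂ] HilbertTensor (Boxes m) E}
    (hA : ReflectionEquivariant A) (hB : ReflectionEquivariant B) (hh : IsRowFrame m h)
    (hAB : A (highestVector m h) = B (highestVector m h)) {v : HilbertTensor (Boxes m) E}
    (hv : v ∈ youngSpace m E) : A v = B v :=
  (mem_ker_clm_sub A B).1 ((reflectionInvariant_ker hA hB).youngSpace_le (isClosed_ker_clm _) hh
    ((mem_ker_clm_sub A B).2 hAB) hv)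

/-- Two equivariant operators that agree on the row tensor of a frame agree on row-symmetric
tensors. -/
lemma ReflectionEquivariant.eqOn_rowSymmetrizer
    {A B : HilbertTensor (Boxes m) E →L[ℂ] HilbertTensor (Boxes m) E}
    (hA : ReflectionEquivariant A) (hB : ReflectionEquivariant B) (hh : IsRowFrame m h)
    (hAB : A (rowTensor m h) = B (rowTensor m h)) (t : HilbertTensor (Boxes m) E) :
    A (rowSymmetrizer m E t) = B (rowSymmetrizer m E t) :=
  (mem_ker_clm_sub A B).1 ((reflectionInvariant_ker hA hB).range_rowSymmetrizer_le
    (isClosed_ker_clm _) hh ((mem_ker_clm_sub A B).2 hAB) t)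

/-- Schur's lemma for the space of Young-symmetrized tensors. -/
lemma ReflectionEquivariant.exists_smul
    {A : HilbertTensor (Boxes m) E →L[ℂ] HilbertTensor (Boxes m) E} (hA : ReflectionEquivariant A)
    (hm : Antitone m) (hh : IsRowFrame m h) (hv : A (highestVector m h) ∈ youngSpace m E) :
    ∃ c : ℂ, ∀ v ∈ youngSpace m E, A v = c • v := by
  -- The image of the highest vector is column antisymmetric and again of weight `m`, so
  -- multiplicity one gives the scalar; cyclicity propagates it to the whole Young space.
  have h1 := eq_smul_highestVector hm hh (columnAntisymmetric_of_mem_youngSpace hv)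
    ((hasShapeWeight_highestVector hh).map hA)
  exact ⟨_, fun v hv => hA.eqOn_youngSpace (reflectionEquivariant_smul _ reflectionEquivariant_id)
    hh h1 hv⟩

lemma highestVector_ne_zero (hh : IsRowFrame m h) : highestVector m h ≠ 0 := fun h0 => by
  have := inner_rowTensor_highestVector hh
  rw [h0, inner_zero_right] at this
  exact zero_ne_one this

/-- Let R and C be the row symmetrizer and column antisymmetrizer, both self-adjoint, and v = C x
with x the row tensor. If C R v = 0, then ⟪v, R v⟫ = ⟪x, C R v⟫ = 0, and since R² is a multiple of
R, also R v = 0. But ⟪x, R v⟫ = ⟪R x, v⟫ is the order of the row group. -/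
lemma youngSymmetrizer_highestVector_ne_zero (hh : IsRowFrame m h) :
    youngSymmetrizer m E (highestVector m h) ≠ 0 := by
  intro h0
  have h1 : ⟪highestVector m h, rowSymmetrizer m E (highestVector m h)⟫_ℂ = 0 := by
    conv_lhs => rw [highestVector, inner_columnAntisymmetrizer_left]
    exact (congrArg _ h0).trans (inner_zero_right _)
  have h2 : rowSymmetrizer m E (highestVector m h) = 0 := by
    rw [← inner_self_eq_zero (𝕜 := ℂ), inner_rowSymmetrizer_left, rowSymmetrizer_rowSymmetrizer,
      inner_smul_right, h1, mul_zero]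
  have h3 : ⟪rowTensor m h, rowSymmetrizer m E (highestVector m h)⟫_ℂ = rowOrder m := by
    rw [← inner_rowSymmetrizer_left, rowSymmetrizer_rowTensor, inner_smul_left,
      inner_rowTensor_highestVector hh, mul_one, map_natCast]
  rw [h2, inner_zero_right] at h3
  exact rowOrder_ne_zero h3.symm

/-- The Young symmetrizer is a nonzero multiple of an idempotent. -/
lemma exists_youngSymmetrizer_eq_smul (hm : Antitone m) (hh : IsRowFrame m h) :
    ∃ c : ℂ, c ≠ 0 ∧ ∀ v ∈ youngSpace m E, youngSymmetrizer m E v = c • v := by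
  obtain ⟨c, hc⟩ := (reflectionEquivariant_youngSymmetrizer (m := m) (E := E)).exists_smul hm hh
    (youngSymmetrizer_mem _)
  refine ⟨c, fun h0 => ?_, hc⟩
  have := hc _ (highestVector_mem h)
  rw [h0, zero_smul] at this
  exact youngSymmetrizer_highestVector_ne_zero hh this

/-- Since the Young symmetrizer is a multiple `c ≠ 0` of an idempotent, its range is its eigenspace
for `c`, a closed condition. -/
lemma isClosed_youngSpace (hm : Antitone m) (hh : IsRowFrame m h) :
    IsClosed (youngSpace m E : Set (HilbertTensor (Boxes m) E)) := by
  obtain ⟨c, hc0, hc⟩ := exists_youngSymmetrizer_eq_smul hm hh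
  have : (youngSpace m E : Set (HilbertTensor (Boxes m) E)) =
      {v | youngSymmetrizer m E v = c • v} := by
    ext v
    refine ⟨hc v, fun hv => ?_⟩
    rw [Set.mem_ofPred_eq] at hv
    have := (youngSpace m E).smul_mem c⁻¹ (youngSymmetrizer_mem v)
    rwa [hv, smul_smul, inv_mul_cancel₀ hc0, one_smul] at this
  rw [this]
  exact isClosed_eq (youngSymmetrizer m E).continuous (continuous_const_smul c)

lemma completeSpace_youngTensors (hm : Antitone m) (hh : IsRowFrame m h) :
    CompleteSpace (YoungTensors m E) :=
  (isClosed_youngSpace hm hh).completeSpace_coe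

/-- The inverse of a reflection is the reflection with the inverse phase, so the orthogonal
complement of `W` is invariant too. -/
lemma reflectionEquivariant_starProjection {ι : Type} [Fintype ι]
    {W : Submodule ℂ (HilbertTensor ι E)} [W.HasOrthogonalProjection]
    (hW : ReflectionInvariant W) : ReflectionEquivariant W.starProjection := by
  intro e he z x
  refine Submodule.eq_starProjection_of_mem_of_inner_eq_zero
    (hW e he z _ (W.starProjection_apply_mem x)) fun w hw => ?_
  have h1 : w = tensorPower ι E (complexReflection e he z)
      (tensorPower ι E (complexReflection e he z⁻¹) w) := by
    rw [← complexReflection_inv, map_inv]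
    exact ((tensorPower ι E (complexReflection e he z)).apply_symm_apply w).symm
  rw [h1, ← map_sub, LinearIsometryEquiv.inner_map_map]
  exact W.starProjection_inner_eq_zero x _ (hW e he z⁻¹ w hw)

/-- A closed reflection invariant subspace of the space of Young-symmetrized tensors is trivial. -/
lemma eq_bot_or_youngSpace_le (hm : Antitone m) (hh : IsRowFrame m h)
    {W : Submodule ℂ (HilbertTensor (Boxes m) E)}
    (hWc : IsClosed (W : Set (HilbertTensor (Boxes m) E))) (hW : ReflectionInvariant W)
    (hle : W ≤ youngSpace m E) : W = ⊥ ∨ youngSpace m E ≤ W := by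
  have : CompleteSpace W := hWc.completeSpace_coe
  -- By Schur's lemma the projection onto `W` is a scalar on the Young space. A nonzero vector of
  -- `W` makes this scalar 1.
  obtain ⟨c, hc⟩ := (reflectionEquivariant_starProjection hW).exists_smul hm hh
    (hle (W.starProjection_apply_mem _))
  refine or_iff_not_imp_left.2 fun hne v hv => ?_
  obtain ⟨w, hw, hw0⟩ := Submodule.exists_mem_ne_zero_of_ne_bot hne
  have h1 := hc w (hle hw)
  rw [Submodule.starProjection_eq_self_iff.2 hw] at h1
  have h2 : c = 1 := by
    by_contra hc1
    have : (1 - c) • w = 0 := by rw [sub_smul, one_smul, ← h1, sub_self]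
    exact (smul_ne_zero (sub_ne_zero.2 (Ne.symm hc1)) hw0) this
  have h3 := hc v hv
  rw [h2, one_smul] at h3
  exact Submodule.starProjection_eq_self_iff.1 h3

/-- The vectors with continuous orbit map form a subspace. It is closed, because unitarity makes the
approximation of orbit maps uniform in `g`, and it contains the elementary tensors. -/
lemma continuous_tensorPower {ι : Type} [Fintype ι] {G : Type*} [TopologicalSpace G]
    {u : G → (E ≃ₗᵢ[ℂ] E)} (hu : ∀ x, Continuous fun g => u g x) (t : HilbertTensor ι E) :
    Continuous fun g => tensorPower ι E (u g) t := by
  let W : Submodule ℂ (HilbertTensor ι E) :=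
    { carrier := {t | Continuous fun g => tensorPower ι E (u g) t}
      zero_mem' := by simpa using continuous_const
      add_mem' := fun {a b} ha hb => by
        simp only [Set.mem_ofPred_eq, map_add] at *
        exact ha.add hb
      smul_mem' := fun c x hx => by
        simp only [Set.mem_ofPred_eq, map_smul] at *
        exact hx.const_smul c }
  refine mem_of_elementary_mem (W := W) (isClosed_of_closure_subset fun x hx => ?_) (fun f => ?_) t
  · change Continuous _
    refine continuous_of_uniform_approx_of_continuous fun s hs => ?_
    obtain ⟨ε, hε, hs⟩ := Metric.mem_uniformity_dist.1 hs
    obtain ⟨y, hy, hxy⟩ := Metric.mem_closure_iff.1 hx ε hε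
    exact ⟨_, hy, fun g => hs (by rwa [LinearIsometryEquiv.dist_map])⟩
  · change Continuous _
    simp only [tensorPower_elementary]
    exact continuous_elementary.comp (continuous_pi fun i => hu (f i))

/-- Irreducibility of the space of Young-symmetrized tensors for every group of unitary operators
that contains the complex reflections. -/
theorem isIrreducibleUnitaryRep_youngRep (hm : Antitone m) (hh : IsRowFrame m h) {G : Type*}
    [Group G] [TopologicalSpace G] (u : G →* (E ≃ₗᵢ[ℂ] E)) (hu : ∀ x, Continuous fun g => u g x)
    (hrefl : ∀ (e : E) (he : ‖e‖ = 1) (z : Circle), ∃ g, u g = complexReflection e he z) :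
    IsIrreducibleUnitaryRep ((youngRep m E).comp u) := by
  refine ⟨completeSpace_youngTensors hm hh, ?_, fun v => ?_, fun W hW hinv => ?_⟩
  · exact nontrivial_of_ne (⟨highestVector m h, highestVector_mem h⟩ : youngSpace m E) 0
      fun e => highestVector_ne_zero hh (congrArg Subtype.val e)
  · exact Continuous.subtype_mk (continuous_tensorPower hu (v : youngSpace m E).1) _
  · let W' : Submodule ℂ (youngSpace m E) := W
    have h1 : IsClosed ((W'.map (youngSpace m E).subtype : Submodule ℂ _) :
        Set (HilbertTensor (Boxes m) E)) :=
      (isClosed_youngSpace hm hh).isClosedEmbedding_subtypeVal.isClosedMap _ hW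
    have h2 : ReflectionInvariant (W'.map (youngSpace m E).subtype) := by
      rintro e he z _ ⟨w, hw, rfl⟩
      obtain ⟨g, hg⟩ := hrefl e he z
      refine ⟨_, hinv g w hw, ?_⟩
      rw [← hg]
      rfl
    rcases eq_bot_or_youngSpace_le hm hh h1 h2 (Submodule.map_subtype_le _ _) with h3 | h3
    · refine Or.inl ((Submodule.eq_bot_iff _).2 fun w hw => Subtype.ext ?_)
      exact (Submodule.eq_bot_iff _).1 h3 _ ⟨w, hw, rfl⟩
    · right
      refine eq_top_iff.2 fun v _ => ?_
      obtain ⟨w, hw, hwv⟩ := h3 (v : youngSpace m E).2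
      have : w = v := Subtype.ext hwv
      exact this ▸ hw

end Schur

/-! ### Frames -/

section Frames

variable {E : Type*} [NormedAddCommGroup E] [InnerProductSpace ℂ E] {M : ℕ} (m : Fin M → ℕ)

lemma isRowFrame_of_orthonormal {h : Fin M → E} (hh : Orthonormal ℂ h) : IsRowFrame m h :=
  fun i j _ _ => orthonormal_iff_ite.1 hh i j

lemma exists_isRowFrame
    (hdim : ((Finset.univ.filter fun i => 0 < m i).card : Cardinal) ≤ Module.rank ℂ E) :
    ∃ h : Fin M → E, IsRowFrame m h := by
  obtain ⟨s, hs, hli⟩ := le_rank_iff_exists_linearIndependent_finset.1 hdim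
  let b := stdOrthonormalBasis ℂ (Submodule.span ℂ (s : Set E))
  have hcard : Module.finrank ℂ (Submodule.span ℂ (s : Set E)) =
      Fintype.card {i // 0 < m i} := by
    rw [finrank_span_finset_eq_card hli, hs, Fintype.card_subtype]
  let e : {i // 0 < m i} ≃ Fin (Module.finrank ℂ (Submodule.span ℂ (s : Set E))) :=
    (Fintype.equivFinOfCardEq hcard.symm)
  -- The value `0` on empty rows is irrelevant, since a frame is constrained only on nonempty rows.
  refine ⟨fun i => if hi : 0 < m i then (b (e ⟨i, hi⟩) : E) else 0, fun i j hi hj => ?_⟩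
  dsimp only
  rw [dif_pos hi, dif_pos hj, ← Submodule.coe_inner, orthonormal_iff_ite.1 b.orthonormal]
  simp

end Frames

/-! ### The defining representations -/

section Groups

variable {H : Type*} [NormedAddCommGroup H] [InnerProductSpace ℂ H] [CompleteSpace H]

lemma isCompactOperator_smulRight {X : Type*} [NormedAddCommGroup X] [NormedSpace ℂ X]
    (f : X →L[ℂ] ℂ) (v : X) : IsCompactOperator (f.smulRight v : X →L[ℂ] X) := by
  have h1 : IsCompactOperator (id : ℂ → ℂ) := (isCompactOperator_id_iff_finiteDimensional (𝕜 := ℂ)).2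
    inferInstance
  have h2 := (h1.comp_clm f).clm_comp ((ContinuousLinearMap.id ℂ ℂ).smulRight v)
  exact h2

/-- A reflection differs from the identity by an operator of rank at most one, which is compact. -/
lemma exists_definingU0_eq_complexReflection (e : H) (he : ‖e‖ = 1) (z : Circle) :
    ∃ g : U0 H, definingU0 H g = complexReflection e he z := by
  refine ⟨⟨Unitary.linearIsometryEquiv.symm (complexReflection e he z), ?_⟩, ?_⟩
  · change IsCompactOperator
      (((complexReflection e he z : H ≃L[ℂ] H) : H →L[ℂ] H) - (1 : H →L[ℂ] H))
    have : (((complexReflection e he z : H ≃L[ℂ] H) : H →L[ℂ] H) - (1 : H →L[ℂ] H)) =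
        ((z : ℂ) - 1) • (innerSL ℂ e).smulRight e := by
      ext v
      change complexReflection e he z v - v = _
      rw [complexReflection_apply, scaleAlong_apply, add_sub_cancel_left, mul_smul]
      rfl
    rw [this]
    exact (isCompactOperator_smulRight _ _).smul _
  · exact Unitary.linearIsometryEquiv.apply_symm_apply _

lemma continuous_definingU0 (x : H) : Continuous fun g : U0 H => definingU0 H g x := by
  change Continuous fun g : U0 H => ((g : unitary (H →L[ℂ] H)) : H →L[ℂ] H) x
  fun_prop

variable {M : ℕ}

lemma definingUM_apply (h : UM M) (x : EuclideanSpace ℂ (Fin M)) (i : Fin M) :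
    definingUM M h x i = ∑ j, (h : Matrix (Fin M) (Fin M) ℂ) i j * x j := by
  change (Matrix.toEuclideanCLM (n := Fin M) (𝕜 := ℂ) (h : Matrix (Fin M) (Fin M) ℂ) x) i = _
  rw [Matrix.ofLp_toEuclideanCLM]
  rfl

lemma exists_definingUM_eq (u : EuclideanSpace ℂ (Fin M) ≃ₗᵢ[ℂ] EuclideanSpace ℂ (Fin M)) :
    ∃ g : UM M, definingUM M g = u := by
  let φ := Matrix.toEuclideanCLM (n := Fin M) (𝕜 := ℂ)
  let w := Unitary.linearIsometryEquiv.symm u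
  have hw : star (w : EuclideanSpace ℂ (Fin M) →L[ℂ] EuclideanSpace ℂ (Fin M)) * w = 1 ∧
      (w : EuclideanSpace ℂ (Fin M) →L[ℂ] EuclideanSpace ℂ (Fin M)) * star w = 1 := w.2
  refine ⟨⟨φ.symm w, ?_⟩, ?_⟩
  · constructor
    · refine (EquivLike.injective φ) ?_
      rw [map_mul, map_star, StarAlgEquiv.apply_symm_apply, hw.1, map_one]
    · refine (EquivLike.injective φ) ?_
      rw [map_mul, map_star, StarAlgEquiv.apply_symm_apply]
      exact hw.2.trans (map_one φ).symm
  · refine (Unitary.linearIsometryEquiv.eq_symm_apply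
      (y := ((⟨φ (φ.symm w), _⟩ : unitary (EuclideanSpace ℂ (Fin M) →L[ℂ]
        EuclideanSpace ℂ (Fin M)))))).1 (Subtype.ext ?_)
    exact φ.apply_symm_apply _

lemma continuous_definingUM (x : EuclideanSpace ℂ (Fin M)) :
    Continuous fun g : UM M => definingUM M g x := by
  rw [← (PiLp.homeomorph 2 (fun _ : Fin M => ℂ)).comp_continuous_iff]
  refine continuous_pi fun i => ?_
  change Continuous fun g : UM M => definingUM M g x i
  simp only [definingUM_apply]
  refine continuous_finsetSum _ fun j _ => Continuous.mul ?_ continuous_const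
  exact (continuous_subtype_val (p := fun A => A ∈ Matrix.unitaryGroup (Fin M) ℂ)).matrix_elem i j

variable (M) in
/-- The standard basis vectors of `ℂ^M`. -/
abbrev stdVec (i : Fin M) : EuclideanSpace ℂ (Fin M) := EuclideanSpace.single i 1

lemma orthonormal_stdVec : Orthonormal ℂ (stdVec M) := EuclideanSpace.orthonormal_single

lemma isRowFrame_stdVec (m : Fin M → ℕ) : IsRowFrame m (stdVec M) :=
  isRowFrame_of_orthonormal m orthonormal_stdVec

lemma span_stdVec : Submodule.span ℂ (Set.range (stdVec M)) = ⊤ := by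
  refine eq_top_iff.2 fun x _ => ?_
  rw [← (EuclideanSpace.basisFun (Fin M) ℂ).sum_repr x]
  refine Submodule.sum_mem _ fun i _ => Submodule.smul_mem _ _ (Submodule.subset_span ⟨i, ?_⟩)
  rw [EuclideanSpace.basisFun_apply]

lemma definingUM_stdVec (h : UM M) (j : Fin M) :
    definingUM M h (stdVec M j) = ∑ i, (h : Matrix (Fin M) (Fin M) ℂ) i j • stdVec M i := by
  ext i
  rw [definingUM_apply]
  simp [Pi.single_apply]

lemma definingUM_torusUM (z : Fin M → Circle) (i : Fin M) :
    definingUM M (torusUM z) (stdVec M i) = (z i : ℂ) • stdVec M i := by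
  rw [definingUM_stdVec, Finset.sum_eq_single i]
  · simp [torusUM]
  · intro j _ hj
    simp [torusUM, Matrix.diagonal_apply_ne _ hj]
  · simp

lemma elementary_smul_univ {ι : Type} [Fintype ι] {E : Type*} [NormedAddCommGroup E]
    [InnerProductSpace ℂ E] (c : ι → ℂ) (f : ι → E) :
    elementary (fun i => c i • f i) = (∏ i, c i) • elementary f :=
  MultilinearMap.map_smul_univ elementaryMul c f

lemma tensorPower_torusUM {ι : Type} [Fintype ι] (z : Fin M → Circle) (J : ι → Fin M) :
    tensorPower ι _ (definingUM M (torusUM z)) (elementary fun b => stdVec M (J b)) =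
      (∏ b, (z (J b) : ℂ)) • elementary fun b => stdVec M (J b) := by
  rw [tensorPower_elementary, ← elementary_smul_univ]
  simp only [definingUM_torusUM]

variable {m : Fin M → ℕ}

theorem isIrreducibleUnitaryRep_repUM (hm : Antitone m) : IsIrreducibleUnitaryRep (repUM m) :=
  isIrreducibleUnitaryRep_youngRep hm (isRowFrame_stdVec m) (definingUM M) continuous_definingUM
    fun _ _ _ => exists_definingUM_eq _

theorem isIrreducibleUnitaryRep_repU0 (hm : Antitone m) {h : Fin M → H} (hh : IsRowFrame m h) :
    IsIrreducibleUnitaryRep (repU0 H m) :=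
  isIrreducibleUnitaryRep_youngRep hm hh (definingU0 H) continuous_definingU0
    exists_definingU0_eq_complexReflection

lemma eq_zero_of_inner_elementary_stdVec {ι : Type} [Fintype ι]
    {t : HilbertTensor ι (EuclideanSpace ℂ (Fin M))}
    (h : ∀ J : ι → Fin M, ⟪t, elementary fun b => stdVec M (J b)⟫_ℂ = 0) : t = 0 := by
  suffices H : ∀ x, x ∈ (ℂ ∙ t)ᗮ from
    inner_self_eq_zero.1 (Submodule.mem_orthogonal_singleton_iff_inner_right.1 (H t))
  refine mem_of_elementary_mem_of_span (Submodule.isClosed_orthogonal _) span_stdVec fun f hf => ?_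
  rw [Submodule.mem_orthogonal_singleton_iff_inner_right]
  choose J hJ using hf
  rw [← h J]
  exact congrArg _ (congrArg elementary (funext fun b => (hJ b).symm))

/-- A weight vector is orthogonal to the vectors with the weight of a basis tensor of different
content. -/
lemma eq_content_of_inner_ne_zero {ι : Type} [Fintype ι]
    {t : HilbertTensor ι (EuclideanSpace ℂ (Fin M))} {l : Fin M → ℤ}
    (ht : ∀ z : Fin M → Circle, tensorPower ι _ (definingUM M (torusUM z)) t =
      (∏ i, (z i : ℂ) ^ l i) • t) {J : ι → Fin M} {w : HilbertTensor ι (EuclideanSpace ℂ (Fin M))}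
    (hw : ∀ z : Fin M → Circle, tensorPower ι _ (definingUM M (torusUM z)) w =
      (∏ b, (z (J b) : ℂ)) • w) (hJ : ⟪t, w⟫_ℂ ≠ 0) (k : Fin M) :
    l k = (Finset.univ.filter fun b => J b = k).card := by
  have key : ∀ z : Fin M → Circle, (∏ b, (z (J b) : ℂ)) = ∏ i, (z i : ℂ) ^ l i := by
    intro z
    have e2 := (tensorPower ι _ (definingUM M (torusUM z))).inner_map_map t w
    rw [hw, ht z, inner_smul_left, inner_smul_right, ← mul_assoc] at e2
    have e3 := mul_right_cancel₀ hJ (e2.trans (one_mul _).symm)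
    have e4 : (starRingEnd ℂ) (∏ i, (z i : ℂ) ^ l i) * ∏ i, (z i : ℂ) ^ l i = 1 := by
      rw [map_prod, ← Finset.prod_mul_distrib]
      refine Finset.prod_eq_one fun i _ => ?_
      rw [map_zpow₀, ← mul_zpow, mul_comm, Complex.mul_conj, Circle.normSq_coe,
        Complex.ofReal_one, one_zpow]
    exact mul_left_cancel₀ (left_ne_zero_of_mul_eq_one e4) (e3.trans e4.symm)
  symm
  refine circle_zpow_injective fun w => ?_
  -- A torus element with the single nontrivial entry `w` in place `k` isolates the exponent `l k`.
  have h1 := key (Function.update 1 k w)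
  rw [Finset.prod_eq_single (s := Finset.univ) (f := fun i => ((Function.update 1 k w :
    Fin M → Circle) i : ℂ) ^ l i) k (fun i _ hi => by simp [hi]) (by simp),
    Function.update_self] at h1
  rw [← h1, zpow_natCast, ← Finset.prod_const, Finset.prod_filter]
  refine Finset.prod_congr rfl fun b _ => ?_
  by_cases hb : J b = k
  · rw [if_pos hb, hb, Function.update_self]
  · rw [if_neg hb, Function.update_of_ne hb]
    simp

lemma tensorPower_torusUM_highestVector (z : Fin M → Circle) :
    tensorPower (Boxes m) _ (definingUM M (torusUM z)) (highestVector m (stdVec M)) =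
      (∏ i, (z i : ℂ) ^ (m i : ℤ)) • highestVector m (stdVec M) := by
  rw [highestVector, tensorPower_columnAntisymmetrizer, rowTensor, tensorPower_torusUM, map_smul,
    Fintype.prod_sigma]
  simp

/-- A weight vector has a nonzero inner product with some basis tensor e_J, so its weight is the
content of `J`. Its column antisymmetry makes `J` column injective, and dominance becomes the column
count. -/
theorem hasHighestWeight_repUM (hm : Antitone m) :
    HasHighestWeight (repUM m) fun i => (m i : ℤ) := by
  refine ⟨⟨(⟨highestVector m (stdVec M), highestVector_mem _⟩ : youngSpace m _),
    fun e => highestVector_ne_zero (isRowFrame_stdVec m) (congrArg Subtype.val e),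
    fun z => Subtype.ext ?_⟩, fun l hl => ?_⟩
  · exact tensorPower_torusUM_highestVector z
  · obtain ⟨⟨t, htY⟩, ht0, ht⟩ := hl
    have ht' : ∀ z : Fin M → Circle, tensorPower (Boxes m) _ (definingUM M (torusUM z)) t =
        (∏ i, (z i : ℂ) ^ l i) • t := fun z => congrArg Subtype.val (ht z)
    have : ∃ J : Boxes m → Fin M, ⟪t, elementary fun b => stdVec M (J b)⟫_ℂ ≠ 0 := by
      by_contra! h0
      exact ht0 (Subtype.ext (eq_zero_of_inner_elementary_stdVec h0))
    obtain ⟨J, hJ⟩ := this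
    have hl := eq_content_of_inner_ne_zero ht' (fun z => tensorPower_torusUM z J) hJ
    have hinj : ColumnInjective J := fun b b' h2 e => by
      by_contra hbb
      exact hJ ((columnAntisymmetric_of_mem_youngSpace htY).inner_eq_zero hbb h2 (by rw [e]))
    refine ⟨fun k => ?_, ?_⟩
    · have h1 := hinj.card_le hm k
      rw [card_filter_Iic, card_filter_Iic (fun b : Boxes m => b.1)] at h1
      simp only [card_row] at h1
      simp only [hl]
      exact_mod_cast h1
    · simp only [hl]
      have h1 := Finset.card_eq_sum_card_fiberwise (f := J) (s := Finset.univ) (t := Finset.univ)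
        (fun _ _ => by simp)
      rw [Finset.card_univ, Fintype.card_sigma] at h1
      simp only [Fintype.card_fin] at h1
      exact_mod_cast h1.symm

end Groups

/-! ### Maps between Hilbert tensor powers -/

section TensorMap

variable {ι ι' : Type} [Fintype ι] [Fintype ι'] {E E' : Type*} [NormedAddCommGroup E]
  [InnerProductSpace ℂ E] [NormedAddCommGroup E'] [InnerProductSpace ℂ E']

/-- The map `⨂ b, f b ↦ ⨂ b, L b (f b)` followed by the relabelling `ε` of the factors, on the
algebraic tensor powers. -/
def algTensorMap (ε : ι ≃ ι') (L : ι → (E →ₗᵢ[ℂ] E')) : AlgTensor ι E →ₗ[ℂ] AlgTensor ι' E' :=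
  PiTensorProduct.lift (((AlgTensor.tprod (ι := ι') (E := E')).domDomCongr ε.symm).compLinearMap
    fun i => (L i).toLinearMap)

lemma algTensorMap_tprod (ε : ι ≃ ι') (L : ι → (E →ₗᵢ[ℂ] E')) (f : ι → E) :
    algTensorMap ε L (AlgTensor.tprod f) =
      AlgTensor.tprod fun i => L (ε.symm i) (f (ε.symm i)) :=
  PiTensorProduct.lift.tprod f

lemma inner_algTensorMap (ε : ι ≃ ι') (L : ι → (E →ₗᵢ[ℂ] E')) (x y : AlgTensor ι E) :
    ⟪algTensorMap ε L x, algTensorMap ε L y⟫_ℂ = ⟪x, y⟫_ℂ := by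
  induction x using AlgTensor.induction with
  | add u v hu hv => simp only [map_add, inner_add_left, hu, hv]
  | smul c f =>
    induction y using AlgTensor.induction with
    | add u v hu hv => simp only [map_add, inner_add_right, hu, hv]
    | smul d g =>
      simp only [map_smul, inner_smul_left, inner_smul_right, algTensorMap_tprod,
        AlgTensor.inner_tprod, LinearIsometry.inner_map_map]
      rw [ε.symm.prod_comp fun i => ⟪f i, g i⟫_ℂ]

/-- The map `⨂ b, f b ↦ ⨂ b, L b (f b)` followed by the relabelling `ε` of the factors. -/
def tensorMap (ε : ι ≃ ι') (L : ι → (E →ₗᵢ[ℂ] E')) :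
    HilbertTensor ι E →L[ℂ] HilbertTensor ι' E' :=
  ((algTensorMap ε L).isometryOfInner (inner_algTensorMap ε L)).toContinuousLinearMap.completion

lemma tensorMap_elementary (ε : ι ≃ ι') (L : ι → (E →ₗᵢ[ℂ] E')) (f : ι → E) :
    tensorMap ε L (elementary f) = elementary fun i => L (ε.symm i) (f (ε.symm i)) := by
  rw [elementary, elementary, ← algTensorMap_tprod]
  exact ContinuousLinearMap.completion_apply_coe
    ((algTensorMap ε L).isometryOfInner (inner_algTensorMap ε L)).toContinuousLinearMap _

end TensorMap

/-! ### Tensors in the Fock space -/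

section FockTensor

variable {E : Type*} [NormedAddCommGroup E] [InnerProductSpace ℂ E]

/-- The sum over all permutations of the factors, with values in the symmetric tensors. -/
def symmetrize (E : Type*) [NormedAddCommGroup E] [InnerProductSpace ℂ E] (n : ℕ) :
    HilbertTensor (Fin n) E →L[ℂ] symPower E n :=
  (∑ σ : Equiv.Perm (Fin n),
    (permuteFactors (Fin n) E σ : HilbertTensor (Fin n) E →L[ℂ] HilbertTensor (Fin n) E)).codRestrict
    (symPower E n) fun x τ => by
      simp only [sum_apply, map_sum]
      exact Fintype.sum_equiv (Equiv.mulLeft τ) _ _ fun σ =>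
        (permuteFactors_mul_apply τ σ x).symm

lemma coe_symmetrize (n : ℕ) (x : HilbertTensor (Fin n) E) :
    (symmetrize E n x : HilbertTensor (Fin n) E) =
      ∑ σ : Equiv.Perm (Fin n), permuteFactors (Fin n) E σ x := by
  change (∑ σ : Equiv.Perm (Fin n),
    (permuteFactors (Fin n) E σ : HilbertTensor (Fin n) E →L[ℂ] HilbertTensor (Fin n) E)) x = _
  rw [sum_apply]
  rfl

lemma symmetrize_permuteFactors {n : ℕ} (τ : Equiv.Perm (Fin n)) (x : HilbertTensor (Fin n) E) :
    symmetrize E n (permuteFactors (Fin n) E τ x) = symmetrize E n x := by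
  refine Subtype.ext ?_
  rw [coe_symmetrize, coe_symmetrize]
  exact Fintype.sum_equiv (Equiv.mulRight τ) _ _ fun σ => (permuteFactors_mul_apply σ τ x).symm

lemma symmetrize_coe {n : ℕ} (s : symPower E n) :
    symmetrize E n (s : HilbertTensor (Fin n) E) = (n.factorial : ℂ) • s := by
  refine Subtype.ext ?_
  rw [coe_symmetrize, Finset.sum_congr rfl fun σ _ => s.2 σ, Finset.sum_const, Finset.card_univ,
    Fintype.card_perm, Fintype.card_fin, ← Nat.cast_smul_eq_nsmul ℂ]
  rfl

lemma symRep_symmetrize {n : ℕ} (u : E ≃ₗᵢ[ℂ] E) (x : HilbertTensor (Fin n) E) :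
    symRep E n u (symmetrize E n x) = symmetrize E n (tensorPower (Fin n) E u x) := by
  refine Subtype.ext ?_
  change tensorPower (Fin n) E u (symmetrize E n x : HilbertTensor (Fin n) E) = _
  simp only [coe_symmetrize, map_sum, tensorPower_permuteFactors]

lemma inner_symmetrize {n : ℕ} (x y : HilbertTensor (Fin n) E) :
    ⟪symmetrize E n x, symmetrize E n y⟫_ℂ =
      (n.factorial : ℂ) * ∑ σ : Equiv.Perm (Fin n), ⟪x, permuteFactors (Fin n) E σ y⟫_ℂ := by
  rw [Submodule.coe_inner, coe_symmetrize, sum_inner, Finset.sum_congr rfl fun σ _ => by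
    rw [inner_permuteFactors_left, (symmetrize E n y).2 σ⁻¹], Finset.sum_const, Finset.card_univ,
    Fintype.card_perm, Fintype.card_fin, nsmul_eq_mul, coe_symmetrize, inner_sum]

/-- The inclusion of the symmetric tensors of degree `n` in the Fock space. -/
def fockOf (E : Type*) [NormedAddCommGroup E] [InnerProductSpace ℂ E] (n : ℕ) :
    symPower E n →L[ℂ] Fock E :=
  lp.singleContinuousLinearMap ℂ (fun n : ℕ => symPower E n) 2 n

lemma inner_fockOf {n : ℕ} (s t : symPower E n) : ⟪fockOf E n s, fockOf E n t⟫_ℂ = ⟪s, t⟫_ℂ := by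
  change ⟪lp.single (E := fun n : ℕ => symPower E n) 2 n s, lp.single 2 n t⟫_ℂ = _
  rw [lp.inner_single_left, lp.single_apply_self]

lemma secondQuantization_fockOf {n : ℕ} (u : E ≃ₗᵢ[ℂ] E) (s : symPower E n) :
    secondQuantization E u (fockOf E n s) = fockOf E n (symRep E n u s) := by
  refine lp.ext (funext fun k => ?_)
  change symRep E k u (lp.single (E := fun n : ℕ => symPower E n) 2 n s k) =
    lp.single (E := fun n : ℕ => symPower E n) 2 n (symRep E n u s) k
  by_cases hk : k = n
  · subst hk
    rw [lp.single_apply_self, lp.single_apply_self]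
  · rw [lp.single_apply_ne _ _ _ hk, lp.single_apply_ne _ _ _ hk, map_zero]

lemma mem_of_fockOf_mem {W : Submodule ℂ (Fock E)} (hW : IsClosed (W : Set (Fock E)))
    (h : ∀ n s, fockOf E n s ∈ W) (x : Fock E) : x ∈ W := by
  let y : lp (fun n : ℕ => symPower E n) 2 := x
  have hs := lp.hasSum_single (p := 2) (by norm_num) y
  exact hW.mem_of_tendsto hs
    (Filter.Eventually.of_forall fun s => W.sum_mem fun n _ => h n (y n))

/-- The unnormalized `symmetrize` multiplies symmetric tensors of degree `n` by `n!`, so every one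
of them is reached up to a nonzero factor. -/
lemma mem_of_fockOf_symmetrize_mem {W : Submodule ℂ (Fock E)} (hW : IsClosed (W : Set (Fock E)))
    {S : Set E} (hS : Submodule.span ℂ S = ⊤)
    (h : ∀ n (f : Fin n → E), (∀ i, f i ∈ S) → fockOf E n (symmetrize E n (elementary f)) ∈ W)
    (x : Fock E) : x ∈ W := by
  refine mem_of_fockOf_mem hW (fun n s => ?_) x
  have h1 := mem_of_elementary_mem_of_span
    (W := W.comap ((fockOf E n).comp (symmetrize E n)).toLinearMap)
    (isClosed_comap_clm _ hW) hS (fun f hf => (mem_comap_clm _).2 (h n f hf))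
    (s : HilbertTensor (Fin n) E)
  have h2 : fockOf E n (symmetrize E n (s : HilbertTensor (Fin n) E)) ∈ W :=
    (mem_comap_clm ((fockOf E n).comp (symmetrize E n))).1 h1
  rw [symmetrize_coe, map_smul] at h2
  have h3 := W.smul_mem (n.factorial : ℂ)⁻¹ h2
  rwa [smul_smul, inv_mul_cancel₀ (by exact_mod_cast n.factorial_ne_zero), one_smul] at h3

variable {H : Type*} [NormedAddCommGroup H] [InnerProductSpace ℂ H] {M : ℕ}

/-- The embedding `v ↦ v ⊗ e_j` of `H` in `H ⊗ ℂ^M`. -/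
def slot (H : Type*) [NormedAddCommGroup H] [InnerProductSpace ℂ H] {M : ℕ} (j : Fin M) :
    H →ₗᵢ[ℂ] OneParticle H M where
  toLinearMap := (TensorProduct.mk ℂ H (EuclideanSpace ℂ (Fin M))).flip (stdVec M j)
  norm_map' v := by
    change ‖v ⊗ₜ[ℂ] stdVec M j‖ = ‖v‖
    rw [TensorProduct.norm_tmul, orthonormal_stdVec.1, mul_one]

lemma slot_apply (j : Fin M) (v : H) : slot H j v = v ⊗ₜ[ℂ] stdVec M j := rfl

lemma span_slot :
    Submodule.span ℂ {w : OneParticle H M | ∃ v j, w = slot H j v} = ⊤ := by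
  rw [eq_top_iff, ← TensorProduct.span_tmul_eq_top, Submodule.span_le]
  rintro _ ⟨v, x, rfl⟩
  have hx : x ∈ Submodule.span ℂ (Set.range (stdVec M)) := by rw [span_stdVec]; trivial
  change v ⊗ₜ[ℂ] x ∈ Submodule.span ℂ {w : OneParticle H M | ∃ v j, w = slot H j v}
  induction hx using Submodule.span_induction with
  | mem x hx =>
    obtain ⟨j, rfl⟩ := hx
    exact Submodule.subset_span ⟨v, j, rfl⟩
  | zero => rw [TensorProduct.tmul_zero]; exact Submodule.zero_mem _
  | add x y _ _ hx hy => rw [TensorProduct.tmul_add]; exact Submodule.add_mem _ hx hy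
  | smul c x _ hx => rw [TensorProduct.tmul_smul]; exact Submodule.smul_mem _ c hx

variable {ι : Type} [Fintype ι] [DecidableEq ι] {n : ℕ} (ε : ι ≃ Fin n)

/-- The symmetrization of `x ⊗ e_I` as a vector of degree `n` in the Fock space over `H ⊗ ℂ^M`. -/
def fockTensor (I : ι → Fin M) : HilbertTensor ι H →L[ℂ] Fock (OneParticle H M) :=
  (fockOf (OneParticle H M) n).comp
    ((symmetrize (OneParticle H M) n).comp (tensorMap ε fun b => slot H (I b)))

lemma fockTensor_elementary (I : ι → Fin M) (f : ι → H) :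
    fockTensor ε I (elementary f) = fockOf (OneParticle H M) n (symmetrize (OneParticle H M) n
      (elementary fun i => slot H (I (ε.symm i)) (f (ε.symm i)))) := by
  change fockOf _ n (symmetrize _ n (tensorMap ε _ (elementary f))) = _
  rw [tensorMap_elementary]

/-- After total symmetrization only the joint position of an `H` factor and its label matters, so
permuting the former amounts to relabelling the latter. This carries symmetrizations over `H` to
symmetrizations over `ℂ^M`. -/
lemma fockTensor_permuteFactors (I : ι → Fin M) (σ : Equiv.Perm ι)
    (x : HilbertTensor ι H) :
    fockTensor ε I (permuteFactors ι H σ x) = fockTensor ε (fun b => I (σ b)) x := by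
  refine ext_elementary (S := (fockTensor ε I).comp
    (permuteFactors ι H σ : HilbertTensor ι H →L[ℂ] HilbertTensor ι H)) (fun f => ?_) x
  change fockTensor ε I (permuteFactors ι H σ (elementary f)) = _
  rw [permuteFactors_elementary, fockTensor_elementary, fockTensor_elementary,
    ← symmetrize_permuteFactors (ε.symm.trans (σ.symm.trans ε)), permuteFactors_elementary]
  simp

variable (M) in
lemma multilinear_sum_stdVec {E' : Type*} [AddCommGroup E'] [Module ℂ E'] {Q : Type*}
    [AddCommGroup Q] [Module ℂ Q] (φ : MultilinearMap ℂ (fun _ : ι => E') Q)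
    (c : ι → Fin M → ℂ)
    (v : ι → Fin M → E') :
    φ (fun b => ∑ j, c b j • v b j) =
      ∑ J : ι → Fin M, (∏ b, c b (J b)) • φ (fun b => v b (J b)) := by
  rw [φ.map_sum]
  exact Finset.sum_congr rfl fun J _ => φ.map_smul_univ _ _

lemma tensorPower_definingUM (h : UM M) (L : ι → Fin M) :
    tensorPower ι _ (definingUM M h) (elementary fun b => stdVec M (L b)) =
      ∑ J : ι → Fin M, (∏ b, (h : Matrix (Fin M) (Fin M) ℂ) (J b) (L b)) •
        elementary fun b => stdVec M (J b) := by
  rw [tensorPower_elementary]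
  simp only [definingUM_stdVec]
  exact multilinear_sum_stdVec M elementaryMul (fun b j => (h : Matrix (Fin M) (Fin M) ℂ) j (L b))
    fun _ j => stdVec M j

variable [CompleteSpace H]

lemma fockLeft_fockTensor (g : U0 H) (I : ι → Fin M) (x : HilbertTensor ι H) :
    fockLeft H M g (fockTensor ε I x) =
      fockTensor ε I (tensorPower ι H (definingU0 H g) x) := by
  refine ext_elementary
    (S := (fockLeft H M g : Fock (OneParticle H M) →L[ℂ] Fock (OneParticle H M)).comp
      (fockTensor ε I))
    (T := (fockTensor ε I).comp
      (tensorPower ι H (definingU0 H g) : HilbertTensor ι H →L[ℂ] HilbertTensor ι H))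
    (fun f => ?_) x
  change secondQuantization _ (leftAction H M g) (fockTensor ε I (elementary f)) =
    fockTensor ε I (tensorPower ι H (definingU0 H g) (elementary f))
  rw [tensorPower_elementary, fockTensor_elementary, fockTensor_elementary,
    secondQuantization_fockOf, symRep_symmetrize, tensorPower_elementary]
  rfl

lemma rightAction_slot (h : (UM M)ᵐᵒᵖ) (j : Fin M) (v : H) :
    rightAction H M h (slot H j v) =
      ∑ i, (h.unop : Matrix (Fin M) (Fin M) ℂ) j i • slot H i v := by
  change v ⊗ₜ[ℂ] (definingUM M (transposeUM M h) (stdVec M j)) = _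
  rw [definingUM_stdVec, TensorProduct.tmul_sum]
  exact Finset.sum_congr rfl fun i _ => TensorProduct.tmul_smul _ _ _

lemma fockRight_fockTensor (h : (UM M)ᵐᵒᵖ) (L : ι → Fin M) (x : HilbertTensor ι H) :
    fockRight H M h (fockTensor ε L x) =
      ∑ I : ι → Fin M, (∏ b, (h.unop : Matrix (Fin M) (Fin M) ℂ) (L b) (I b)) •
        fockTensor ε I x := by
  have key := ext_elementary
    (S := (fockRight H M h : Fock (OneParticle H M) →L[ℂ] Fock (OneParticle H M)).comp
      (fockTensor ε L))
    (T := ∑ I : ι → Fin M, (∏ b, (h.unop : Matrix (Fin M) (Fin M) ℂ) (L b) (I b)) •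
        fockTensor ε I)
    (fun f => ?_) x
  · rw [sum_apply] at key
    exact key
  rw [sum_apply]
  change secondQuantization _ (rightAction H M h) (fockTensor ε L (elementary f)) =
    ∑ I : ι → Fin M, (∏ b, (h.unop : Matrix (Fin M) (Fin M) ℂ) (L b) (I b)) •
      fockTensor ε I (elementary f)
  rw [fockTensor_elementary, secondQuantization_fockOf, symRep_symmetrize, tensorPower_elementary]
  simp only [rightAction_slot, fockTensor_elementary]
  have h1 := multilinear_sum_stdVec (ι := Fin n) M elementaryMul
    (fun i j => (h.unop : Matrix (Fin M) (Fin M) ℂ) (L (ε.symm i)) j)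
    (fun i j => slot H j (f (ε.symm i)))
  rw [elementaryMul_apply] at h1
  rw [h1, map_sum, map_sum]
  refine Fintype.sum_equiv (ε.symm.arrowCongr (Equiv.refl (Fin M))) _ _ fun J => ?_
  rw [map_smul, map_smul, elementaryMul_apply, ← ε.symm.prod_comp]
  simp

/-- Scalar matrices read off the degree; this later isolates the degree |m| in the induced space. -/
lemma fockRight_center_elementary (ζ : Circle) (f : Fin n → OneParticle H M) :
    fockRight H M (MulOpposite.op (torusUM fun _ => ζ))
      (fockOf (OneParticle H M) n (symmetrize (OneParticle H M) n (elementary f))) =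
      (ζ : ℂ) ^ n • fockOf (OneParticle H M) n (symmetrize (OneParticle H M) n (elementary f)) := by
  have h1 : ∀ w : OneParticle H M, rightAction H M (MulOpposite.op (torusUM fun _ => ζ)) w =
      (ζ : ℂ) • w := by
    intro w
    have hw : w ∈ Submodule.span ℂ {w : OneParticle H M | ∃ v j, w = slot H j v} := by
      rw [span_slot]; trivial
    induction hw using Submodule.span_induction with
    | mem w hw =>
      obtain ⟨v, j, rfl⟩ := hw
      rw [rightAction_slot, Finset.sum_eq_single j]
      · simp [torusUM]
      · intro i _ hi
        simp [torusUM, Matrix.diagonal_apply_ne _ hi.symm]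
      · simp
    | zero => rw [map_zero, smul_zero]
    | add x y _ _ hx hy => rw [map_add, hx, hy, smul_add]
    | smul c x _ hx => rw [map_smul, hx, smul_comm]
  change secondQuantization _ (rightAction H M _) _ = _
  rw [secondQuantization_fockOf, symRep_symmetrize, tensorPower_elementary]
  simp only [h1]
  rw [elementary_smul_univ, map_smul, map_smul, Finset.prod_const, Finset.card_univ,
    Fintype.card_fin]

end FockTensor

/-! ### Vectors in the induced space -/

section InducedVectors

variable {H : Type*} [NormedAddCommGroup H] [InnerProductSpace ℂ H] [CompleteSpace H] {M : ℕ}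
  {m : Fin M → ℕ}

/-- The embedding `x ↦ x ⊗ e_I` of the tensors over `H` in the Fock space, with the factors indexed
by the boxes. -/
def boxTensor (I : Boxes m → Fin M) :
    HilbertTensor (Boxes m) H →L[ℂ] Fock (OneParticle H M) :=
  fockTensor (Fintype.equivFin (Boxes m)) I

variable (m) in
/-- The Young symmetrizer of `ℂ^M` with values in the space of Young-symmetrized tensors. -/
def toYoung : HilbertTensor (Boxes m) (EuclideanSpace ℂ (Fin M)) →ₗ[ℂ]
    YoungTensors m (EuclideanSpace ℂ (Fin M)) :=
  (youngSymmetrizer m (EuclideanSpace ℂ (Fin M))).toLinearMap.rangeRestrict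

/-- The elementary tensor of standard basis vectors. -/
abbrev stdTensor {ι : Type} [Fintype ι] (I : ι → Fin M) :
    HilbertTensor ι (EuclideanSpace ℂ (Fin M)) :=
  elementary fun b => stdVec M (I b)

/-- The vector `∑ I, (x ⊗ e_I) ⊗ φ(e_I)` of `exp(H ⊗ ℂ^M) ⊗ V`. -/
def coupling {V : Type*} [NormedAddCommGroup V] [InnerProductSpace ℂ V]
    (φ : HilbertTensor (Boxes m) (EuclideanSpace ℂ (Fin M)) →ₗ[ℂ] V) :
    HilbertTensor (Boxes m) H →ₗ[ℂ] Fock (OneParticle H M) ⊗[ℂ] V :=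
  ∑ I : Boxes m → Fin M,
    (TensorProduct.mk ℂ (Fock (OneParticle H M)) V).flip (φ (stdTensor I)) ∘ₗ
      (boxTensor I).toLinearMap

section Coupling

variable {V : Type*} [NormedAddCommGroup V] [InnerProductSpace ℂ V]
  (φ : HilbertTensor (Boxes m) (EuclideanSpace ℂ (Fin M)) →ₗ[ℂ] V)

lemma coupling_apply (x : HilbertTensor (Boxes m) H) :
    coupling φ x = ∑ I : Boxes m → Fin M, boxTensor I x ⊗ₜ[ℂ] φ (stdTensor I) := by
  simp only [coupling, LinearMap.sum_apply]
  rfl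

/-- A permutation of the factors of `x` becomes a relabelling of `I`, which the sum over all `I`
transfers to the argument of `φ`. -/
lemma coupling_permuteFactors (σ : Equiv.Perm (Boxes m)) (x : HilbertTensor (Boxes m) H) :
    coupling φ (permuteFactors (Boxes m) H σ x) =
      coupling (φ ∘ₗ (permuteFactors (Boxes m) _ σ).toLinearEquiv.toLinearMap) x := by
  rw [coupling_apply, coupling_apply]
  refine Fintype.sum_equiv (σ.symm.arrowCongr (Equiv.refl (Fin M))) _ _ fun I => ?_
  change boxTensor I (permuteFactors (Boxes m) H σ x) ⊗ₜ[ℂ] φ (stdTensor I) =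
    boxTensor (fun b => I (σ b)) x ⊗ₜ[ℂ] φ (permuteFactors (Boxes m) _ σ
      (elementary fun b => stdVec M (I (σ b))))
  rw [boxTensor, fockTensor_permuteFactors, permuteFactors_elementary]
  simp only [Equiv.apply_symm_apply]
  rfl

lemma coupling_rowSymmetrizer (x : HilbertTensor (Boxes m) H) :
    coupling φ (rowSymmetrizer m H x) = coupling (φ ∘ₗ (rowSymmetrizer m _).toLinearMap) x := by
  rw [rowSymmetrizer_apply, map_sum]
  simp only [coupling_permuteFactors]
  simp only [coupling_apply]
  rw [Finset.sum_comm]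
  refine Finset.sum_congr rfl fun I _ => ?_
  rw [← TensorProduct.tmul_sum]
  change _ = boxTensor I x ⊗ₜ[ℂ] φ (rowSymmetrizer m _ (stdTensor I))
  rw [rowSymmetrizer_apply, map_sum]
  rfl

lemma coupling_columnAntisymmetrizer (x : HilbertTensor (Boxes m) H) :
    coupling φ (columnAntisymmetrizer m H x) =
      coupling (φ ∘ₗ (columnAntisymmetrizer m _).toLinearMap) x := by
  rw [columnAntisymmetrizer_apply, map_sum]
  simp only [map_smul, coupling_permuteFactors]
  simp only [coupling_apply, Finset.smul_sum]
  rw [Finset.sum_comm]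
  refine Finset.sum_congr rfl fun I _ => ?_
  simp only [← TensorProduct.tmul_smul]
  rw [← TensorProduct.tmul_sum]
  change _ = boxTensor I x ⊗ₜ[ℂ] φ (columnAntisymmetrizer m _ (stdTensor I))
  rw [columnAntisymmetrizer_apply, map_sum]
  simp only [map_smul]
  rfl

/-- Symmetrizers pass from `x` to `φ` from the outside in, each being composed on the right, so the
order (columns after rows) is preserved. -/
lemma coupling_youngSymmetrizer (x : HilbertTensor (Boxes m) H) :
    coupling φ (youngSymmetrizer m H x) = coupling (φ ∘ₗ (youngSymmetrizer m _).toLinearMap) x := by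
  have e : (φ ∘ₗ (columnAntisymmetrizer m _).toLinearMap) ∘ₗ (rowSymmetrizer m _).toLinearMap =
      φ ∘ₗ (youngSymmetrizer m _).toLinearMap :=
    LinearMap.ext fun t => congrArg φ (youngSymmetrizer_apply t).symm
  rw [youngSymmetrizer_apply, coupling_columnAntisymmetrizer, coupling_rowSymmetrizer, e]

lemma ampliation_coupling (g : U0 H) (x : HilbertTensor (Boxes m) H) :
    ampliation (fockLeft H M) V g (coupling φ x) =
      coupling φ (tensorPower (Boxes m) H (definingU0 H g) x) := by
  rw [coupling_apply, coupling_apply, map_sum]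
  refine Finset.sum_congr rfl fun I _ => ?_
  rw [boxTensor, ← fockLeft_fockTensor]
  rfl

lemma inner_coupling (x y : HilbertTensor (Boxes m) H) :
    ⟪coupling φ x, coupling φ y⟫_ℂ = ∑ I : Boxes m → Fin M, ∑ K : Boxes m → Fin M,
      ⟪φ (stdTensor I), φ (stdTensor K)⟫_ℂ * ⟪boxTensor I x, boxTensor K y⟫_ℂ := by
  rw [coupling_apply, coupling_apply, sum_inner]
  refine Finset.sum_congr rfl fun I _ => ?_
  rw [inner_sum]
  exact Finset.sum_congr rfl fun K _ => by rw [TensorProduct.inner_tmul, mul_comm]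

end Coupling

lemma repUM_toYoung (h : UM M) (t : HilbertTensor (Boxes m) (EuclideanSpace ℂ (Fin M))) :
    repUM m h (toYoung m t) = toYoung m (tensorPower (Boxes m) _ (definingUM M h) t) :=
  Subtype.ext (tensorPower_youngSymmetrizer m _ (definingUM M h) t)

lemma sum_prod_mul_prod_inv (h : UM M) {ι : Type} [Fintype ι] [DecidableEq ι] (K I : ι → Fin M) :
    ∑ L : ι → Fin M, (∏ b, ((h⁻¹ : UM M) : Matrix (Fin M) (Fin M) ℂ) (L b) (I b)) *
      (∏ b, (h : Matrix (Fin M) (Fin M) ℂ) (K b) (L b)) = if K = I then 1 else 0 := by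
  have h1 : (h : Matrix (Fin M) (Fin M) ℂ) * ((h⁻¹ : UM M) : Matrix (Fin M) (Fin M) ℂ) = 1 :=
    congrArg Subtype.val (mul_inv_cancel h)
  have h2 : ∀ b, ∑ l, ((h⁻¹ : UM M) : Matrix (Fin M) (Fin M) ℂ) l (I b) *
      (h : Matrix (Fin M) (Fin M) ℂ) (K b) l = if K b = I b then 1 else 0 := by
    intro b
    rw [← Matrix.one_apply, ← h1, Matrix.mul_apply]
    exact Finset.sum_congr rfl fun l _ => mul_comm _ _
  simp only [← Finset.prod_mul_distrib]
  have h3 := Finset.prod_univ_sum (fun _ : ι => (Finset.univ : Finset (Fin M)))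
    fun b l => ((h⁻¹ : UM M) : Matrix (Fin M) (Fin M) ℂ) l (I b) *
      (h : Matrix (Fin M) (Fin M) ℂ) (K b) l
  rw [Fintype.piFinset_univ] at h3
  rw [← h3]
  simp only [h2]
  by_cases hKI : K = I
  · simp [hKI]
  · obtain ⟨b, hb⟩ := Function.ne_iff.1 hKI
    rw [if_neg hKI, Finset.prod_eq_zero (Finset.mem_univ b) (if_neg hb)]

/-- Since the right action uses the transpose, `h⁻¹` acts on the labels in the Fock factor
contragrediently to the action of `h` on `ℋ_m`. The matrix entries of `h` and `h⁻¹` then cancel in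
the sum over labels. -/
lemma coupling_mem (x : HilbertTensor (Boxes m) H) :
    coupling (toYoung m) x ∈ inducedSpace (fockRight H M) (repUM m) := by
  intro h
  have h1 : ∀ L : Boxes m → Fin M,
      TensorProduct.congrIsometry (fockRight H M (MulOpposite.op h⁻¹)) (repUM m h)
        (boxTensor L x ⊗ₜ[ℂ] toYoung m (stdTensor L)) =
      ∑ I : Boxes m → Fin M, ∑ K : Boxes m → Fin M,
        ((∏ b, ((h⁻¹ : UM M) : Matrix (Fin M) (Fin M) ℂ) (L b) (I b)) *
          (∏ b, (h : Matrix (Fin M) (Fin M) ℂ) (K b) (L b))) •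
            (boxTensor I x ⊗ₜ[ℂ] toYoung m (stdTensor K)) := by
    intro L
    change fockRight H M (MulOpposite.op h⁻¹) (boxTensor L x) ⊗ₜ[ℂ]
      repUM m h (toYoung m (stdTensor L)) = _
    rw [boxTensor, fockRight_fockTensor, repUM_toYoung, tensorPower_definingUM, map_sum,
      TensorProduct.sum_tmul]
    refine Finset.sum_congr rfl fun I _ => ?_
    rw [TensorProduct.tmul_sum]
    refine Finset.sum_congr rfl fun K _ => ?_
    rw [map_smul, TensorProduct.smul_tmul_smul]
    rfl
  rw [coupling_apply, map_sum]
  simp only [h1]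
  rw [Finset.sum_comm]
  refine Finset.sum_congr rfl fun I _ => ?_
  rw [Finset.sum_comm, Finset.sum_eq_single I]
  · rw [← Finset.sum_smul, sum_prod_mul_prod_inv, if_pos rfl, one_smul]
  · intro K _ hK
    rw [← Finset.sum_smul, sum_prod_mul_prod_inv, if_neg hK, zero_smul]
  · simp

/-- The inner product is `N!` times a number of permutations, so no cancellation can occur. A
permutation that counts must match row vectors and labels at once, which forces `I` to be the
filling by row numbers; for that filling the identity counts. -/
lemma inner_fockTensor_rowTensor {h : Fin M → H} (hh : IsRowFrame m h) {N : ℕ}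
    (ε : Boxes m ≃ Fin N) (I : Boxes m → Fin M) :
    ∃ c : ℕ, ⟪fockTensor ε (fun b => b.1) (rowTensor m h),
      fockTensor ε I (rowTensor m h)⟫_ℂ = c ∧
      ((I = fun b => b.1) → c ≠ 0) ∧ (c ≠ 0 → I = fun b => b.1) := by
  refine ⟨N.factorial * ∑ σ : Equiv.Perm (Fin N), ∏ i,
    if (ε.symm i).1 = (ε.symm (σ.symm i)).1 ∧ (ε.symm i).1 = I (ε.symm (σ.symm i)) then 1 else 0,
    ?_, fun hI => ?_, fun hc => ?_⟩
  · rw [rowTensor, fockTensor_elementary, fockTensor_elementary,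
      inner_fockOf, inner_symmetrize]
    push_cast
    congr 1
    refine Finset.sum_congr rfl fun σ _ => ?_
    rw [permuteFactors_elementary, inner_elementary]
    refine Finset.prod_congr rfl fun i _ => ?_
    rw [slot_apply, slot_apply, TensorProduct.inner_tmul, hh _ _ (boxes_pos _) (boxes_pos _),
      orthonormal_iff_ite.1 orthonormal_stdVec]
    by_cases h1 : (ε.symm i).1 = (ε.symm (σ.symm i)).1
    · by_cases h2 : (ε.symm i).1 = I (ε.symm (σ.symm i))
      · rw [if_pos h1, if_pos h2, if_pos ⟨h1, h2⟩, one_mul]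
      · rw [if_neg h2, mul_zero]; exact (if_neg fun h => h2 h.2).symm
    · rw [if_neg h1, zero_mul]; exact (if_neg fun h => h1 h.1).symm
  · refine mul_ne_zero N.factorial_ne_zero ?_
    have : (∏ i, if (ε.symm i).1 = (ε.symm ((1 : Equiv.Perm (Fin N)).symm i)).1 ∧
        (ε.symm i).1 = I (ε.symm ((1 : Equiv.Perm (Fin N)).symm i)) then 1 else 0) ≠ 0 := by
      rw [Finset.prod_ne_zero_iff]
      intro i _
      rw [if_pos]
      · exact one_ne_zero
      · rw [hI]; exact ⟨rfl, rfl⟩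
    intro h0
    rw [Finset.sum_eq_zero_iff] at h0
    exact this (h0 1 (Finset.mem_univ _))
  · obtain ⟨σ, -, hσ⟩ := Finset.exists_ne_zero_of_sum_ne_zero (right_ne_zero_of_mul hc)
    rw [Finset.prod_ne_zero_iff] at hσ
    funext b
    have := hσ (σ (ε b)) (Finset.mem_univ _)
    rw [ne_eq, ite_eq_right_iff, Classical.not_imp] at this
    have := this.1.2.symm.trans this.1.1
    simpa using this

/-- Pairing with the term labelled by row numbers removes all other terms, and the remaining one is
nonzero in both tensor factors. -/
lemma coupling_rowTensor_ne_zero {h : Fin M → H} (hh : IsRowFrame m h) :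
    coupling (toYoung m) (rowTensor m h) ≠ 0 := by
  intro h0
  have hv : toYoung m (stdTensor fun b => b.1) ≠ 0 := by
    intro e
    have e1 : youngSymmetrizer m _ (rowTensor m (stdVec M)) = 0 := congrArg Subtype.val e
    rw [youngSymmetrizer_rowTensor] at e1
    exact smul_ne_zero rowOrder_ne_zero (highestVector_ne_zero (isRowFrame_stdVec m)) e1
  have h1 : ⟪boxTensor (fun b => b.1) (rowTensor m h) ⊗ₜ[ℂ] toYoung m (stdTensor fun b => b.1),
      coupling (toYoung m) (rowTensor m h)⟫_ℂ = 0 := by rw [h0, inner_zero_right]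
  rw [coupling_apply, inner_sum, Finset.sum_eq_single fun b => b.1] at h1
  · rw [TensorProduct.inner_tmul] at h1
    obtain ⟨c, hc, hc0, -⟩ := inner_fockTensor_rowTensor hh (Fintype.equivFin (Boxes m)) (fun b => b.1)
    rw [boxTensor, hc] at h1
    rcases mul_eq_zero.1 h1 with h2 | h2
    · exact hc0 rfl (by exact_mod_cast h2)
    · exact hv (inner_self_eq_zero.1 h2)
  · intro I _ hI
    obtain ⟨c, hc, -, hc0⟩ := inner_fockTensor_rowTensor hh (Fintype.equivFin (Boxes m)) I
    rw [TensorProduct.inner_tmul, boxTensor, boxTensor, hc, not_ne_iff.1 (mt hc0 hI), Nat.cast_zero, zero_mul]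
  · simp

end InducedVectors

/-! ### Contractions of vectors in the induced space -/

section Contraction

/-- The partial inner product with a vector of the first factor. -/
def contract {F V : Type*} [NormedAddCommGroup F] [InnerProductSpace ℂ F] [NormedAddCommGroup V]
    [InnerProductSpace ℂ V] (g : F) : F ⊗[ℂ] V →ₗ[ℂ] V :=
  TensorProduct.lift ((LinearMap.lsmul ℂ V) ∘ₗ (innerSL ℂ g).toLinearMap)

lemma inner_contract {F V : Type*} [NormedAddCommGroup F] [InnerProductSpace ℂ F]
    [NormedAddCommGroup V] [InnerProductSpace ℂ V] (g : F) (v : V) (Φ : F ⊗[ℂ] V) :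
    ⟪v, contract g Φ⟫_ℂ = ⟪g ⊗ₜ[ℂ] v, Φ⟫_ℂ := by
  induction Φ using TensorProduct.induction_on with
  | zero => simp
  | add x y hx hy => rw [map_add, inner_add_right, inner_add_right, hx, hy]
  | tmul f w =>
    have e : contract g (f ⊗ₜ[ℂ] w) = ⟪g, f⟫_ℂ • w := TensorProduct.lift.tmul _ _
    rw [e, inner_smul_right, TensorProduct.inner_tmul]

variable {H : Type*} [NormedAddCommGroup H] [InnerProductSpace ℂ H] [CompleteSpace H] {M : ℕ}
  {m : Fin M → ℕ}

lemma inner_stdTensor {ι : Type} [Fintype ι] [DecidableEq ι] (I J : ι → Fin M) :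
    ⟪(stdTensor I : HilbertTensor ι (EuclideanSpace ℂ (Fin M))), stdTensor J⟫_ℂ =
      if I = J then 1 else 0 := by
  rw [inner_elementary]
  simp only [orthonormal_iff_ite.1 orthonormal_stdVec]
  by_cases hIJ : I = J
  · simp [hIJ]
  · obtain ⟨b, hb⟩ := Function.ne_iff.1 hIJ
    rw [if_neg hIJ, Finset.prod_eq_zero (Finset.mem_univ b) (if_neg hb)]

lemma ext_stdTensor {ι : Type} [Fintype ι] {B : Type*} [NormedAddCommGroup B] [NormedSpace ℂ B]
    {S T : HilbertTensor ι (EuclideanSpace ℂ (Fin M)) →L[ℂ] B}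
    (h : ∀ J : ι → Fin M, S (stdTensor J) = T (stdTensor J))
    (x : HilbertTensor ι (EuclideanSpace ℂ (Fin M))) : S x = T x := by
  refine (mem_ker_clm_sub S T).1 (mem_of_elementary_mem_of_span (isClosed_ker_clm _) span_stdVec
    (fun f hf => ?_) x)
  choose J hJ using hf
  obtain rfl : (fun b => stdVec M (J b)) = f := funext hJ
  exact (mem_ker_clm_sub S T).2 (h J)

/-- A vector of `exp(H ⊗ ℂ^M) ⊗ ℋ_m`, contracted with `x` in the factors from `H`, as an operator
on the tensor power of `ℂ^M`. -/
def contractOp (Φ : Fock (OneParticle H M) ⊗[ℂ] YoungTensors m (EuclideanSpace ℂ (Fin M)))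
    (x : HilbertTensor (Boxes m) H) :
    HilbertTensor (Boxes m) (EuclideanSpace ℂ (Fin M)) →L[ℂ]
      HilbertTensor (Boxes m) (EuclideanSpace ℂ (Fin M)) :=
  ∑ I : Boxes m → Fin M,
    (innerSL ℂ (stdTensor I)).smulRight ((youngSpace m _).subtype (contract (boxTensor I x) Φ))

variable (Φ : Fock (OneParticle H M) ⊗[ℂ] YoungTensors m (EuclideanSpace ℂ (Fin M)))
  (x : HilbertTensor (Boxes m) H)

lemma contractOp_stdTensor (J : Boxes m → Fin M) :
    contractOp Φ x (stdTensor J) =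
      (youngSpace m (EuclideanSpace ℂ (Fin M))).subtype (contract (boxTensor J x) Φ) := by
  rw [contractOp, sum_apply, Finset.sum_eq_single J]
  · change ⟪stdTensor J, stdTensor J⟫_ℂ • (youngSpace m (EuclideanSpace ℂ (Fin M))).subtype (contract (boxTensor J x) Φ) = _
    rw [inner_stdTensor, if_pos rfl, one_smul]
  · intro I _ hI
    change ⟪stdTensor I, stdTensor J⟫_ℂ • (youngSpace m (EuclideanSpace ℂ (Fin M))).subtype (contract (boxTensor I x) Φ) = _
    rw [inner_stdTensor, if_neg hI, zero_smul]
  · simp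

lemma contractOp_mem (t : HilbertTensor (Boxes m) (EuclideanSpace ℂ (Fin M))) :
    contractOp Φ x t ∈ youngSpace m (EuclideanSpace ℂ (Fin M)) := by
  rw [contractOp, sum_apply]
  exact Submodule.sum_mem _ fun I _ => Submodule.smul_mem _ _ (Submodule.coe_mem _)

lemma inner_toYoung_contract (t : HilbertTensor (Boxes m) (EuclideanSpace ℂ (Fin M)))
    (J : Boxes m → Fin M) :
    ⟪youngSymmetrizer m _ t, contractOp Φ x (stdTensor J)⟫_ℂ =
      ⟪boxTensor J x ⊗ₜ[ℂ] toYoung m t, Φ⟫_ℂ := by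
  rw [← inner_contract, contractOp_stdTensor]
  rfl

lemma eq_of_inner_toYoung {v w : HilbertTensor (Boxes m) (EuclideanSpace ℂ (Fin M))}
    (hv : v ∈ youngSpace m _) (hw : w ∈ youngSpace m _)
    (h : ∀ t, ⟪youngSymmetrizer m _ t, v⟫_ℂ = ⟪youngSymmetrizer m _ t, w⟫_ℂ) : v = w := by
  obtain ⟨t, ht⟩ := (youngSpace m _).sub_mem hv hw
  have h1 := h t
  rw [← sub_eq_zero, ← inner_sub_right] at h1
  have ht' : youngSymmetrizer m _ t = v - w := ht
  rw [ht'] at h1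
  exact sub_eq_zero.1 (inner_self_eq_zero.1 h1)

lemma contractOp_permuteFactors (σ : Equiv.Perm (Boxes m))
    (t : HilbertTensor (Boxes m) (EuclideanSpace ℂ (Fin M))) :
    contractOp Φ (permuteFactors (Boxes m) H σ x) t =
      contractOp Φ x (permuteFactors (Boxes m) _ σ⁻¹ t) := by
  refine ext_stdTensor (T := (contractOp Φ x).comp
    (permuteFactors (Boxes m) (EuclideanSpace ℂ (Fin M)) σ⁻¹ : _ →L[ℂ] _)) (fun J => ?_) t
  change _ = contractOp Φ x (permuteFactors (Boxes m) _ σ⁻¹ (stdTensor J))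
  have e : permuteFactors (Boxes m) (EuclideanSpace ℂ (Fin M)) σ⁻¹ (stdTensor J) =
      stdTensor fun b => J (σ b) := permuteFactors_elementary _ _
  rw [e, contractOp_stdTensor, contractOp_stdTensor, boxTensor, fockTensor_permuteFactors]
  rfl

lemma contractOp_rowSymmetrizer (t : HilbertTensor (Boxes m) (EuclideanSpace ℂ (Fin M))) :
    contractOp Φ (rowSymmetrizer m H x) t = contractOp Φ x (rowSymmetrizer m _ t) := by
  refine ext_stdTensor (T := (contractOp Φ x).comp (rowSymmetrizer m _)) (fun J => ?_) t
  change _ = contractOp Φ x (rowSymmetrizer m _ (stdTensor J))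
  -- `contractOp Φ x` is conjugate-linear in `x`, so sums over permutations are expanded inside
  -- inner products with Young-symmetrized vectors.
  refine eq_of_inner_toYoung (contractOp_mem _ _ _) (contractOp_mem _ _ _) fun s => ?_
  rw [inner_toYoung_contract, rowSymmetrizer_apply, rowSymmetrizer_apply, map_sum,
    TensorProduct.sum_tmul, sum_inner, map_sum, inner_sum]
  simp only [← inner_toYoung_contract, contractOp_permuteFactors]
  refine Finset.sum_bij' (fun σ _ => σ⁻¹) (fun σ _ => σ⁻¹) ?_ ?_ (by simp) (by simp) ?_
  · intro σ hσ
    simp only [Finset.mem_filter, Finset.mem_univ, true_and] at hσ ⊢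
    exact row_perm_inv hσ
  · intro σ hσ
    simp only [Finset.mem_filter, Finset.mem_univ, true_and] at hσ ⊢
    exact row_perm_inv hσ
  · intro σ _
    rfl

variable {Φ}

lemma inner_induced (hΦ : Φ ∈ inducedSpace (fockRight H M) (repUM m)) (h : UM M)
    (g : Fock (OneParticle H M)) (v : YoungTensors m (EuclideanSpace ℂ (Fin M))) :
    ⟪fockRight H M (MulOpposite.op h⁻¹) g ⊗ₜ[ℂ] repUM m h v, Φ⟫_ℂ = ⟪g ⊗ₜ[ℂ] v, Φ⟫_ℂ := by
  conv_lhs => rw [← hΦ h]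
  exact (TensorProduct.congrIsometry (fockRight H M (MulOpposite.op h⁻¹))
    (repUM m h)).inner_map_map (g ⊗ₜ[ℂ] v) Φ

/-- The contractions of a vector in the induced space intertwine the action of `U(M)`. -/
lemma contractOp_tensorPower (hΦ : Φ ∈ inducedSpace (fockRight H M) (repUM m)) (h : UM M)
    (t : HilbertTensor (Boxes m) (EuclideanSpace ℂ (Fin M))) :
    contractOp Φ x (tensorPower (Boxes m) _ (definingUM M h) t) =
      tensorPower (Boxes m) _ (definingUM M h) (contractOp Φ x t) := by
  refine ext_stdTensor
    (S := (contractOp Φ x).comp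
      (tensorPower (Boxes m) (EuclideanSpace ℂ (Fin M)) (definingUM M h) : _ →L[ℂ] _))
    (T := (tensorPower (Boxes m) (EuclideanSpace ℂ (Fin M)) (definingUM M h) : _ →L[ℂ] _).comp
      (contractOp Φ x)) (fun L => ?_) t
  change contractOp Φ x (tensorPower (Boxes m) _ (definingUM M h) (stdTensor L)) =
      tensorPower (Boxes m) _ (definingUM M h) (contractOp Φ x (stdTensor L))
  refine eq_of_inner_toYoung (contractOp_mem _ _ _) ?_ fun s => ?_
  · obtain ⟨s, hs⟩ := contractOp_mem Φ x (stdTensor L)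
    rw [← hs]
    exact ⟨_, (tensorPower_youngSymmetrizer m _ _ s).symm⟩
  -- The test vector is written as an image under `h`. Invariance of `Φ` then turns `h` in the
  -- second factor into `h⁻¹` acting on the Fock factor.
  · set s' := tensorPower (Boxes m) _ (definingUM M h⁻¹) s with hs'
    have e1 : youngSymmetrizer m _ s =
        tensorPower (Boxes m) _ (definingUM M h) (youngSymmetrizer m _ s') := by
      rw [tensorPower_youngSymmetrizer, hs', map_inv, map_inv]
      exact congrArg _
        ((tensorPower (Boxes m) _ (definingUM M h)).apply_symm_apply s).symm
    have e2 : toYoung m s = repUM m h (toYoung m s') := Subtype.ext e1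
    rw [e1, LinearIsometryEquiv.inner_map_map, ← e1, inner_toYoung_contract,
      ← inner_induced hΦ h, ← e2, boxTensor, fockRight_fockTensor, tensorPower_definingUM, map_sum,
      inner_sum, TensorProduct.sum_tmul, sum_inner]
    refine Finset.sum_congr rfl fun I _ => ?_
    have e3 : ∀ c : ℂ, ⟪(c • boxTensor I x) ⊗ₜ[ℂ] toYoung m s, Φ⟫_ℂ =
        (starRingEnd ℂ) c * ⟪boxTensor I x ⊗ₜ[ℂ] toYoung m s, Φ⟫_ℂ := fun c => by
      rw [TensorProduct.smul_tmul, ← inner_contract, inner_smul_left, inner_contract]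
    refine Eq.trans ?_ (e3 _).symm
    rw [map_smul, inner_smul_right, inner_toYoung_contract, map_prod]
    congr 1
    refine Finset.prod_congr rfl fun b _ => ?_
    -- The inverse of `h` is its conjugate transpose, so the conjugation from the antilinear entry
    -- of the inner product restores the entries of `h`.
    change _ = (starRingEnd ℂ) ((star (h : Matrix (Fin M) (Fin M) ℂ)) (L b) (I b))
    rw [Matrix.star_apply]
    simp

end Contraction

/-! ### The vectors `coupling (toYoung m) x` span the induced space -/

section Orthogonality

variable {E : Type*} [NormedAddCommGroup E] [InnerProductSpace ℂ E]

/-- The functional `g ↦ ⟪Φ, g ⊗ v⟫`. -/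
def innerTmul {F V : Type*} [NormedAddCommGroup F] [InnerProductSpace ℂ F] [NormedAddCommGroup V]
    [InnerProductSpace ℂ V] (Φ : F ⊗[ℂ] V) (v : V) : F →L[ℂ] ℂ :=
  (innerSL ℂ Φ).comp (((TensorProduct.mk ℂ F V).flip v).mkContinuous ‖v‖ fun g =>
    (TensorProduct.norm_tmul g v).le.trans_eq (mul_comm _ _))

lemma mem_ker_innerTmul {F V : Type*} [NormedAddCommGroup F] [InnerProductSpace ℂ F]
    [NormedAddCommGroup V] [InnerProductSpace ℂ V] (Φ : F ⊗[ℂ] V) (v : V) {g : F} :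
    g ∈ LinearMap.ker (innerTmul Φ v).toLinearMap ↔ ⟪g ⊗ₜ[ℂ] v, Φ⟫_ℂ = 0 := by
  change ⟪Φ, g ⊗ₜ[ℂ] v⟫_ℂ = 0 ↔ _
  exact inner_eq_zero_symm (𝕜 := ℂ) (E := F ⊗[ℂ] V)

lemma ReflectionEquivariant.adjoint {ι : Type} [Fintype ι]
    {A : HilbertTensor ι E →L[ℂ] HilbertTensor ι E} (hA : ReflectionEquivariant A) :
    ReflectionEquivariant (ContinuousLinearMap.adjoint A) := by
  intro e he z x
  refine ext_inner_right ℂ fun y => ?_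
  obtain ⟨y, rfl⟩ := (tensorPower ι E (complexReflection e he z)).surjective y
  rw [ContinuousLinearMap.adjoint_inner_left, hA, LinearIsometryEquiv.inner_map_map,
    LinearIsometryEquiv.inner_map_map, ContinuousLinearMap.adjoint_inner_left]

lemma reflectionEquivariant_zero {ι : Type} [Fintype ι] :
    ReflectionEquivariant (0 : HilbertTensor ι E →L[ℂ] HilbertTensor ι E) :=
  fun _ _ _ _ => (map_zero _).symm

variable {H : Type*} [NormedAddCommGroup H] [InnerProductSpace ℂ H] [CompleteSpace H] {M : ℕ}
  {m : Fin M → ℕ}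
  {Φ : Fock (OneParticle H M) ⊗[ℂ] YoungTensors m (EuclideanSpace ℂ (Fin M))}

lemma reflectionEquivariant_columnAntisymmetrizer :
    ReflectionEquivariant (columnAntisymmetrizer m E) :=
  fun _ _ _ _ => (tensorPower_columnAntisymmetrizer m _ _).symm

lemma reflectionEquivariant_contractOp (hΦ : Φ ∈ inducedSpace (fockRight H M) (repUM m))
    (x : HilbertTensor (Boxes m) H) : ReflectionEquivariant (contractOp Φ x) := by
  intro e he z t
  obtain ⟨g, hg⟩ := exists_definingUM_eq (complexReflection e he z)
  rw [← hg, contractOp_tensorPower x hΦ]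

/-- On row-symmetric tensors, the contractions of a vector in the induced space are multiples of
the Young symmetrizer. -/
lemma exists_contractOp_eq_smul (hm : Antitone m)
    (hΦ : Φ ∈ inducedSpace (fockRight H M) (repUM m)) (x : HilbertTensor (Boxes m) H) :
    ∃ c : ℂ, contractOp Φ x (rowTensor m (stdVec M)) = c • highestVector m (stdVec M) ∧
      ∀ t, contractOp Φ x (rowSymmetrizer m _ t) = c • youngSymmetrizer m _ t := by
  -- The contraction maps the row tensor to a vector of weight `m` in the Young space, hence to a
  -- multiple of the highest vector, which is the column antisymmetrization of that row tensor. Two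
  -- equivariant operators thus agree on a cyclic vector of the row-symmetrized tensors.
  have h1 := eq_smul_highestVector hm (isRowFrame_stdVec m)
    (columnAntisymmetric_of_mem_youngSpace (contractOp_mem Φ x (rowTensor m (stdVec M))))
    ((hasShapeWeight_rowTensor (isRowFrame_stdVec m)).map (reflectionEquivariant_contractOp hΦ x))
  exact ⟨_, h1, (reflectionEquivariant_contractOp hΦ x).eqOn_rowSymmetrizer
    (reflectionEquivariant_smul _ reflectionEquivariant_columnAntisymmetrizer)
    (isRowFrame_stdVec m) h1⟩

lemma inner_coupling_toYoung (x : HilbertTensor (Boxes m) H) :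
    ⟪coupling (toYoung m) x, Φ⟫_ℂ = ∑ I : Boxes m → Fin M,
      ⟪youngSymmetrizer m _ (stdTensor I), contractOp Φ x (stdTensor I)⟫_ℂ := by
  rw [coupling_apply, sum_inner]
  exact Finset.sum_congr rfl fun I _ => (inner_toYoung_contract Φ x _ I).symm

/-- Orthogonality to D applied to the row symmetrization of `x` reads c ∑ I, ‖Y e_I‖² = 0. The
summand for the filling by row numbers is nonzero, so the scalar c vanishes. -/
lemma contractOp_rowTensor_eq_zero (hm : Antitone m)
    (hΦ : Φ ∈ inducedSpace (fockRight H M) (repUM m))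
    (h0 : ∀ x : HilbertTensor (Boxes m) H, ⟪coupling (toYoung m) x, Φ⟫_ℂ = 0)
    (x : HilbertTensor (Boxes m) H) : contractOp Φ x (rowTensor m (stdVec M)) = 0 := by
  obtain ⟨c, h1, h2⟩ := exists_contractOp_eq_smul hm hΦ x
  have h3 := h0 (rowSymmetrizer m H x)
  rw [inner_coupling_toYoung] at h3
  simp only [contractOp_rowSymmetrizer, h2, inner_smul_right, inner_self_eq_norm_sq_to_K] at h3
  rw [← Finset.mul_sum] at h3
  rcases mul_eq_zero.1 h3 with hc | hs
  · rw [h1, hc, zero_smul]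
  · exfalso
    have hs' : ∑ I : Boxes m → Fin M,
        ‖youngSymmetrizer m (EuclideanSpace ℂ (Fin M)) (stdTensor I)‖ ^ 2 = 0 := by
      have : ((∑ I : Boxes m → Fin M,
        ‖youngSymmetrizer m (EuclideanSpace ℂ (Fin M)) (stdTensor I)‖ ^ 2 : ℝ) : ℂ) = 0 := by
        push_cast
        exact hs
      exact_mod_cast this
    rw [Finset.sum_eq_zero_iff_of_nonneg fun _ _ => sq_nonneg _] at hs'
    have h4 := hs' (fun b => b.1) (Finset.mem_univ _)
    have h5 : youngSymmetrizer m _ (rowTensor m (stdVec M)) = 0 :=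
      norm_eq_zero.1 (pow_eq_zero_iff two_ne_zero |>.1 h4)
    rw [youngSymmetrizer_rowTensor] at h5
    exact smul_ne_zero rowOrder_ne_zero (highestVector_ne_zero (isRowFrame_stdVec m)) h5

/-- Comparison of weights leaves only the `J` of content `m`. Then e_J is a permuted row tensor, and
the permutation can be moved to `x`, where the hypothesis holds for every tensor. -/
lemma inner_highestVector_contractOp (hΦ : Φ ∈ inducedSpace (fockRight H M) (repUM m))
    (h0 : ∀ x : HilbertTensor (Boxes m) H, contractOp Φ x (rowTensor m (stdVec M)) = 0)
    (x : HilbertTensor (Boxes m) H) (J : Boxes m → Fin M) :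
    ⟪highestVector m (stdVec M), contractOp Φ x (stdTensor J)⟫_ℂ = 0 := by
  by_contra hne
  have hJ : HasShapeContent J := fun k => by
    have := eq_content_of_inner_ne_zero (w := contractOp Φ x (stdTensor J)) (J := J)
      tensorPower_torusUM_highestVector
      (fun z => by rw [← contractOp_tensorPower x hΦ, tensorPower_torusUM, map_smul]) hne k
    exact_mod_cast this.symm
  obtain ⟨σ, hσ⟩ := hJ.exists_perm
  have e1 : stdTensor J = permuteFactors (Boxes m) _ σ⁻¹ (rowTensor m (stdVec M)) := by
    rw [rowTensor, permuteFactors_elementary]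
    refine congrArg elementary (funext fun b => ?_)
    rw [← hσ]
    rfl
  rw [e1, ← contractOp_permuteFactors, h0, inner_zero_right] at hne
  exact hne rfl

/-- The adjoint kills the highest vector, hence by cyclicity the whole Young space, which contains
the range of the contraction. -/
lemma contractOp_eq_zero (hm : Antitone m) (hΦ : Φ ∈ inducedSpace (fockRight H M) (repUM m))
    (h0 : ∀ x : HilbertTensor (Boxes m) H, ⟪coupling (toYoung m) x, Φ⟫_ℂ = 0)
    (x : HilbertTensor (Boxes m) H) (t : HilbertTensor (Boxes m) (EuclideanSpace ℂ (Fin M))) :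
    contractOp Φ x t = 0 := by
  have h1 : ContinuousLinearMap.adjoint (contractOp Φ x) (highestVector m (stdVec M)) = 0 :=
    eq_zero_of_inner_elementary_stdVec fun J => by
      rw [ContinuousLinearMap.adjoint_inner_left]
      exact inner_highestVector_contractOp hΦ (contractOp_rowTensor_eq_zero hm hΦ h0) x J
  have h2 := (reflectionEquivariant_contractOp hΦ x).adjoint.eqOn_youngSpace
    reflectionEquivariant_zero (isRowFrame_stdVec m) h1 (contractOp_mem Φ x t)
  rw [← inner_self_eq_zero (𝕜 := ℂ), ← ContinuousLinearMap.adjoint_inner_left, h2]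
  exact inner_zero_left _

lemma toYoung_surjective : Function.Surjective (toYoung m) :=
  LinearMap.surjective_rangeRestrict _

lemma repUM_center (ζ : Circle) (v : YoungTensors m (EuclideanSpace ℂ (Fin M))) :
    repUM m (torusUM fun _ => ζ) v = (ζ : ℂ) ^ Fintype.card (Boxes m) • v := by
  obtain ⟨t, rfl⟩ := toYoung_surjective v
  rw [repUM_toYoung, ← map_smul]
  congr 1
  refine ext_stdTensor
    (S := (tensorPower (Boxes m) (EuclideanSpace ℂ (Fin M))
      (definingUM M (torusUM fun _ => ζ)) : _ →L[ℂ] _))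
    (T := (ζ : ℂ) ^ Fintype.card (Boxes m) • ContinuousLinearMap.id ℂ _) (fun J => ?_) t
  change tensorPower (Boxes m) (EuclideanSpace ℂ (Fin M))
    (definingUM M (torusUM fun _ => ζ)) (stdTensor J) = _
  rw [tensorPower_torusUM, Finset.prod_const, Finset.card_univ]
  rfl

/-- In the induced space only the degree `|m|` of the Fock space occurs. -/
lemma inner_fockOf_eq_zero (hΦ : Φ ∈ inducedSpace (fockRight H M) (repUM m)) {n : ℕ}
    (hn : n ≠ Fintype.card (Boxes m)) (f : Fin n → OneParticle H M)
    (v : YoungTensors m (EuclideanSpace ℂ (Fin M))) :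
    ⟪fockOf (OneParticle H M) n (symmetrize (OneParticle H M) n (elementary f)) ⊗ₜ[ℂ] v, Φ⟫_ℂ =
      0 := by
  set g := fockOf (OneParticle H M) n (symmetrize (OneParticle H M) n (elementary f)) with hg
  by_contra hne
  refine hn ?_
  have key : ∀ ζ : Circle, (ζ : ℂ) ^ (n : ℤ) = (ζ : ℂ) ^ (Fintype.card (Boxes m) : ℤ) := by
    intro ζ
    -- Invariance under a scalar matrix compares `ζ ^ n` on the Fock factor with `ζ ^ |m|` on the
    -- second factor.
    have h1 := inner_induced hΦ (torusUM fun _ => ζ)⁻¹ g (repUM m (torusUM fun _ => ζ) v)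
    have h2 : repUM m (torusUM fun _ => ζ)⁻¹ (repUM m (torusUM fun _ => ζ) v) = v := by
      rw [map_inv]
      exact (repUM m (torusUM fun _ => ζ)).symm_apply_apply v
    rw [h2, inv_inv, hg, fockRight_center_elementary, ← hg, repUM_center, TensorProduct.smul_tmul,
      ← inner_contract, ← inner_contract, inner_smul_left, inner_smul_left, inner_contract] at h1
    rw [zpow_natCast, zpow_natCast]
    exact (starRingEnd ℂ).injective (mul_right_cancel₀ hne h1)
  exact_mod_cast circle_zpow_injective key

/-- A vector in the induced space that is orthogonal to all `coupling (toYoung m) x` vanishes. -/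
theorem eq_zero_of_inner_coupling (hm : Antitone m)
    (hΦ : Φ ∈ inducedSpace (fockRight H M) (repUM m))
    (h0 : ∀ x : HilbertTensor (Boxes m) H, ⟪coupling (toYoung m) x, Φ⟫_ℂ = 0) : Φ = 0 := by
  have h1 : ∀ (g : Fock (OneParticle H M)) (v : YoungTensors m (EuclideanSpace ℂ (Fin M))),
      ⟪g ⊗ₜ[ℂ] v, Φ⟫_ℂ = 0 := by
    intro g v
    refine (mem_ker_innerTmul Φ v).1 (mem_of_fockOf_symmetrize_mem (isClosed_ker_clm _) span_slot
      (fun n f hf => (mem_ker_innerTmul Φ v).2 ?_) g)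
    rcases eq_or_ne n (Fintype.card (Boxes m)) with rfl | hn
    · choose x I hx using hf
      -- In degree |m| the factors can be indexed by the boxes, and the inner products with `Φ` are
      -- those recorded by `contractOp`.
      have e : fockOf (OneParticle H M) _ (symmetrize (OneParticle H M) _ (elementary f)) =
          boxTensor (fun b => I (Fintype.equivFin (Boxes m) b))
            (elementary fun b => x (Fintype.equivFin (Boxes m) b)) := by
        rw [boxTensor, fockTensor_elementary]
        simp only [Equiv.apply_symm_apply, ← hx]
      obtain ⟨t, rfl⟩ := toYoung_surjective v
      rw [e, ← inner_toYoung_contract, contractOp_eq_zero hm hΦ h0, inner_zero_right]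
    · exact inner_fockOf_eq_zero hΦ hn f v
  have h2 : ∀ Ψ : Fock (OneParticle H M) ⊗[ℂ] YoungTensors m (EuclideanSpace ℂ (Fin M)),
      ⟪Ψ, Φ⟫_ℂ = 0 := fun Ψ => by
    induction Ψ using TensorProduct.induction_on with
    | zero => exact inner_zero_left _
    | add x y hx hy => rw [inner_add_left, hx, hy, add_zero]
    | tmul g v => exact h1 g v
  exact inner_self_eq_zero.1 (h2 Φ)

end Orthogonality

/-! ### The unitary equivalence -/

section Equivalence

variable {H : Type*} [NormedAddCommGroup H] [InnerProductSpace ℂ H] [CompleteSpace H] {M : ℕ}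
  {m : Fin M → ℕ}

/-- The Young symmetrizer moves from `x` to ℂ^M, where it meets the one in `toYoung m` and acts as
the scalar `c`. Hence D has the same range on the Young space as on all tensors. -/
lemma exists_coupling_youngSymmetrizer (hm : Antitone m) : ∃ c : ℂ, c ≠ 0 ∧
    ∀ x : HilbertTensor (Boxes m) H,
      coupling (toYoung m) (youngSymmetrizer m H x) = c • coupling (toYoung m) x := by
  obtain ⟨c, hc0, hc⟩ := exists_youngSymmetrizer_eq_smul hm (isRowFrame_stdVec m)
  refine ⟨c, hc0, fun x => ?_⟩
  rw [coupling_youngSymmetrizer, coupling_apply, coupling_apply, Finset.smul_sum]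
  refine Finset.sum_congr rfl fun I _ => ?_
  have e : toYoung m (youngSymmetrizer m _ (stdTensor I)) = c • toYoung m (stdTensor I) :=
    Subtype.ext (hc _ (youngSymmetrizer_mem _))
  change boxTensor I x ⊗ₜ[ℂ] toYoung m (youngSymmetrizer m _ (stdTensor I)) = _
  rw [e, TensorProduct.tmul_smul]

lemma coupling_highestVector_ne_zero (hm : Antitone m) {h : Fin M → H} (hh : IsRowFrame m h) :
    coupling (toYoung m) (highestVector m h) ≠ 0 := by
  intro h0
  obtain ⟨c, hc0, hc⟩ := exists_coupling_youngSymmetrizer (H := H) hm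
  have h1 := hc (rowTensor m h)
  rw [youngSymmetrizer_rowTensor, map_smul, h0, smul_zero] at h1
  exact smul_ne_zero hc0 (coupling_rowTensor_ne_zero hh) h1.symm

/-- The operator `D† D` for the map `D = coupling φ`. -/
def couplingGram {V : Type*} [NormedAddCommGroup V] [InnerProductSpace ℂ V]
    (φ : HilbertTensor (Boxes m) (EuclideanSpace ℂ (Fin M)) →ₗ[ℂ] V) :
    HilbertTensor (Boxes m) H →L[ℂ] HilbertTensor (Boxes m) H :=
  ∑ I : Boxes m → Fin M, ∑ K : Boxes m → Fin M, ⟪φ (stdTensor I), φ (stdTensor K)⟫_ℂ •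
    (ContinuousLinearMap.adjoint (boxTensor I)).comp (boxTensor K)

lemma inner_couplingGram {V : Type*} [NormedAddCommGroup V] [InnerProductSpace ℂ V]
    (φ : HilbertTensor (Boxes m) (EuclideanSpace ℂ (Fin M)) →ₗ[ℂ] V)
    (x y : HilbertTensor (Boxes m) H) :
    ⟪x, couplingGram φ y⟫_ℂ = ⟪coupling φ x, coupling φ y⟫_ℂ := by
  rw [inner_coupling, couplingGram, sum_apply, inner_sum]
  refine Finset.sum_congr rfl fun I _ => ?_
  rw [sum_apply, inner_sum]
  refine Finset.sum_congr rfl fun K _ => ?_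
  change ⟪x, ⟪φ (stdTensor I), φ (stdTensor K)⟫_ℂ •
    ContinuousLinearMap.adjoint (boxTensor I) (boxTensor K y)⟫_ℂ = _
  rw [inner_smul_right, ContinuousLinearMap.adjoint_inner_right]

/-- The reflections lie in U₀(H), whose action D intertwines with a unitary one, so the form ⟪D x, D
y⟫ is invariant. -/
lemma reflectionEquivariant_couplingGram {V : Type*} [NormedAddCommGroup V]
    [InnerProductSpace ℂ V]
    (φ : HilbertTensor (Boxes m) (EuclideanSpace ℂ (Fin M)) →ₗ[ℂ] V) :
    ReflectionEquivariant (couplingGram (H := H) φ) := by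
  intro e he z y
  obtain ⟨g, hg⟩ := exists_definingU0_eq_complexReflection e he z
  refine ext_inner_left ℂ fun x => ?_
  obtain ⟨x, rfl⟩ := (tensorPower (Boxes m) H (complexReflection e he z)).surjective x
  rw [LinearIsometryEquiv.inner_map_map, inner_couplingGram, inner_couplingGram, ← hg,
    ← ampliation_coupling, ← ampliation_coupling, LinearIsometryEquiv.inner_map_map]

lemma reflectionInvariant_youngSpace : ReflectionInvariant (youngSpace m H) := by
  rintro e he z _ ⟨x, rfl⟩
  exact ⟨_, (tensorPower_youngSymmetrizer m H _ x).symm⟩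

/-- On the space of Young-symmetrized tensors, `coupling (toYoung m)` is a multiple of an
isometry. -/
lemma exists_inner_coupling_eq (hm : Antitone m) {h : Fin M → H} (hh : IsRowFrame m h) :
    ∃ r : ℝ, 0 < r ∧ ∀ x ∈ youngSpace m H, ∀ y ∈ youngSpace m H,
      ⟪coupling (toYoung m) x, coupling (toYoung m) y⟫_ℂ = r * ⟪x, y⟫_ℂ := by
  have : CompleteSpace (youngSpace m H) := (isClosed_youngSpace hm hh).completeSpace_coe
  have hP := reflectionEquivariant_starProjection (reflectionInvariant_youngSpace (m := m) (H := H))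
  have hG := reflectionEquivariant_couplingGram (H := H) (toYoung m)
  -- Schur's lemma needs the highest vector to be sent into the Young space; the compression by the
  -- projection ensures this and does not affect inner products with Young tensors.
  have hA : ReflectionEquivariant
      ((youngSpace m H).starProjection.comp (couplingGram (toYoung m))) := by
    intro e he z x
    change (youngSpace m H).starProjection (couplingGram (toYoung m) _) = _
    rw [hG, hP]
    rfl
  obtain ⟨c, hc⟩ := hA.exists_smul hm hh ((youngSpace m H).starProjection_apply_mem _)
  have key : ∀ x ∈ youngSpace m H, ∀ y ∈ youngSpace m H,
      ⟪coupling (toYoung m) x, coupling (toYoung m) y⟫_ℂ = c * ⟪x, y⟫_ℂ := by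
    intro x hx y hy
    have h1 : (youngSpace m H).starProjection (couplingGram (toYoung m) y) = c • y := hc y hy
    rw [← inner_smul_right, ← h1, ← Submodule.inner_starProjection_left_eq_right,
      Submodule.starProjection_eq_self_iff.2 hx, inner_couplingGram]
  -- Evaluation on the highest vector, whose image is nonzero, identifies the scalar as a positive
  -- real number.
  have hv := key _ (highestVector_mem h) _ (highestVector_mem h)
  have hpos1 : 0 < ‖coupling (toYoung m) (highestVector m h)‖ ^ 2 :=
    pow_pos (norm_pos_iff.2 (coupling_highestVector_ne_zero hm hh)) 2
  have hpos2 : 0 < ‖highestVector m h‖ ^ 2 :=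
    pow_pos (norm_pos_iff.2 (highestVector_ne_zero hh)) 2
  refine ⟨‖coupling (toYoung m) (highestVector m h)‖ ^ 2 / ‖highestVector m h‖ ^ 2,
    div_pos hpos1 hpos2, fun x hx y hy => ?_⟩
  rw [key x hx y hy]
  congr 1
  rw [inner_self_eq_norm_sq_to_K (highestVector m h)] at hv
  have hv' := (inner_self_eq_norm_sq_to_K (𝕜 := ℂ)
    (coupling (toYoung m) (highestVector m h))).symm.trans hv
  rw [Complex.ofReal_div, eq_div_iff (by exact_mod_cast hpos2.ne')]
  push_cast
  exact hv'.symm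

/-- A multiple of an isometry with dense range on a Hilbert space is a multiple of a unitary. -/
lemma exists_linearIsometryEquiv_eq_smul {X Y : Type*} [NormedAddCommGroup X]
    [InnerProductSpace ℂ X] [CompleteSpace X] [NormedAddCommGroup Y] [InnerProductSpace ℂ Y]
    (D : X →ₗ[ℂ] Y) {r : ℝ} (hr : 0 < r) (hD : ∀ x y, ⟪D x, D y⟫_ℂ = r * ⟪x, y⟫_ℂ)
    (hdense : ∀ y, (∀ x, ⟪D x, y⟫_ℂ = 0) → y = 0) :
    ∃ (U : X ≃ₗᵢ[ℂ] Y) (s : ℂ), ∀ x, U x = s • D x := by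
  let s : ℂ := ((Real.sqrt r)⁻¹ : ℝ)
  have hs : (starRingEnd ℂ) s * s * r = 1 := by
    rw [Complex.conj_ofReal, ← Complex.ofReal_mul, ← Complex.ofReal_mul, ← Complex.ofReal_one]
    congr 1
    rw [← mul_inv, Real.mul_self_sqrt hr.le, inv_mul_cancel₀ hr.ne']
  have hs0 : s ≠ 0 := fun h0 => by rw [h0, mul_zero, zero_mul] at hs; exact zero_ne_one hs
  let T : X →ₗᵢ[ℂ] Y := (s • D).isometryOfInner fun x y => by
    rw [LinearMap.smul_apply, LinearMap.smul_apply, inner_smul_left, inner_smul_right, hD,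
      ← mul_assoc, ← mul_assoc, hs, one_mul]
  -- The range is complete as an isometric image of `X`, so a trivial orthogonal complement implies
  -- surjectivity although `Y` is not assumed complete.
  have hcomplete : CompleteSpace (LinearMap.range T.toLinearMap) :=
    T.isometry.isUniformInducing.isComplete_range.completeSpace_coe
  have hsurj : Function.Surjective T := by
    refine (LinearMap.range_eq_top (f := T.toLinearMap)).1 ?_
    rw [← Submodule.orthogonal_eq_bot_iff, Submodule.eq_bot_iff]
    refine fun y hy => hdense y fun x => ?_
    have h1 : ⟪s • D x, y⟫_ℂ = 0 := (Submodule.mem_orthogonal _ _).1 hy _ ⟨x, rfl⟩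
    rw [inner_smul_left] at h1
    exact (mul_eq_zero.1 h1).resolve_left ((map_ne_zero _).2 hs0)
  exact ⟨LinearIsometryEquiv.ofSurjective T hsurj, s, fun _ => rfl⟩

variable (H m) in
/-- The map `coupling (toYoung m)`, from the Young-symmetrized tensors to the induced space. -/
def toInduced : YoungTensors m H →ₗ[ℂ] Induced (fockRight H M) (repUM m) :=
  LinearMap.codRestrict (inducedSpace (fockRight H M) (repUM m))
    (coupling (toYoung m) ∘ₗ (youngSpace m H).subtype) fun _ => coupling_mem _

lemma toInduced_repU0 (g : U0 H) (x : YoungTensors m H) :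
    toInduced H m (repU0 H m g x) = rieffelRep H m g (toInduced H m x) :=
  Subtype.ext (ampliation_coupling (toYoung m) g (show youngSpace m H from x).1).symm

theorem unitarilyEquivalent_rieffelRep (hm : Antitone m) {h : Fin M → H} (hh : IsRowFrame m h) :
    UnitarilyEquivalent (rieffelRep H m) (repU0 H m) := by
  obtain ⟨r, hr, hrD⟩ := exists_inner_coupling_eq hm hh
  obtain ⟨c, hc0, hc⟩ := exists_coupling_youngSymmetrizer (H := H) hm
  have : CompleteSpace (YoungTensors m H) := completeSpace_youngTensors hm hh
  obtain ⟨U, s, hU⟩ := exists_linearIsometryEquiv_eq_smul (toInduced H m) hr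
    (fun x y => hrD _ (show youngSpace m H from x).2 _ (show youngSpace m H from y).2) (by
      rintro ⟨Φ, hΦ⟩ hperp
      refine Subtype.ext (eq_zero_of_inner_coupling hm hΦ fun x => ?_)
      -- Orthogonality is known only for Young tensors; since D Y = c D with `c ≠ 0`, it extends to
      -- all `x`.
      have h1 : ⟪coupling (toYoung m) (youngSymmetrizer m H x), Φ⟫_ℂ = 0 :=
        hperp ⟨_, youngSymmetrizer_mem x⟩
      rw [hc] at h1
      exact (mul_eq_zero.1 ((inner_smul_left (𝕜 := ℂ) (coupling (toYoung m) x) Φ c).symm.trans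
        h1)).resolve_left ((map_ne_zero _).2 hc0))
  refine ⟨U.symm, fun g v => ?_⟩
  rw [LinearIsometryEquiv.symm_apply_eq, hU, toInduced_repU0, ← map_smul, ← hU,
    LinearIsometryEquiv.apply_symm_apply]

end Equivalence

end FockInduction

end

theorem theorem2 {H : Type*} [NormedAddCommGroup H] [InnerProductSpace ℂ H] [CompleteSpace H]
    [TopologicalSpace.SeparableSpace H] {M : ℕ} (m : Fin M → ℕ) (hm : Antitone m)
    (hdim : ((Finset.univ.filter fun i => 0 < m i).card : Cardinal) ≤ Module.rank ℂ H) :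
    (IsIrreducibleUnitaryRep (repUM m) ∧ HasHighestWeight (repUM m) fun i => (m i : ℤ)) ∧
      IsIrreducibleUnitaryRep (repU0 H m) ∧
        UnitarilyEquivalent (rieffelRep H m) (repU0 H m) := by
  obtain ⟨h, hh⟩ := exists_isRowFrame m hdim
  exact ⟨⟨isIrreducibleUnitaryRep_repUM hm, hasHighestWeight_repUM hm⟩,
    isIrreducibleUnitaryRep_repU0 hm hh, unitarilyEquivalent_rieffelRep hm hh⟩
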